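/- Let $(W,S_W)$ be a Coxeter system with length function $\ell$, let $P\le W$ be the parabolic subgroup generated by a subset $S_P\subseteq S_W$, and let ${}^PW$ be the set of minimal length representatives of the cosets $P\backslash W$, with the strong Bruhat order $\le$; let $\varnothing$ denote the identity. The Bruhat graph of $(W,P)$ is the directed graph on ${}^PW$ with an edge $\lambda\to\lambda s_i$ (labelled $i$) whenever $\lambda<\lambda s_i\in{}^PW$. In the extended Bruhat graph every such edge is replaced by four edges labelled $i$: $\lambda\to\lambda s_i$ and $\lambda s_i\to\lambda$ of degree $0$, $\lambda\to\lambda$ of degree $1$, and $\lambda s_i\to\lambda s_i$ of degree $-1$. The degree of a path is the sum of the degrees of its edges and its weight is the sequence of its labels. For every $\mu\in{}^PW$ fix a path $T^\mu$ of shortest possible length from $\varnothing$ to $\mu$ in the extended graph, let $\mathrm{Path}(\lambda,T^\mu)$ be the set of paths from $\varnothing$ to $\lambda$ of the same weight as $T^\mu$, and put $\Delta_{\lambda,\mu}=\sum_{S\in \mathrm{Path}(\lambda,T^\mu)}q^{\deg S}$. The Kazhdan--Lusztig matrix $N^{(W,P)}=(n_{\lambda,\mu})$, together with $(b_{\lambda,\mu})$,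 is defined recursively by $n_{\lambda,\lambda}=b_{\lambda,\lambda}=1$ and, for $\lambda\ne\mu$, $$b_{\lambda,\mu}+n_{\lambda,\mu}=\Delta_{\lambda,\mu}-\sum_{\lambda<\nu<\mu}n_{\lambda,\nu}b_{\nu,\mu},\qquad b_{\lambda,\mu}\in\mathbb Z[q+q^{-1}],\quad n_{\lambda,\mu}\in q\mathbb Z[q].$$ In type $(C_n,A_{n-1})$ represent $w\in W$ by a row of $n+1$ labels in $\{\wedge,\vee,\circ\}$, in positions $1,\dots,n+1$: the identity is $\circ\vee\cdots\vee$, and right multiplication by the generators $s_{1'},s_2,\dots,s_n$ acts as follows: $s_i$ swaps the labels in positions $i,i+1$, and $s_{1'}$ flips the label in position $2$ ($\wedge\leftrightarrow\vee$). In type $(D_{n+1},A_n)$ use rows of $n+1$ labels, with the identity $\vee\cdots\vee$ and generators $s_{1''},s_1,\dots,s_n$: $s_i$ swaps the labels in positions $i,i+1$, and $s_{1''}$ swaps and flips the labels in positions $1$ and $2$. The parabolic is generated by all generators except $s_{1'}$, respectively $s_{1''}$. The parabolic of $(B_n,B_{n-1})$ is generated by all simple reflections except the one at the end of the Coxeter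 graph opposite to the edge of order $4$, and that of $(A_{2n-1},A_{2n-2})$ by all simple reflections except one of the two at the ends of the Coxeter graph (the statement holds for either choice). Let $n\ge2$, and let the reduced paths $T^\mu$ be chosen arbitrarily in every type. (1) There is a unique map ${}^{A_{n-1}}C_n\to{}^{A_n}D_{n+1}$, $\lambda\mapsto\overline\lambda$, such that the diagram of $\overline\lambda$ is obtained from that of $\lambda$ by replacing $\circ$ by $\wedge$ or $\vee$ so that the total number of $\wedge$ is even; it is a bijection, for each $\lambda$ the element $\overline\lambda$ is the only one of ${}^{A_n}D_{n+1}$ with this diagram, and for all $\lambda,\mu\in{}^{A_{n-1}}C_n$ $$N^{(C_n,A_{n-1})}_{\lambda,\mu}=N^{(D_{n+1},A_n)}_{\overline\lambda,\overline\mu}.$$ (2) There is a unique bijection ${}^{B_{n-1}}B_n\to{}^{A_{2n-2}}A_{2n-1}$, $\lambda\mapsto\tilde\lambda$, that is an isomorphism of the (directed, unlabelled) Bruhat graphs, and for all $\lambda,\mu\in{}^{B_{n-1}}B_n$ $$N^{(B_n,B_{n-1})}_{\lambda,\mu}=N^{(A_{2n-1},A_{2n-2})}_{\tilde\lambda,\tilde\mu}.$$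 -/

import Mathlib

/-! Anti-spherical Kazhdan-Lusztig matrices of a parabolic Coxeter system `(W, P)`,
where `W` is the Coxeter group of the matrix `M` and `P` is generated by the simple
reflections in `J`. -/

namespace ParabolicKL

open scoped LaurentPolynomial

section General

variable {B : Type} (M : CoxeterMatrix B) (J : Set B)

/-- The length function of `W`. -/
noncomputable def len (w : M.Group) : ℕ := M.toCoxeterSystem.length w

/-- The standard parabolic subgroup `P`. -/
def parabolic : Subgroup M.Group := Subgroup.closure (M.simple '' J)

/-- `^P W`: the elements of minimal length in their coset `P w`. -/
def CosetRep : Type :=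
  {w : M.Group // ∀ p ∈ parabolic M J, len M w ≤ len M (p * w)}

/-- The identity element, the representative of the trivial coset `P`. -/
noncomputable def CosetRep.empty : CosetRep M J :=
  ⟨1, fun p _ => by simp [len]⟩

variable {M J}

/-- Strong Bruhat order on `W`: some reduced expression of `w` has a subword that is a
reduced expression of `y`. -/
def BruhatLE (y w : M.Group) : Prop :=
  ∃ ω η : List B, M.toCoxeterSystem.IsReduced ω ∧ M.toCoxeterSystem.wordProd ω = w ∧
    η.Sublist ω ∧ M.toCoxeterSystem.IsReduced η ∧ M.toCoxeterSystem.wordProd η = y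

/-- The strict Bruhat order on `^P W`. -/
def CosetRep.Lt (α β : CosetRep M J) : Prop := BruhatLE α.1 β.1 ∧ α ≠ β

/-- `α → β = α sᵢ` is an edge with label `i` of the Bruhat graph: `α < α sᵢ ∈ ^P W`. -/
def LabelledEdge (i : B) (α β : CosetRep M J) : Prop :=
  β.1 = α.1 * M.simple i ∧ α.Lt β

variable (M J) in
/-- The directed edges of the Bruhat graph of `(W, P)`, labels forgotten. -/
def BruhatEdge (α β : CosetRep M J) : Prop := ∃ i, LabelledEdge i α β

/-- `α → β` is an edge with label `i` of the extended Bruhat graph: each edge of the Bruhat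
graph between `α` and `γ = α sᵢ` (in either direction) gives edges `α → α` and `α → γ`. -/
def ExtEdge (i : B) (α β : CosetRep M J) : Prop :=
  ∃ γ : CosetRep M J, (LabelledEdge i α γ ∨ LabelledEdge i γ α) ∧ (β = α ∨ β = γ)

open Classical in
/-- The degree of an edge `α → β` with label `i`: it is `0` if `β = α sᵢ`; a loop `α → α` has
degree `1` if `α sᵢ > α` and degree `-1` if `α sᵢ < α`. -/
noncomputable def edgeDegree (i : B) (α β : CosetRep M J) : ℤ :=
  if β = α then (if BruhatLE α.1 (α.1 * M.simple i) then 1 else -1) else 0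

/-- Paths on the extended Bruhat graph from `α` to `γ`; the list is the weight of the path, i.e.
the sequence of its edge labels. -/
inductive Stroll : CosetRep M J → List B → CosetRep M J → Type
  | nil (α : CosetRep M J) : Stroll α [] α
  | cons {α β γ : CosetRep M J} {ω : List B} (i : B) (h : ExtEdge i α β)
      (S : Stroll β ω γ) : Stroll α (i :: ω) γ

/-- The degree of a path is the sum of the degrees of its edges. -/
noncomputable def Stroll.degree :
    {α : CosetRep M J} → {ω : List B} → {γ : CosetRep M J} → Stroll α ω γ → ℤ
  | _, _, _, .nil _ => 0
  | α, _, _, .cons (β := β) i _ S => edgeDegree i α β + S.degree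

/-- A reduced path from `∅` to `μ`: one of the shortest possible length. -/
structure ReducedPath (μ : CosetRep M J) where
  word : List B
  path : Stroll (CosetRep.empty M J) word μ
  minimal : ∀ ω : List B, Nonempty (Stroll (CosetRep.empty M J) ω μ) → word.length ≤ ω.length

/-- The paths with given end points and given weight form a finite set, so that the sum in
`lightLeaves` is a finite sum. -/
instance Stroll.instFinite (α : CosetRep M J) (ω : List B) (γ : CosetRep M J) :
    Finite (Stroll α ω γ) := by
  induction ω generalizing α with
  | nil =>
    have : Subsingleton (Stroll α [] γ) := ⟨by
      intro S S'
      cases S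
      cases S'
      rfl⟩
    infer_instance
  | cons i ω ih =>
    have hfin : Finite {β : CosetRep M J // ExtEdge i α β} := by
      have : {β : CosetRep M J | ExtEdge i α β}.Finite := by
        by_cases hγ : ∃ γ : CosetRep M J, γ.1 = α.1 * M.simple i
        · obtain ⟨δ, hδ⟩ := hγ
          refine (Set.toFinite {α, δ}).subset ?_
          rintro β ⟨γ, h, hβ⟩
          have hγδ : γ = δ := by
            apply Subtype.ext
            rcases h with h | h
            · rw [h.1, hδ]
            · rw [hδ, h.1, mul_assoc]
              have := M.toCoxeterSystem.simple_mul_simple_self i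
              rw [M.toCoxeterSystem_simple] at this
              rw [this, mul_one]
          subst hγδ
          simpa using hβ
        · refine Set.finite_empty.subset ?_
          rintro β ⟨γ, h, -⟩
          refine hγ ⟨γ, ?_⟩
          rcases h with h | h
          · exact h.1
          · rw [h.1, mul_assoc]
            have := M.toCoxeterSystem.simple_mul_simple_self i
            rw [M.toCoxeterSystem_simple] at this
            rw [this, mul_one]
      exact this
    let f : Stroll α (i :: ω) γ → Σ β : {β : CosetRep M J // ExtEdge i α β}, Stroll β.1 ω γ :=
      fun S => match S with
        | .cons (β := β) _ h S => ⟨⟨β, h⟩, S⟩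
    refine Finite.of_injective f ?_
    intro S S' h
    cases S with
    | cons _ h1 S1 =>
      cases S' with
      | cons _ h2 S2 =>
        simp only [f, Sigma.mk.injEq, Subtype.mk.injEq] at h
        obtain ⟨rfl, h⟩ := h
        cases h
        rfl

/-- The entry `Δ_{λ,μ} = ∑ q ^ deg S` of the matrix of light leaves polynomials, the sum being
over the paths `S` from `∅` to `lam` whose weight is that of the fixed reduced path `t μ`. -/
noncomputable def lightLeaves (t : ∀ μ : CosetRep M J, ReducedPath μ)
    (lam μ : CosetRep M J) : ℤ[T;T⁻¹] :=
  ∑ᶠ S : Stroll (CosetRep.empty M J) (t μ).word lam, LaurentPolynomial.T S.degree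

/-- The subring `ℤ[q + q⁻¹]` of `ℤ[q, q⁻¹]`. -/
noncomputable def selfDual : Subalgebra ℤ ℤ[T;T⁻¹] :=
  Algebra.adjoin ℤ {LaurentPolynomial.T 1 + LaurentPolynomial.T (-1)}

/-- The additive group `q ℤ[q]` inside `ℤ[q, q⁻¹]`. -/
def IsPositive (p : ℤ[T;T⁻¹]) : Prop :=
  ∃ f : Polynomial ℤ, p = LaurentPolynomial.T 1 * Polynomial.toLaurent f

/-- The recursion that defines the matrices `N = (n_{λ,μ})` and `B = (b_{λ,μ})`. -/
structure IsKLPair (t : ∀ μ : CosetRep M J, ReducedPath μ)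
    (N b : Matrix (CosetRep M J) (CosetRep M J) ℤ[T;T⁻¹]) : Prop where
  diag : ∀ lam, N lam lam = 1 ∧ b lam lam = 1
  selfDual_b : ∀ lam μ, lam ≠ μ → b lam μ ∈ selfDual
  positive_N : ∀ lam μ, lam ≠ μ → IsPositive (N lam μ)
  recursion : ∀ lam μ, lam ≠ μ → b lam μ + N lam μ =
    lightLeaves t lam μ - ∑ᶠ ν ∈ {ν : CosetRep M J | lam.Lt ν ∧ ν.Lt μ}, N lam ν * b ν μ

theorem invert_of_mem_selfDual {p : ℤ[T;T⁻¹]} (hp : p ∈ selfDual) :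
    LaurentPolynomial.invert p = p := by
  unfold selfDual at hp
  induction hp using Algebra.adjoin_induction with
  | mem x hx =>
    rw [Set.mem_singleton_iff] at hx
    subst hx
    simp [add_comm]
  | algebraMap r => simp
  | add x y _ _ hx hy => rw [map_add, hx, hy]
  | mul x y _ _ hx hy => rw [map_mul, hx, hy]

theorem coeff_of_isPositive {p : ℤ[T;T⁻¹]} (hp : IsPositive p) {k : ℤ} (hk : k ≤ 0) :
    p.coeff k = 0 := by
  obtain ⟨f, rfl⟩ := hp
  induction f using Polynomial.induction_on' with
  | add f g hf hg => rw [map_add, mul_add, AddMonoidAlgebra.coeff_add, Finsupp.add_apply, hf, hg, add_zero]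
  | monomial n a =>
    rw [← Polynomial.C_mul_X_pow_eq_monomial, Polynomial.toLaurent_C_mul_X_pow,
      ← mul_assoc, mul_comm (LaurentPolynomial.T 1), mul_assoc, ← LaurentPolynomial.T_add,
      ← LaurentPolynomial.single_eq_C_mul_T, AddMonoidAlgebra.coeff_single, Finsupp.single_apply,
      if_neg (by omega)]

theorem eq_zero_of_selfDual_of_isPositive {p : ℤ[T;T⁻¹]} (h1 : p ∈ selfDual)
    (h2 : IsPositive p) : p = 0 := by
  apply LaurentPolynomial.ext
  intro k
  rcases le_or_gt k 0 with hk | hk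
  · simpa using coeff_of_isPositive h2 hk
  · rw [← invert_of_mem_selfDual h1, LaurentPolynomial.invert_apply]
    simpa using coeff_of_isPositive h2 (show -k ≤ 0 by omega)

theorem IsPositive.add {p p' : ℤ[T;T⁻¹]} (h : IsPositive p) (h' : IsPositive p') :
    IsPositive (p + p') := by
  obtain ⟨f, rfl⟩ := h
  obtain ⟨g, rfl⟩ := h'
  exact ⟨f + g, by rw [map_add, mul_add]⟩

theorem IsPositive.sub {p p' : ℤ[T;T⁻¹]} (h : IsPositive p) (h' : IsPositive p') :
    IsPositive (p - p') := by
  obtain ⟨f, rfl⟩ := h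
  obtain ⟨g, rfl⟩ := h'
  exact ⟨f - g, by rw [map_sub, mul_sub]⟩

theorem isPositive_C_mul_T (a : ℤ) (n : ℕ) :
    IsPositive (LaurentPolynomial.C a * LaurentPolynomial.T ((n : ℤ) + 1)) := by
  refine ⟨Polynomial.C a * Polynomial.X ^ n, ?_⟩
  rw [Polynomial.toLaurent_C_mul_X_pow, add_comm, LaurentPolynomial.T_add]
  ring

theorem T_add_T_neg_mem (n : ℕ) :
    (LaurentPolynomial.T (n : ℤ) + LaurentPolynomial.T (-(n : ℤ)) : ℤ[T;T⁻¹]) ∈ selfDual := by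
  have h1 : (LaurentPolynomial.T 1 + LaurentPolynomial.T (-1) : ℤ[T;T⁻¹]) ∈ selfDual :=
    Algebra.subset_adjoin rfl
  induction n using Nat.strong_induction_on with
  | _ n ih =>
    match n with
    | 0 => simpa using add_mem (one_mem selfDual) (one_mem selfDual)
    | 1 => simpa using h1
    | n + 2 =>
      have e : (LaurentPolynomial.T ((n + 2 : ℕ) : ℤ) + LaurentPolynomial.T (-((n + 2 : ℕ) : ℤ)) :
          ℤ[T;T⁻¹]) =
          (LaurentPolynomial.T 1 + LaurentPolynomial.T (-1)) *
            (LaurentPolynomial.T ((n + 1 : ℕ) : ℤ) + LaurentPolynomial.T (-((n + 1 : ℕ) : ℤ))) -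
          (LaurentPolynomial.T (n : ℤ) + LaurentPolynomial.T (-(n : ℤ))) := by
        simp only [mul_add, add_mul, ← LaurentPolynomial.T_add]
        rw [show (1 : ℤ) + ((n + 1 : ℕ) : ℤ) = ((n + 2 : ℕ) : ℤ) by push_cast; ring,
          show (1 : ℤ) + -((n + 1 : ℕ) : ℤ) = -(n : ℤ) by push_cast; ring,
          show (-1 : ℤ) + ((n + 1 : ℕ) : ℤ) = (n : ℤ) by push_cast; ring,
          show (-1 : ℤ) + -((n + 1 : ℕ) : ℤ) = -((n + 2 : ℕ) : ℤ) by push_cast; ring]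
        ring
      rw [e]
      exact sub_mem (mul_mem h1 (ih (n + 1) (by omega))) (ih n (by omega))

/-- `ℤ[q, q⁻¹] = ℤ[q + q⁻¹] ⊕ q ℤ[q]`. -/
theorem exists_split (p : ℤ[T;T⁻¹]) :
    ∃ x : ℤ[T;T⁻¹] × ℤ[T;T⁻¹], x.2 ∈ selfDual ∧ IsPositive x.1 ∧ x.2 + x.1 = p := by
  induction p using LaurentPolynomial.induction_on' with
  | add p p' h h' =>
    obtain ⟨x, h1, h2, h3⟩ := h
    obtain ⟨x', h1', h2', h3'⟩ := h'
    exact ⟨x + x', add_mem h1 h1', h2.add h2', by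
      rw [← h3, ← h3', Prod.snd_add, Prod.fst_add]; ring⟩
  | C_mul_T n a =>
    have hC : (LaurentPolynomial.C a : ℤ[T;T⁻¹]) ∈ selfDual := by
      have := selfDual.algebraMap_mem a
      rwa [LaurentPolynomial.C_eq_algebraMap]
    have h0 : IsPositive 0 := ⟨0, by simp⟩
    obtain ⟨k, rfl | rfl⟩ := n.eq_nat_or_neg
    · cases k with
      | zero => exact ⟨(0, LaurentPolynomial.C a), hC, h0, by simp⟩
      | succ k => exact ⟨(_, 0), zero_mem _, isPositive_C_mul_T a k, by simp⟩
    · cases k with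
      | zero => exact ⟨(0, LaurentPolynomial.C a), hC, h0, by simp⟩
      | succ k =>
        refine ⟨(0 - LaurentPolynomial.C a * LaurentPolynomial.T ((k : ℤ) + 1),
          LaurentPolynomial.C a * (LaurentPolynomial.T ((k + 1 : ℕ) : ℤ) +
            LaurentPolynomial.T (-((k + 1 : ℕ) : ℤ)))),
          mul_mem hC (T_add_T_neg_mem (k + 1)), h0.sub (isPositive_C_mul_T a k), ?_⟩
        push_cast
        ring

theorem CosetRep.Lt.len_lt {α β : CosetRep M J} (h : α.Lt β) : len M α.1 < len M β.1 := by
  obtain ⟨⟨ω, η, hω, hw, hs, hη, hy⟩, hne⟩ := h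
  have h1 : len M β.1 = ω.length := by rw [← hw]; exact hω
  have h2 : len M α.1 = η.length := by rw [← hy]; exact hη
  rw [h1, h2]
  refine lt_of_le_of_ne hs.length_le fun he => hne (Subtype.ext ?_)
  rw [← hy, ← hw, hs.eq_of_length he]

open Classical in
/-- An auxiliary construction of the pair `(n_{λ,μ}, b_{λ,μ})` by recursion on the length. -/
noncomputable def klAux (t : ∀ μ : CosetRep M J, ReducedPath μ) (lam μ : CosetRep M J) :
    ℤ[T;T⁻¹] × ℤ[T;T⁻¹] :=
  if lam = μ then (1, 1)
  else (exists_split (lightLeaves t lam μ - ∑ᶠ ν : CosetRep M J,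
    if _ : lam.Lt ν ∧ ν.Lt μ then (klAux t lam ν).1 * (klAux t ν μ).2 else 0)).choose
termination_by len M μ.1 - len M lam.1
decreasing_by
  all_goals
    rename_i h
    have h1 := h.1.len_lt
    have h2 := h.2.len_lt
    omega

theorem exists_isKLPair (t : ∀ μ : CosetRep M J, ReducedPath μ) :
    ∃ N b, IsKLPair t N b := by
  classical
  have key : ∀ lam μ, lam ≠ μ → (klAux t lam μ).2 ∈ selfDual ∧ IsPositive (klAux t lam μ).1 ∧
      (klAux t lam μ).2 + (klAux t lam μ).1 = lightLeaves t lam μ - ∑ᶠ ν : CosetRep M J,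
        if _ : lam.Lt ν ∧ ν.Lt μ then (klAux t lam ν).1 * (klAux t ν μ).2 else 0 := by
    intro lam μ h
    rw [klAux, if_neg h]
    exact Exists.choose_spec (exists_split _)
  refine ⟨fun lam μ => (klAux t lam μ).1, fun lam μ => (klAux t lam μ).2, ?_, ?_, ?_, ?_⟩
  · intro lam
    rw [klAux, if_pos rfl]
    exact ⟨rfl, rfl⟩
  · exact fun lam μ h => (key lam μ h).1
  · exact fun lam μ h => (key lam μ h).2.1
  · intro lam μ h
    rw [(key lam μ h).2.2]
    congr 1
    refine finsum_congr fun ν => ?_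
    rw [finsum_eq_if]
    rfl

theorem IsKLPair.unique {t : ∀ μ : CosetRep M J, ReducedPath μ}
    {N b N' b' : Matrix (CosetRep M J) (CosetRep M J) ℤ[T;T⁻¹]}
    (h : IsKLPair t N b) (h' : IsKLPair t N' b') : N = N' ∧ b = b' := by
  have key : ∀ d : ℕ, ∀ lam μ : CosetRep M J, len M μ.1 - len M lam.1 = d →
      N lam μ = N' lam μ ∧ b lam μ = b' lam μ := by
    intro d
    induction d using Nat.strong_induction_on with
    | _ d ih =>
      intro lam μ hd
      by_cases he : lam = μ
      · subst he
        rw [(h.diag lam).1, (h.diag lam).2, (h'.diag lam).1, (h'.diag lam).2]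
        exact ⟨rfl, rfl⟩
      · have hsum : ∑ᶠ ν ∈ {ν : CosetRep M J | lam.Lt ν ∧ ν.Lt μ}, N lam ν * b ν μ =
            ∑ᶠ ν ∈ {ν : CosetRep M J | lam.Lt ν ∧ ν.Lt μ}, N' lam ν * b' ν μ := by
          refine finsum_mem_congr rfl fun ν hν => ?_
          have h1 := hν.1.len_lt
          have h2 := hν.2.len_lt
          rw [(ih _ (by omega) lam ν rfl).1, (ih _ (by omega) ν μ rfl).2]
        have hrec : b lam μ + N lam μ = b' lam μ + N' lam μ := by
          rw [h.recursion lam μ he, h'.recursion lam μ he, hsum]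
        have hdiff : b lam μ - b' lam μ = N' lam μ - N lam μ := by
          linear_combination hrec
        have hzero := eq_zero_of_selfDual_of_isPositive
          (sub_mem (h.selfDual_b lam μ he) (h'.selfDual_b lam μ he))
          (hdiff ▸ (h'.positive_N lam μ he).sub (h.positive_N lam μ he))
        exact ⟨(sub_eq_zero.mp (hdiff ▸ hzero)).symm, sub_eq_zero.mp hzero⟩
  have e : ∀ lam μ, N lam μ = N' lam μ ∧ b lam μ = b' lam μ := fun lam μ => key _ lam μ rfl
  exact ⟨Matrix.ext fun lam μ => (e lam μ).1, Matrix.ext fun lam μ => (e lam μ).2⟩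

/-- The matrix `N = (n_{λ,μ})` of anti-spherical Kazhdan-Lusztig polynomials: the first matrix of
the unique pair `(N, B)` that satisfies the recursion. -/
noncomputable def klMatrix (t : ∀ μ : CosetRep M J, ReducedPath μ) :
    Matrix (CosetRep M J) (CosetRep M J) ℤ[T;T⁻¹] :=
  (exists_isKLPair t).choose

theorem simple_mul_self (i : B) : M.simple i * M.simple i = 1 := by
  have := M.toCoxeterSystem.simple_mul_simple_self i
  rwa [M.toCoxeterSystem_simple] at this

theorem Stroll.len_le {α γ : CosetRep M J} {ω : List B} (S : Stroll α ω γ) :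
    len M γ.1 ≤ len M α.1 + ω.length := by
  induction S with
  | nil => simp
  | @cons α β γ ω i h S ih =>
    have : len M β.1 ≤ len M α.1 + 1 := by
      obtain ⟨δ, h, rfl | rfl⟩ := h
      · omega
      · have hδ : β.1 = α.1 * M.simple i := by
          rcases h with h | h
          · exact h.1
          · rw [h.1, mul_assoc, simple_mul_self, mul_one]
        rw [hδ]
        have := M.toCoxeterSystem.length_mul_le α.1 (M.simple i)
        rw [← M.toCoxeterSystem_simple, M.toCoxeterSystem.length_simple] at this
        exact this
    simp only [List.length_cons]
    omega

/-- A path can be extended by an edge of the Bruhat graph. -/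
theorem Stroll.snoc {α β γ : CosetRep M J} {ω : List B} (S : Stroll α ω β) (i : B)
    (h : ExtEdge i β γ) : Nonempty (Stroll α (ω ++ [i]) γ) := by
  induction S with
  | nil => exact ⟨.cons i h (.nil _)⟩
  | cons j h' S ih =>
    obtain ⟨S'⟩ := ih h
    exact ⟨.cons j h' S'⟩

theorem exists_stroll (ω : List B) (hω : M.toCoxeterSystem.IsReduced ω) (μ : CosetRep M J)
    (hμ : M.toCoxeterSystem.wordProd ω = μ.1) :
    Nonempty (Stroll (CosetRep.empty M J) ω μ) := by
  induction ω using List.reverseRecOn generalizing μ with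
  | nil =>
    have : μ = CosetRep.empty M J := Subtype.ext (by rw [← hμ]; simp [CosetRep.empty])
    subst this
    exact ⟨.nil _⟩
  | append_singleton ω i ih =>
    have hr : M.toCoxeterSystem.IsReduced ω := by simpa using hω.take ω.length
    have hμ' : μ.1 = M.toCoxeterSystem.wordProd ω * M.simple i := by
      rw [← hμ, M.toCoxeterSystem.wordProd_append, M.toCoxeterSystem.wordProd_singleton,
        M.toCoxeterSystem_simple]
    have hlen : len M μ.1 = ω.length + 1 := by
      rw [← hμ]
      have := hω.eq
      simpa [len] using this
    let ν : CosetRep M J := ⟨M.toCoxeterSystem.wordProd ω, fun p hp => by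
      have h1 := μ.2 p hp
      have h2 : len M (p * μ.1) ≤ len M (p * M.toCoxeterSystem.wordProd ω) + 1 := by
        rw [hμ', ← mul_assoc]
        have := M.toCoxeterSystem.length_mul_le (p * M.toCoxeterSystem.wordProd ω) (M.simple i)
        rw [← M.toCoxeterSystem_simple, M.toCoxeterSystem.length_simple] at this
        exact this
      have h3 : len M (M.toCoxeterSystem.wordProd ω) = ω.length := hr.eq
      omega⟩
    obtain ⟨S⟩ := ih hr ν rfl
    refine S.snoc i ⟨μ, Or.inl ⟨hμ', ⟨_, ω, hω, hμ, List.sublist_append_left _ _, hr, rfl⟩, ?_⟩,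
      Or.inr rfl⟩
    intro he
    have h3 : len M ν.1 = ω.length := hr.eq
    rw [he] at h3
    omega

/-- Reduced paths exist. -/
instance ReducedPath.instNonempty (μ : CosetRep M J) : Nonempty (ReducedPath μ) := by
  obtain ⟨ω, hω, hμ⟩ := M.toCoxeterSystem.exists_isReduced μ.1
  obtain ⟨S⟩ := exists_stroll ω hω μ hμ.symm
  refine ⟨⟨ω, S, ?_⟩⟩
  rintro η ⟨S'⟩
  have h1 := S'.len_le
  have h2 : len M μ.1 = ω.length := by rw [hμ]; exact hω.eq
  have h3 : len M (CosetRep.empty M J).1 = 0 := by simp [len, CosetRep.empty]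
  omega

end General

section Types

/-- The Coxeter matrix of type `D_n` (`n ≥ 3`): the nodes `0, …, n - 2` form a simple chain and the
node `n - 1` is joined to the node `n - 3` only. -/
def typeD (n : ℕ) : CoxeterMatrix (Fin n) where
  M := Matrix.of fun i j : Fin n ↦
    if i = j then 1
    else if ((i : ℕ) + 1 = j ∧ (j : ℕ) + 1 ≠ n) ∨ ((j : ℕ) + 1 = i ∧ (i : ℕ) + 1 ≠ n) ∨
      ((i : ℕ) + 2 = j ∧ (j : ℕ) + 1 = n) ∨ ((j : ℕ) + 2 = i ∧ (i : ℕ) + 1 = n) then 3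
    else 2
  isSymm := by
    ext i j
    simp only [Matrix.transpose_apply, Matrix.of_apply]
    grind
  diagonal := by simp
  off_diagonal := by
    intro i j h
    simp only [Matrix.of_apply, if_neg h]
    split_ifs <;> simp

/-- The labels of the points of a coset diagram: `∧`, `∨` and `∘`. -/
inductive Label
  | up
  | down
  | circ
  deriving DecidableEq

/-- Flip a label through the horizontal axis. -/
def Label.flip : Label → Label
  | up => down
  | down => up
  | circ => circ

/-- Coset diagrams with `n + 1` points. They are numbered from the right to the left: the entry
at `k` is the label in position `n + 1 - k`, so that the entry at `n` is the leftmost label. -/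
abbrev Diagram (n : ℕ) : Type := Fin (n + 1) → Label

/-- The action of the generators in type `C_n`: the generator with number `k < n - 1`
swaps the labels at `k` and `k + 1`, that with number `n - 1` flips the label at `n - 1`
(the second one from the left). -/
def actC (n : ℕ) (k : Fin n) (d : Diagram n) : Diagram n := fun p =>
  if (k : ℕ) + 1 < n then d (Equiv.swap k.castSucc k.succ p)
  else if p = k.castSucc then (d p).flip else d p

/-- The action of the generators in type `D_{n+1}`: the generator with number `k < n` swaps the
labels at `k` and `k + 1`, that with number `n` swaps and flips the labels at `n - 1` and `n` (the
two leftmost ones). -/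
def actD (n : ℕ) (k : Fin (n + 1)) (d : Diagram n) : Diagram n := fun p =>
  if h : (k : ℕ) < n then d (Equiv.swap k ⟨k + 1, by omega⟩ p)
  else if (p : ℕ) + 1 = n then (d (Fin.last n)).flip
  else if p = Fin.last n then (d ⟨n - 1, by omega⟩).flip else d p

theorem Label.flip_flip (l : Label) : l.flip.flip = l := by cases l <;> rfl

theorem actC_actC (n : ℕ) (k : Fin n) : Function.Involutive (actC n k) := by
  intro d
  funext p
  simp only [actC, Equiv.swap_apply_def]
  grind [Label.flip_flip]

theorem actD_actD (n : ℕ) (k : Fin (n + 1)) : Function.Involutive (actD n k) := by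
  intro d
  funext p
  simp only [actD, Equiv.swap_apply_def]
  grind [Label.flip_flip]


theorem actC_val (n : ℕ) (k : Fin n) (d : Diagram n) (p : Fin (n + 1)) :
    actC n k d p = if (k : ℕ) + 1 < n then
        (if p.1 = k.1 then d ⟨k.1 + 1, by omega⟩
          else if p.1 = k.1 + 1 then d ⟨k.1, by omega⟩ else d p)
      else if p.1 = k.1 then (d p).flip else d p := by
  simp only [actC, Equiv.swap_apply_def, Fin.ext_iff, Fin.val_castSucc, Fin.val_succ]
  split_ifs <;> rfl

theorem actD_val (n : ℕ) (k : Fin (n + 1)) (d : Diagram n) (p : Fin (n + 1)) :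
    actD n k d p = if h : k.1 < n then
        (if p.1 = k.1 then d ⟨k.1 + 1, by omega⟩ else if p.1 = k.1 + 1 then d k else d p)
      else if p.1 + 1 = n then (d (Fin.last n)).flip
      else if p.1 = n then (d ⟨n - 1, by omega⟩).flip else d p := by
  simp only [actD, Equiv.swap_apply_def, Fin.ext_iff, Fin.val_last]
  split_ifs <;> rfl

theorem isLiftable_actC (n : ℕ) :
    (CoxeterMatrix.B n).IsLiftable fun k => (actC_actC n k).toPerm := by
  intro i j
  ext d p : 2
  simp only [CoxeterMatrix.B, Matrix.of_apply]
  split_ifs with h1 h2 h3 <;>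
    simp only [pow_succ, pow_zero, one_mul, Equiv.Perm.mul_apply, Function.Involutive.coe_toPerm,
      Equiv.Perm.one_apply]
  · subst h1
    rw [actC_actC n i d]
  · grind (splits := 40) (gen := 30) (ematch := 40) (instances := 5000) [Label.flip_flip, actC_val]
  · grind (splits := 40) (gen := 30) (ematch := 40) (instances := 5000) [Label.flip_flip, actC_val]
  · grind (splits := 40) (gen := 30) (ematch := 40) (instances := 5000) [Label.flip_flip, actC_val]

theorem isLiftable_actD (n : ℕ) :
    (typeD (n + 1)).IsLiftable fun k => (actD_actD n k).toPerm := by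
  intro i j
  ext d p : 2
  simp only [typeD, Matrix.of_apply]
  split_ifs with h1 h2 <;>
    simp only [pow_succ, pow_zero, one_mul, Equiv.Perm.mul_apply, Function.Involutive.coe_toPerm,
      Equiv.Perm.one_apply]
  · subst h1
    rw [actD_actD n i d]
  · grind (splits := 40) (gen := 30) (ematch := 40) (instances := 5000) [Label.flip_flip, actD_val]
  · grind (splits := 40) (gen := 30) (ematch := 40) (instances := 5000) [Label.flip_flip, actD_val]

/-- The diagram of the coset of the identity in type `(C_n, A_{n-1})`: leftmost label `∘`, all
other labels `∨`. -/
def emptyC (n : ℕ) : Diagram n := fun p => if p = Fin.last n then .circ else .down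

/-- The diagram of the coset of the identity in type `(D_{n+1}, A_n)`: all labels are `∨`. -/
def emptyD (n : ℕ) : Diagram n := fun _ => .down

/-- The coset diagram of `w = s_{i₁} ⋯ s_{iₖ}` in type `C_n`: the generators act on the
diagram of the identity coset from the right, first `s_{i₁}`, then `s_{i₂}`, and so on. -/
noncomputable def diagramC (n : ℕ) (w : (CoxeterMatrix.B n).Group) : Diagram n :=
  (CoxeterMatrix.B n).toCoxeterSystem.lift ⟨_, isLiftable_actC n⟩ w⁻¹ (emptyC n)

/-- The coset diagram of `w = s_{i₁} ⋯ s_{iₖ}` in type `D_{n+1}`: the generators act on the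
diagram of the identity coset from the right, first `s_{i₁}`, then `s_{i₂}`, and so on. -/
noncomputable def diagramD (n : ℕ) (w : (typeD (n + 1)).Group) : Diagram n :=
  (typeD (n + 1)).toCoxeterSystem.lift ⟨_, isLiftable_actD n⟩ w⁻¹ (emptyD n)

/-- The parity specialisation of a diagram: each `∘` is replaced by `∨` or `∧` in such a way that
the total number of `∧` becomes even if there is exactly one `∘`. -/
def paritySpec {n : ℕ} (d : Diagram n) : Diagram n := fun p =>
  if d p = .circ then
    (if Even (Finset.univ.filter fun x => d x = .up).card then .down else .up)
  else d p

/-- `^P W` for `(C_n, A_{n-1})`. The Coxeter matrix of type `C_n` is that of type `B_n`, in which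
the nodes `n - 2` and `n - 1` are joined by the edge of order `4`; the parabolic omits the
node `n - 1`. -/
abbrev CosetC (n : ℕ) : Type := CosetRep (CoxeterMatrix.B n) {k | (k : ℕ) + 1 ≠ n}

/-- `^P W` for `(D_{n+1}, A_n)`: the parabolic omits the node `n`. -/
abbrev CosetD (n : ℕ) : Type := CosetRep (typeD (n + 1)) {k | k ≠ Fin.last n}

/-- The nodes of the parabolic of `(B_n, B_{n-1})`: all but the node `0`, the end of the Coxeter
graph opposite to the edge of order `4`. -/
def nodesB (n : ℕ) : Set (Fin n) := {k | (k : ℕ) ≠ 0}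

/-- `^P W` for `(B_n, B_{n-1})`. -/
abbrev CosetB (n : ℕ) : Type := CosetRep (CoxeterMatrix.B n) (nodesB n)

/-- `^P W` for the group of type `A_m` and the parabolic that omits the node `e`. If `e` is one of
the two end nodes, this is the pair `(A_m, A_{m-1})`. -/
abbrev CosetA (m : ℕ) (e : Fin m) : Type := CosetRep (CoxeterMatrix.A m) {k | k ≠ e}

end Types

end ParabolicKL

/-! Let X be a poset on which the generators act as they do on `^P W` (`CosetModel`). On functions
from X to ℤ[q, q⁻¹] the Kazhdan-Lusztig generator C_i of the Hecke algebra acts as on the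
anti-spherical module (`hecke`): e_x C_i is e_{x s_i} + q^{±1} e_x, or 0 if s_i fixes x. These terms
are exactly the edges with label i that leave x in the extended Bruhat graph, and the exponents are
the degrees. Hence column μ of Δ is e_∅ C_{i₁} ⋯ C_{iₖ}, where i₁, …, iₖ is the weight of T^μ
(`finsum_stroll`, `lightLeaves_eq`).

The recursion says that Δ = N b, where both factors are unitriangular, N has entries in qℤ[q] off
the diagonal and b has entries in ℤ[q + q⁻¹] (`CosetModel.isKLFactorization`). So the columns of N
and those of Δ span the same ℤ[q + q⁻¹]-lattice, and this lattice determines N because ℤ[q + q⁻¹] ∩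
qℤ[q] = 0 (`IsKLFactorization.eq_of_mem`).

In both parts of the theorem two Coxeter systems act on the same poset X, and their Bruhat graphs
differ only in the labels: those of the simply laced type (D or A) are identified along a folding π
of its Coxeter graph. At each x at most one generator over i moves x, so the operator C_i is the sum
of the C_k with π k = i (`IsFolding.hecke_eq`). If the lattice of the simply laced type is stable
under its C_k, it therefore contains all columns of Δ of the folded type, hence the columns of its
N, and the two matrices N agree by uniqueness (`IsFolding.klMatrix_eq`).

Stability (`hecke_column_mem`) holds because the quotients are fully commutative. The operators
satisfy the Temperley-Lieb relations C_i² = (q + q⁻¹) C_i, C_i C_j C_i = C_i if the order is 3, and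
C_i C_j = C_j C_i if it is 2; these rewrite C_i applied to a reduced monomial as a combination of
reduced monomials. For the same reason Δ does not depend on the paths T^μ (`IsUpWord.column_eq`).

It remains to find X. For C and D it consists of lattice paths that count labels ∧, for B and A it
is a chain with 2n elements. That X is `^P W` with its Bruhat order (`CosetModel.equiv`,
`CosetModel.lt_iff`) rests on a lemma of Deodhar type, `CosetModel.isMin_dichotomy`. -/

namespace ParabolicKL

open scoped LaurentPolynomial

/-- A combinatorial model of `^P W`: a poset `X` with a transitive action of `W` from the right, in
which the simple reflections move an element along a cover relation or fix it, and in which the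
orbits of the dihedral subgroups are those of a fully commutative quotient. -/
structure CosetModel {B : Type} (M : CoxeterMatrix B) (J : Set B) (X : Type)
    [PartialOrder X] where
  act : B → Equiv.Perm X
  base : X
  rank : X → ℕ
  liftable : M.IsLiftable act
  base_le : ∀ x, base ≤ x
  rank_base : rank base = 0
  act_base : ∀ i, act i base = base ↔ i ∈ J
  comparable : ∀ i x, x < act i x ∨ act i x < x ∨ act i x = x
  rank_act : ∀ i x, x < act i x → rank (act i x) = rank x + 1
  act_le_act : ∀ i x y, x ≤ y → x < act i x → y < act i y → act i x ≤ act i y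
  -- This makes the order of X the weak order: y can be lowered to x one generator at a time.
  exists_descent : ∀ x y, x < y → ∃ i, act i y < y ∧ x ≤ act i y
  order : ∀ i j, i ≠ j → M i j = 2 ∨ M i j = 3 ∨ M i j = 4
  comm : ∀ i j x, M i j = 2 → x < act j x → (act j x < act i (act j x) ↔ x < act i x)
  -- A dihedral orbit of order 3 is a point or a chain of three elements; x is its bottom in the
  -- first alternative and its middle in the second.
  braid₃ : ∀ i j x, M i j = 3 → x < act i x →
    (act j x = x ∧ act i x < act j (act i x) ∧ act i (act j (act i x)) = act j (act i x)) ∨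
    (act j x < x ∧ act j (act i x) = act i x ∧ act i (act j x) = act j x)
  -- If j does not raise the image of x under i, then that image is the top of an orbit that is a
  -- chain of four elements.
  braid₄ : ∀ i j x, M i j = 4 → x < act i x →
    act i x < act j (act i x) ∨ (act j (act i x) = act i x ∧ act j x < x ∧
      act i (act j x) < act j x ∧ act j (act i (act j x)) = act i (act j x))

/-! ### Lengths, minimal coset representatives and dihedral relations -/

section Length

variable {B : Type} {M : CoxeterMatrix B} {J : Set B}

theorem len_mul_simple (w : M.Group) (i : B) :
    len M (w * M.simple i) = len M w + 1 ∨ len M (w * M.simple i) + 1 = len M w := by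
  have := M.toCoxeterSystem.length_mul_simple w i
  rwa [M.toCoxeterSystem_simple] at this

theorem mul_simple_mul_simple (w : M.Group) (i : B) : w * M.simple i * M.simple i = w := by
  rw [mul_assoc, simple_mul_self, mul_one]

theorem exists_right_descent {w : M.Group} (hw : w ≠ 1) :
    ∃ i, len M (w * M.simple i) < len M w := by
  obtain ⟨i, hi⟩ := M.toCoxeterSystem.exists_rightDescent_of_ne_one hw
  refine ⟨i, ?_⟩
  rwa [CoxeterSystem.IsRightDescent, M.toCoxeterSystem_simple] at hi

theorem simple_mem_parabolic {i : B} (hi : i ∈ J) : M.simple i ∈ parabolic M J :=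
  Subgroup.subset_closure ⟨i, hi, rfl⟩

/-- `w` has minimal length in `P w`. -/
def IsMin (J : Set B) (w : M.Group) : Prop := ∀ p ∈ parabolic M J, len M w ≤ len M (p * w)

theorem IsMin.mul_simple {w : M.Group} (hw : IsMin J w) {i : B}
    (hi : len M (w * M.simple i) < len M w) : IsMin J (w * M.simple i) := by
  intro p hp
  have h1 := hw p hp
  have h2 := len_mul_simple w i
  have h3 := len_mul_simple (p * w) i
  rw [← mul_assoc]
  omega

theorem IsMin.ne_mul {y z : M.Group} (hy : IsMin J y) (h : len M z < len M y) :
    ¬ ∃ p ∈ parabolic M J, y = p * z := by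
  rintro ⟨p, hp, rfl⟩
  have := hy p⁻¹ (inv_mem hp)
  rw [inv_mul_cancel_left] at this
  omega

theorem simple_mul_simple_pow (i j : B) : (M.simple i * M.simple j) ^ M i j = 1 := by
  have := M.toCoxeterSystem.simple_mul_simple_pow i j
  rwa [M.toCoxeterSystem_simple] at this

theorem simple_inv (i : B) : (M.simple i)⁻¹ = M.simple i := by
  have := M.toCoxeterSystem.inv_simple i
  rwa [M.toCoxeterSystem_simple] at this

theorem simple_comm {i j : B} (h : M i j = 2) :
    M.simple i * M.simple j = M.simple j * M.simple i := by
  have := simple_mul_simple_pow (M := M) i j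
  rw [h, pow_two, mul_eq_one_iff_eq_inv] at this
  simpa [simple_inv] using this

theorem simple_braid₃ {i j : B} (h : M i j = 3) :
    M.simple i * M.simple j * M.simple i = M.simple j * M.simple i * M.simple j := by
  have := simple_mul_simple_pow (M := M) i j
  rw [h, pow_succ, pow_two, show M.simple i * M.simple j * (M.simple i * M.simple j) *
    (M.simple i * M.simple j) = (M.simple i * M.simple j * M.simple i) *
    (M.simple j * M.simple i * M.simple j) by simp only [mul_assoc],
    mul_eq_one_iff_eq_inv] at this
  simpa [simple_inv, mul_assoc] using this

theorem simple_braid₄ {i j : B} (h : M i j = 4) :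
    M.simple i * M.simple j * M.simple i * M.simple j =
      M.simple j * M.simple i * M.simple j * M.simple i := by
  have := simple_mul_simple_pow (M := M) i j
  rw [h, show (M.simple i * M.simple j) ^ 4 = (M.simple i * M.simple j * M.simple i * M.simple j) *
    (M.simple i * M.simple j * M.simple i * M.simple j) by
      simp only [pow_succ, pow_zero, one_mul, mul_assoc], mul_eq_one_iff_eq_inv] at this
  simpa [simple_inv, mul_assoc] using this

theorem bruhatLE_mul {ω η : List B} (h : M.toCoxeterSystem.IsReduced (ω ++ η)) :
    BruhatLE (M.toCoxeterSystem.wordProd ω) (M.toCoxeterSystem.wordProd (ω ++ η)) := by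
  refine ⟨ω ++ η, ω, h, rfl, List.sublist_append_left _ _, ?_, rfl⟩
  simpa using h.take ω.length

theorem bruhatLE_len_le {y w : M.Group} (h : BruhatLE y w) : len M y ≤ len M w := by
  obtain ⟨ω, η, hω, rfl, hs, hη, rfl⟩ := h
  have h1 : len M _ = _ := hω
  have h2 : len M _ = _ := hη
  rw [h1, h2]
  exact hs.length_le

theorem bruhatLE_mul_simple_iff (w : M.Group) (i : B) :
    BruhatLE w (w * M.simple i) ↔ len M w < len M (w * M.simple i) := by
  have h1 := len_mul_simple w i
  refine ⟨fun h => ?_, fun h => ?_⟩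
  · have := bruhatLE_len_le h
    omega
  · obtain ⟨ω, hω, rfl⟩ := M.toCoxeterSystem.exists_isReduced w
    have e : M.toCoxeterSystem.wordProd ω * M.simple i =
        M.toCoxeterSystem.wordProd (ω ++ [i]) := by
      rw [M.toCoxeterSystem.wordProd_append, M.toCoxeterSystem.wordProd_singleton,
        M.toCoxeterSystem_simple]
    rw [e] at h h1 ⊢
    apply bruhatLE_mul
    have h2 : len M _ = _ := hω
    unfold CoxeterSystem.IsReduced
    change len M _ = _
    rw [List.length_append, List.length_singleton]
    omega

theorem wordProd_append_singleton (ω : List B) (i : B) : M.toCoxeterSystem.wordProd (ω ++ [i]) =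
    M.toCoxeterSystem.wordProd ω * M.simple i := by
  rw [M.toCoxeterSystem.wordProd_append, M.toCoxeterSystem.wordProd_singleton,
    M.toCoxeterSystem_simple]

end Length

/-! ### Identification of `^P W` and its Bruhat order with a model -/

namespace CosetModel

variable {B : Type} {M : CoxeterMatrix B} {J : Set B} {X : Type} [PartialOrder X]
  (𝓜 : CosetModel M J X)

theorem act_act (i : B) (x : X) : 𝓜.act i (𝓜.act i x) = x := by
  have := 𝓜.liftable i i
  rw [M.diagonal, pow_one] at this
  exact DFunLike.congr_fun this x

theorem up_of_down {i : B} {x : X} (h : 𝓜.act i x < x) :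
    𝓜.act i x < 𝓜.act i (𝓜.act i x) := by
  rwa [act_act]

theorem rank_down {i : B} {x : X} (h : 𝓜.act i x < x) : 𝓜.rank x = 𝓜.rank (𝓜.act i x) + 1 := by
  have := 𝓜.rank_act i _ (𝓜.up_of_down h)
  rwa [act_act] at this

theorem act_le {i : B} {x : X} (h : ¬ x < 𝓜.act i x) : 𝓜.act i x ≤ x := by
  rcases 𝓜.comparable i x with h' | h' | h'
  · exact absurd h' h
  · exact h'.le
  · exact h'.le

theorem not_down_base (i : B) : ¬ 𝓜.act i 𝓜.base < 𝓜.base :=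
  fun h => h.not_ge (𝓜.base_le _)

theorem act_comm {i j : B} (h : M i j = 2) (x : X) :
    𝓜.act i (𝓜.act j x) = 𝓜.act j (𝓜.act i x) := by
  have := 𝓜.liftable i j
  rw [h, pow_two] at this
  have h2 := DFunLike.congr_fun this (𝓜.act j (𝓜.act i x))
  simpa only [Equiv.Perm.mul_apply, act_act, Equiv.Perm.one_apply] using h2

theorem fix_act_iff {i j : B} (h : M i j = 2) (x : X) :
    𝓜.act i (𝓜.act j x) = 𝓜.act j x ↔ 𝓜.act i x = x := by
  rw [𝓜.act_comm h, (𝓜.act j).injective.eq_iff]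

theorem up_act_iff {i j : B} (h : M i j = 2) (x : X) :
    𝓜.act j x < 𝓜.act i (𝓜.act j x) ↔ x < 𝓜.act i x := by
  rcases 𝓜.comparable j x with h' | h' | h'
  · exact 𝓜.comm i j x h h'
  · have := 𝓜.comm i j _ h (𝓜.up_of_down h')
    rw [act_act] at this
    exact this.symm
  · rw [h']

theorem down_act_iff {i j : B} (h : M i j = 2) (x : X) :
    𝓜.act i (𝓜.act j x) < 𝓜.act j x ↔ 𝓜.act i x < x := by
  have h1 := 𝓜.fix_act_iff h x
  have h2 := 𝓜.up_act_iff h x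
  rcases 𝓜.comparable i x with h' | h' | h' <;>
    rcases 𝓜.comparable i (𝓜.act j x) with h'' | h'' | h''
  · simp [h''.not_gt, h'.not_gt]
  · exact absurd (h2.2 h') h''.not_gt
  · exact absurd (h1.1 h'') h'.ne'
  · exact absurd (h2.1 h'') h'.not_gt
  · simp [h', h'']
  · exact absurd (h1.1 h'') h'.ne
  · exact absurd (h1.2 h') h''.ne'
  · exact absurd (h1.2 h') h''.ne
  · simp [h', h'']

/-- The dihedral orbits for orders 3 and 4 are points or chains, and no element of a chain has two
lower neighbours. -/
theorem order_eq_two_of_down {i j : B} (hij : i ≠ j) {x : X} (hi : 𝓜.act i x < x)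
    (hj : 𝓜.act j x < x) : M i j = 2 := by
  have hj' := 𝓜.up_of_down hj
  have e := 𝓜.act_act j x
  rcases 𝓜.order i j hij with h | h | h
  · exact h
  · rcases 𝓜.braid₃ j i _ (M.symmetric j i ▸ h) hj' with h' | h'
    · rw [e] at h'
      exact absurd h'.2.1 hi.not_gt
    · rw [e] at h'
      exact absurd h'.2.1 hi.ne
  · rcases 𝓜.braid₄ j i _ (M.symmetric j i ▸ h) hj' with h' | h'
    · rw [e] at h'
      exact absurd h' hi.not_gt
    · rw [e] at h'
      exact absurd h'.1 hi.ne

/-- Such an x is the top of its dihedral chain, which is followed here down to the bottom; the next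
lemma does the same for order 4. -/
theorem fix_down₃ {i j : B} (h : M i j = 3) {x : X} (hi : 𝓜.act i x = x)
    (hj : 𝓜.act j x < x) : 𝓜.act i (𝓜.act j x) < 𝓜.act j x ∧
      𝓜.act j (𝓜.act i (𝓜.act j x)) = 𝓜.act i (𝓜.act j x) := by
  have hj' := 𝓜.up_of_down hj
  have e := 𝓜.act_act j x
  rcases 𝓜.braid₃ j i _ (M.symmetric j i ▸ h) hj' with h' | h'
  · rw [e] at h'
    exact absurd hi h'.2.1.ne'
  · exact ⟨h'.1, h'.2.2⟩

theorem fix_down₄ {i j : B} (h : M i j = 4) {x : X} (hi : 𝓜.act i x = x)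
    (hj : 𝓜.act j x < x) : 𝓜.act i (𝓜.act j x) < 𝓜.act j x ∧
      𝓜.act j (𝓜.act i (𝓜.act j x)) < 𝓜.act i (𝓜.act j x) ∧
      𝓜.act i (𝓜.act j (𝓜.act i (𝓜.act j x))) = 𝓜.act j (𝓜.act i (𝓜.act j x)) := by
  have hj' := 𝓜.up_of_down hj
  have e := 𝓜.act_act j x
  rcases 𝓜.braid₄ j i _ (M.symmetric j i ▸ h) hj' with h' | h'
  · rw [e] at h'
    exact absurd hi h'.ne'
  · exact h'.2

/-- The element of the model that represents the coset of `w`. -/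
noncomputable def diag (w : M.Group) : X :=
  M.toCoxeterSystem.lift ⟨𝓜.act, 𝓜.liftable⟩ w⁻¹ 𝓜.base

theorem diag_one : 𝓜.diag 1 = 𝓜.base := by simp [diag]

theorem diag_mul_simple (w : M.Group) (i : B) :
    𝓜.diag (w * M.simple i) = 𝓜.act i (𝓜.diag w) := by
  have := M.toCoxeterSystem.lift_apply_simple 𝓜.liftable i
  rw [M.toCoxeterSystem_simple] at this
  simp only [diag, mul_inv_rev, simple_inv, map_mul, this, Equiv.Perm.mul_apply]

theorem diag_mul_of_mem {p : M.Group} (hp : p ∈ parabolic M J) (w : M.Group) :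
    𝓜.diag (p * w) = 𝓜.diag w := by
  have key : M.toCoxeterSystem.lift ⟨𝓜.act, 𝓜.liftable⟩ p⁻¹ 𝓜.base = 𝓜.base := by
    have hp' := inv_mem hp
    generalize p⁻¹ = r at hp'
    unfold parabolic at hp'
    induction hp' using Subgroup.closure_induction with
    | mem x hx =>
      obtain ⟨i, hi, rfl⟩ := hx
      have := M.toCoxeterSystem.lift_apply_simple 𝓜.liftable i
      rw [M.toCoxeterSystem_simple] at this
      rw [this]
      exact (𝓜.act_base i).2 hi
    | one => simp
    | mul x y _ _ hx hy => rw [map_mul, Equiv.Perm.mul_apply, hy, hx]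
    | inv x _ hx =>
      rw [map_inv, Equiv.Perm.inv_eq_iff_eq, hx]
  simp only [diag, mul_inv_rev, map_mul, Equiv.Perm.mul_apply, key]

theorem rank_act_le (i : B) (x : X) : 𝓜.rank (𝓜.act i x) ≤ 𝓜.rank x + 1 := by
  rcases 𝓜.comparable i x with h | h | h
  · exact (𝓜.rank_act i x h).le
  · have := 𝓜.rank_down h
    omega
  · rw [h]
    omega

theorem rank_diag_le (w : M.Group) : 𝓜.rank (𝓜.diag w) ≤ len M w := by
  induction hn : len M w using Nat.strong_induction_on generalizing w with
  | _ n ih =>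
    by_cases hw : w = 1
    · subst hw
      simp [diag_one, rank_base]
    · obtain ⟨i, hi⟩ := exists_right_descent hw
      have h1 := ih _ (hn ▸ hi) _ rfl
      have h2 := 𝓜.rank_act_le i (𝓜.diag (w * M.simple i))
      rw [← diag_mul_simple, mul_simple_mul_simple] at h2
      omega

theorem exists_down {x : X} (h : x ≠ 𝓜.base) : ∃ i, 𝓜.act i x < x := by
  obtain ⟨i, hi, -⟩ := 𝓜.exists_descent _ _ (lt_of_le_of_ne (𝓜.base_le x) h.symm)
  exact ⟨i, hi⟩

theorem exists_diag_eq (x : X) : ∃ w : M.Group, 𝓜.diag w = x ∧ len M w = 𝓜.rank x := by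
  induction hn : 𝓜.rank x using Nat.strong_induction_on generalizing x with
  | _ n ih =>
    by_cases hx : x = 𝓜.base
    · subst hx
      exact ⟨1, 𝓜.diag_one, by rw [← hn, rank_base]; simp [len]⟩
    · obtain ⟨i, hi⟩ := 𝓜.exists_down hx
      have hr := 𝓜.rank_down hi
      obtain ⟨w, hw, hl⟩ := ih (𝓜.rank (𝓜.act i x)) (by omega) _ rfl
      have hd : 𝓜.diag (w * M.simple i) = x := by rw [diag_mul_simple, hw, act_act]
      refine ⟨w * M.simple i, hd, ?_⟩
      have h1 := 𝓜.rank_diag_le (w * M.simple i)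
      have h2 := len_mul_simple w i
      rw [hd] at h1
      omega

/-- The rank of `diag` is constant on the coset and bounds the length from below. -/
theorem isMin_of_len_eq {w : M.Group} (h : len M w = 𝓜.rank (𝓜.diag w)) : IsMin J w := by
  intro p hp
  have := 𝓜.rank_diag_le (p * w)
  rw [𝓜.diag_mul_of_mem hp] at this
  omega

/-- Induction on the length through a right descent j of y. If i = j there is nothing to prove. If i
and j both lower the point of y, they commute, and the claim passes from y s_j to y. If i fixes the
point of y, this point is the top of its chain for i and j; from the representative u of the bottom,
which is fixed by a generator up to a factor p from P, the braid relation moves p through to y s_i =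
p y. -/
theorem isMin_dichotomy {y : M.Group} (hy : IsMin J y) (i : B) :
    (𝓜.act i (𝓜.diag y) < 𝓜.diag y → len M (y * M.simple i) < len M y) ∧
    (𝓜.act i (𝓜.diag y) = 𝓜.diag y → ∃ p ∈ parabolic M J, y * M.simple i = p * y) := by
  induction hn : len M y using Nat.strong_induction_on generalizing y i with
  | _ n ih =>
  subst hn
  by_cases hy1 : y = 1
  · subst hy1
    rw [diag_one]
    refine ⟨fun h => absurd h (𝓜.not_down_base i), fun h => ?_⟩
    exact ⟨M.simple i, simple_mem_parabolic ((𝓜.act_base i).1 h), by simp⟩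
  obtain ⟨j, hj⟩ := exists_right_descent hy1
  have hz := hy.mul_simple hj
  have hzj := ih _ hj hz j rfl
  have hyz : y = y * M.simple j * M.simple j := (mul_simple_mul_simple y j).symm
  -- The induction hypothesis at y s_j excludes the other two cases: one would make y shorter than y
  -- s_j, the other would put y and the shorter y s_j into the same coset.
  have hdj : 𝓜.act j (𝓜.diag y) < 𝓜.diag y := by
    rw [diag_mul_simple, act_act, ← hyz] at hzj
    rcases 𝓜.comparable j (𝓜.diag y) with h | h | h
    · exact absurd (hzj.1 h) (by omega)
    · exact h
    · exact absurd (hzj.2 h.symm) (hy.ne_mul hj)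
  by_cases hij : i = j
  · subst hij
    exact ⟨fun _ => hj, fun h => absurd h hdj.ne⟩
  have hzi := ih _ hj hz i rfl
  rw [diag_mul_simple] at hzi
  have hcomm : M i j = 2 → y * M.simple i = y * M.simple j * M.simple i * M.simple j := by
    intro h
    rw [mul_assoc (y * M.simple j), simple_comm h, ← mul_assoc, mul_simple_mul_simple]
  constructor
  · intro hi
    have h2 := 𝓜.order_eq_two_of_down hij hi hdj
    have h3 := hzi.1 ((𝓜.down_act_iff h2 _).2 hi)
    rw [hcomm h2]
    have h4 := len_mul_simple (y * M.simple j * M.simple i) j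
    have h5 := len_mul_simple y j
    omega
  · intro hi
    rcases 𝓜.order i j hij with h | h | h
    · obtain ⟨p, hp, h'⟩ := hzi.2 ((𝓜.fix_act_iff h _).2 hi)
      refine ⟨p, hp, ?_⟩
      rw [hcomm h, h', mul_assoc p, ← hyz]
    · obtain ⟨h1, h2⟩ := 𝓜.fix_down₃ h hi hdj
      have hl := hzi.1 h1
      obtain ⟨p, hp, h'⟩ := (ih _ (hl.trans hj) (hz.mul_simple hl) j rfl).2 (by
        rw [diag_mul_simple, diag_mul_simple, h2])
      refine ⟨p, hp, ?_⟩
      have e := simple_braid₃ h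
      have e1 : y = (y * M.simple j * M.simple i) * M.simple i * M.simple j := by
        rw [mul_simple_mul_simple, mul_simple_mul_simple]
      generalize y * M.simple j * M.simple i = u at h' e1
      rw [e1, mul_assoc, mul_assoc, ← mul_assoc (M.simple i), e, ← mul_assoc, ← mul_assoc, h']
      simp only [mul_assoc]
    · obtain ⟨h1, h2, h3⟩ := 𝓜.fix_down₄ h hi hdj
      have hl := hzi.1 h1
      have hu := hz.mul_simple hl
      have hl2 := (ih _ (hl.trans hj) hu j rfl).1 (by
        rw [diag_mul_simple, diag_mul_simple]; exact h2)
      obtain ⟨p, hp, h'⟩ := (ih _ (hl2.trans (hl.trans hj)) (hu.mul_simple hl2) i rfl).2 (by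
        rw [diag_mul_simple, diag_mul_simple, diag_mul_simple, h3])
      refine ⟨p, hp, ?_⟩
      have e := simple_braid₄ h
      have e1 : y = (y * M.simple j * M.simple i * M.simple j) * M.simple j * M.simple i *
          M.simple j := by
        rw [mul_simple_mul_simple, mul_simple_mul_simple, mul_simple_mul_simple]
      generalize y * M.simple j * M.simple i * M.simple j = v at h' e1
      have e2 : y * M.simple i = v * (M.simple i * M.simple j * M.simple i * M.simple j) := by
        rw [e, e1]
        simp only [mul_assoc]
      rw [e2, e1, mul_assoc, mul_assoc, ← mul_assoc v, h']
      simp only [mul_assoc]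

/-- The dichotomy, applied to the shorter minimal element y s_i, leaves no other possibility. -/
theorem down_of_descent {y : M.Group} (hy : IsMin J y) {i : B}
    (hi : len M (y * M.simple i) < len M y) : 𝓜.act i (𝓜.diag y) < 𝓜.diag y := by
  have h := 𝓜.isMin_dichotomy (hy.mul_simple hi) i
  rw [diag_mul_simple, act_act, mul_simple_mul_simple] at h
  rcases 𝓜.comparable i (𝓜.diag y) with h' | h' | h'
  · exact absurd (h.1 h') (by omega)
  · exact h'
  · exact absurd (h.2 h'.symm) (hy.ne_mul hi)

theorem len_eq_rank {y : M.Group} (hy : IsMin J y) : len M y = 𝓜.rank (𝓜.diag y) := by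
  induction hn : len M y using Nat.strong_induction_on generalizing y with
  | _ n ih =>
    subst hn
    by_cases hy1 : y = 1
    · subst hy1
      rw [diag_one, rank_base]
      simp [len]
    · obtain ⟨i, hi⟩ := exists_right_descent hy1
      have h1 := ih _ hi (hy.mul_simple hi) rfl
      have h2 := 𝓜.rank_down (𝓜.down_of_descent hy hi)
      rw [diag_mul_simple] at h1
      have h3 := len_mul_simple y i
      omega

theorem eq_of_diag_eq {y z : M.Group} (hy : IsMin J y) (hz : IsMin J z)
    (h : 𝓜.diag y = 𝓜.diag z) : y = z := by
  induction hn : len M y using Nat.strong_induction_on generalizing y z with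
  | _ n ih =>
    subst hn
    by_cases hy1 : y = 1
    · have h1 := 𝓜.len_eq_rank hz
      rw [← h, ← 𝓜.len_eq_rank hy, hy1] at h1
      have : len M z = 0 := by rw [h1]; simp [len]
      rw [hy1]
      exact (M.toCoxeterSystem.length_eq_zero_iff.1 this).symm
    · obtain ⟨i, hi⟩ := exists_right_descent hy1
      have h1 := 𝓜.down_of_descent hy hi
      rw [h] at h1
      have h2 := (𝓜.isMin_dichotomy hz i).1 h1
      have := ih _ hi (hy.mul_simple hi) (hz.mul_simple h2)
        (by rw [diag_mul_simple, diag_mul_simple, h]) rfl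
      exact mul_right_cancel this

/-- The elements of the model are the elements of `^P W`. -/
noncomputable def equiv : CosetRep M J ≃ X :=
  Equiv.ofBijective (fun α => 𝓜.diag α.1) ⟨fun α β h => Subtype.ext (𝓜.eq_of_diag_eq α.2 β.2 h),
    fun x => by
      obtain ⟨w, hw, hl⟩ := 𝓜.exists_diag_eq x
      exact ⟨⟨w, 𝓜.isMin_of_len_eq (by rw [hw, hl])⟩, hw⟩⟩

theorem equiv_apply (α : CosetRep M J) : 𝓜.equiv α = 𝓜.diag α.1 := rfl

theorem equiv_empty : 𝓜.equiv (CosetRep.empty M J) = 𝓜.base := 𝓜.diag_one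

theorem len_eq (α : CosetRep M J) : len M α.1 = 𝓜.rank (𝓜.equiv α) := 𝓜.len_eq_rank α.2

theorem bruhatLE_mul_simple_iff_up (α : CosetRep M J) {β : CosetRep M J} {i : B}
    (hβ : β.1 = α.1 * M.simple i) :
    BruhatLE α.1 (α.1 * M.simple i) ↔ 𝓜.equiv α < 𝓜.act i (𝓜.equiv α) := by
  have hd : 𝓜.equiv β = 𝓜.act i (𝓜.equiv α) := by
    rw [equiv_apply, hβ, diag_mul_simple, equiv_apply]
  rw [bruhatLE_mul_simple_iff, ← hβ, 𝓜.len_eq, 𝓜.len_eq, hd]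
  rcases 𝓜.comparable i (𝓜.equiv α) with h | h | h
  · simp [h, 𝓜.rank_act _ _ h]
  · simp [h.not_gt, 𝓜.rank_down h]
  · simp [h]

theorem labelledEdge_iff (i : B) (α β : CosetRep M J) : LabelledEdge i α β ↔
    𝓜.equiv α < 𝓜.act i (𝓜.equiv α) ∧ 𝓜.equiv β = 𝓜.act i (𝓜.equiv α) := by
  constructor
  · rintro ⟨h1, h2, -⟩
    have hd : 𝓜.equiv β = 𝓜.act i (𝓜.equiv α) := by
      rw [equiv_apply, h1, diag_mul_simple, equiv_apply]
    rw [h1, 𝓜.bruhatLE_mul_simple_iff_up α h1] at h2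
    exact ⟨h2, hd⟩
  · rintro ⟨h1, h2⟩
    have hr := 𝓜.rank_act _ _ h1
    have hd : 𝓜.diag (α.1 * M.simple i) = 𝓜.equiv β := by
      rw [h2, diag_mul_simple, equiv_apply]
    have hm : IsMin J (α.1 * M.simple i) := by
      apply 𝓜.isMin_of_len_eq
      have h3 := 𝓜.rank_diag_le (α.1 * M.simple i)
      have h4 := len_mul_simple α.1 i
      have h5 := 𝓜.len_eq α
      rw [hd, h2] at h3 ⊢
      omega
    have hβ : β.1 = α.1 * M.simple i := 𝓜.eq_of_diag_eq β.2 hm hd.symm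
    refine ⟨hβ, ?_, ?_⟩
    · rw [hβ]
      exact (𝓜.bruhatLE_mul_simple_iff_up α hβ).2 h1
    · rintro rfl
      exact h1.ne h2

/-- Induction on the last letter i of the reduced word, which raises its point. If the subword omits
i, monotonicity is clear. If it uses i, either i raises both points and `act_le_act` applies, or i
does not raise the point of the subword and the bound only improves. -/
theorem diag_le_of_sublist {ω η : List B} (hω : M.toCoxeterSystem.IsReduced ω)
    (hm : IsMin J (M.toCoxeterSystem.wordProd ω)) (hs : η.Sublist ω) :
    𝓜.diag (M.toCoxeterSystem.wordProd η) ≤ 𝓜.diag (M.toCoxeterSystem.wordProd ω) := by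
  induction ω using List.reverseRecOn generalizing η with
  | nil => rw [List.sublist_nil.1 hs]
  | append_singleton ω i ih =>
    have hr : M.toCoxeterSystem.IsReduced ω := by simpa using hω.take ω.length
    have h1 : len M _ = _ := hω
    have h2 : len M _ = _ := hr
    rw [wordProd_append_singleton] at hm h1
    rw [List.length_append, List.length_singleton] at h1
    have hl : len M (M.toCoxeterSystem.wordProd ω * M.simple i * M.simple i) <
        len M (M.toCoxeterSystem.wordProd ω * M.simple i) := by
      rw [mul_simple_mul_simple]
      omega
    have hm' := hm.mul_simple hl
    have hd := 𝓜.down_of_descent hm hl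
    rw [mul_simple_mul_simple] at hm'
    rw [diag_mul_simple, act_act] at hd
    rw [wordProd_append_singleton, diag_mul_simple]
    obtain ⟨η₁, η₂, rfl, h3, h4⟩ := List.sublist_append_iff.1 hs
    have h5 := ih hr hm' h3
    rcases List.sublist_singleton.1 h4 with rfl | rfl
    · rw [List.append_nil]
      exact h5.trans hd.le
    · rw [wordProd_append_singleton, diag_mul_simple]
      by_cases hu : 𝓜.diag (M.toCoxeterSystem.wordProd η₁) <
          𝓜.act i (𝓜.diag (M.toCoxeterSystem.wordProd η₁))
      · exact 𝓜.act_le_act _ _ _ h5 hu hd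
      · exact (𝓜.act_le hu).trans (h5.trans hd.le)

/-- By `exists_descent` the larger element is reached from the smaller one along upward edges, so a
reduced word of the smaller one is even a prefix: on these quotients the Bruhat order is the weak
order. -/
theorem exists_append_of_le {α β : CosetRep M J} (h : 𝓜.equiv α ≤ 𝓜.equiv β) :
    ∃ ω η : List B, M.toCoxeterSystem.IsReduced (ω ++ η) ∧
      M.toCoxeterSystem.wordProd ω = α.1 ∧ M.toCoxeterSystem.wordProd (ω ++ η) = β.1 := by
  induction hn : 𝓜.rank (𝓜.equiv β) using Nat.strong_induction_on generalizing β with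
  | _ n ih =>
    rcases h.eq_or_lt with h | h
    · obtain ⟨ω, hω, hα⟩ := M.toCoxeterSystem.exists_isReduced α.1
      refine ⟨ω, [], by simpa using hω, hα.symm, ?_⟩
      rw [List.append_nil, ← hα, 𝓜.equiv.injective h]
    · obtain ⟨i, hi, hle⟩ := 𝓜.exists_descent _ _ h
      have hr := 𝓜.rank_down hi
      obtain ⟨γ, hγ⟩ := 𝓜.equiv.surjective (𝓜.act i (𝓜.equiv β))
      rw [← hγ] at hle hr
      obtain ⟨ω, η, h1, h2, h3⟩ := ih (𝓜.rank (𝓜.equiv γ)) (by omega) hle rfl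
      have he : LabelledEdge i γ β := by
        rw [𝓜.labelledEdge_iff, hγ, act_act]
        exact ⟨hi, rfl⟩
      have hw : M.toCoxeterSystem.wordProd (ω ++ (η ++ [i])) = β.1 := by
        rw [← List.append_assoc, wordProd_append_singleton, h3, he.1]
      refine ⟨ω, η ++ [i], ?_, h2, hw⟩
      have h4 : len M _ = _ := h1
      rw [h3, 𝓜.len_eq] at h4
      unfold CoxeterSystem.IsReduced
      change len M _ = _
      rw [hw, 𝓜.len_eq, hr, h4]
      simp [add_assoc]

theorem lt_iff (α β : CosetRep M J) : α.Lt β ↔ 𝓜.equiv α < 𝓜.equiv β := by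
  constructor
  · rintro ⟨⟨ω, η, hω, hw, hs, -, hy⟩, hne⟩
    refine lt_of_le_of_ne ?_ (𝓜.equiv.injective.ne hne)
    have := 𝓜.diag_le_of_sublist hω (hw ▸ β.2) hs
    rwa [hw, hy] at this
  · intro h
    obtain ⟨ω, η, h1, h2, h3⟩ := 𝓜.exists_append_of_le h.le
    refine ⟨?_, fun e => h.ne (e ▸ rfl)⟩
    rw [← h2, ← h3]
    exact bruhatLE_mul h1

end CosetModel

end ParabolicKL

/-! ### Light leaves as coefficients of the anti-spherical Hecke action -/

namespace ParabolicKL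

open scoped LaurentPolynomial

namespace CosetModel

variable {B : Type} {M : CoxeterMatrix B} {J : Set B} {X : Type} [PartialOrder X]
  (𝓜 : CosetModel M J X)

open Classical in
/-- The action of the Kazhdan-Lusztig generator `C_i` of the Hecke algebra on the anti-spherical
module, in coordinates. -/
noncomputable def hecke (i : B) : (X → ℤ[T;T⁻¹]) →ₗ[ℤ[T;T⁻¹]] (X → ℤ[T;T⁻¹]) where
  toFun v x := if 𝓜.act i x = x then 0 else
    v (𝓜.act i x) + LaurentPolynomial.T (if x < 𝓜.act i x then 1 else -1) * v x
  map_add' v w := by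
    funext x
    simp only [Pi.add_apply]
    split_ifs <;> ring
  map_smul' r v := by
    funext x
    simp only [Pi.smul_apply, smul_eq_mul, RingHom.id_apply]
    split_ifs <;> ring

theorem hecke_fix {i : B} {x : X} (h : 𝓜.act i x = x) (v : X → ℤ[T;T⁻¹]) :
    𝓜.hecke i v x = 0 := if_pos h

theorem hecke_up {i : B} {x : X} (h : x < 𝓜.act i x) (v : X → ℤ[T;T⁻¹]) :
    𝓜.hecke i v x = v (𝓜.act i x) + LaurentPolynomial.T 1 * v x := by
  simp [hecke, h, h.ne']

theorem hecke_down {i : B} {x : X} (h : 𝓜.act i x < x) (v : X → ℤ[T;T⁻¹]) :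
    𝓜.hecke i v x = v (𝓜.act i x) + LaurentPolynomial.T (-1) * v x := by
  simp [hecke, h.not_gt, h.ne]

/-- The action of a product of generators, from the right. -/
noncomputable def heckeWord (ω : List B) (v : X → ℤ[T;T⁻¹]) : X → ℤ[T;T⁻¹] :=
  ω.foldl (fun v i => 𝓜.hecke i v) v

theorem heckeWord_cons (i : B) (ω : List B) (v : X → ℤ[T;T⁻¹]) :
    𝓜.heckeWord (i :: ω) v = 𝓜.heckeWord ω (𝓜.hecke i v) := rfl

theorem heckeWord_append_singleton (i : B) (ω : List B) (v : X → ℤ[T;T⁻¹]) :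
    𝓜.heckeWord (ω ++ [i]) v = 𝓜.hecke i (𝓜.heckeWord ω v) := by
  simp [heckeWord]

theorem heckeWord_add (ω : List B) (v w : X → ℤ[T;T⁻¹]) :
    𝓜.heckeWord ω (v + w) = 𝓜.heckeWord ω v + 𝓜.heckeWord ω w := by
  induction ω generalizing v w with
  | nil => rfl
  | cons i ω ih => simp only [heckeWord_cons, map_add, ih]

theorem heckeWord_smul (ω : List B) (r : ℤ[T;T⁻¹]) (v : X → ℤ[T;T⁻¹]) :
    𝓜.heckeWord ω (r • v) = r • 𝓜.heckeWord ω v := by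
  induction ω generalizing v with
  | nil => rfl
  | cons i ω ih => simp only [heckeWord_cons, map_smul, ih]

open Classical in
theorem hecke_single_fix {i : B} {x : X} (h : 𝓜.act i x = x) :
    𝓜.hecke i (Pi.single x 1) = 0 := by
  funext y
  rcases eq_or_ne (𝓜.act i y) y with hy | hy
  · exact 𝓜.hecke_fix hy _
  · have h1 : y ≠ x := by rintro rfl; exact hy h
    have h2 : 𝓜.act i y ≠ x := by
      rintro rfl
      rw [act_act] at h
      exact hy h.symm
    rcases 𝓜.comparable i y with h' | h' | h'
    · rw [𝓜.hecke_up h']; simp [h1, h2]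
    · rw [𝓜.hecke_down h']; simp [h1, h2]
    · exact absurd h' hy

open Classical in
theorem hecke_single {i : B} {x : X} (h : 𝓜.act i x ≠ x) :
    𝓜.hecke i (Pi.single x 1) = Pi.single (𝓜.act i x) 1 +
      (LaurentPolynomial.T (if x < 𝓜.act i x then 1 else -1) : ℤ[T;T⁻¹]) • Pi.single x 1 := by
  funext y
  by_cases h1 : y = x
  · subst h1
    rcases 𝓜.comparable i y with h' | h' | h'
    · rw [𝓜.hecke_up h']; simp [h.symm, h', h]
    · rw [𝓜.hecke_down h']; simp [h.symm, h'.not_gt, h]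
    · exact absurd h' h
  by_cases h2 : y = 𝓜.act i x
  · subst h2
    rcases 𝓜.comparable i (𝓜.act i x) with h' | h' | h'
    · rw [𝓜.hecke_up h']; simp [act_act, h]
    · rw [𝓜.hecke_down h']; simp [act_act, h]
    · exact absurd ((𝓜.act i).injective h') h
  have h3 : 𝓜.act i y ≠ x := by rintro rfl; simp [act_act] at h2
  rcases 𝓜.comparable i y with h' | h' | h'
  · rw [𝓜.hecke_up h']; simp [h1, h2, h3]
  · rw [𝓜.hecke_down h']; simp [h1, h2, h3]
  · rw [𝓜.hecke_fix h']; simp [h1, h2]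

theorem extEdge_iff (i : B) (α β : CosetRep M J) : ExtEdge i α β ↔
    𝓜.act i (𝓜.equiv α) ≠ 𝓜.equiv α ∧
      (β = α ∨ β = 𝓜.equiv.symm (𝓜.act i (𝓜.equiv α))) := by
  have e : ∀ γ, 𝓜.equiv γ = 𝓜.act i (𝓜.equiv α) ↔
      γ = 𝓜.equiv.symm (𝓜.act i (𝓜.equiv α)) := fun γ => (Equiv.eq_symm_apply _).symm
  constructor
  · rintro ⟨γ, h, hβ⟩
    have h' : 𝓜.act i (𝓜.equiv α) ≠ 𝓜.equiv α ∧ 𝓜.equiv γ = 𝓜.act i (𝓜.equiv α) := by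
      rw [𝓜.labelledEdge_iff, 𝓜.labelledEdge_iff] at h
      rcases h with ⟨h1, h2⟩ | ⟨h1, h2⟩
      · exact ⟨h1.ne', h2⟩
      · rw [h2, act_act]
        exact ⟨h1.ne, rfl⟩
    rw [e] at h'
    exact ⟨h'.1, h'.2 ▸ hβ⟩
  · rintro ⟨h, hβ⟩
    refine ⟨_, ?_, hβ⟩
    rw [𝓜.labelledEdge_iff, 𝓜.labelledEdge_iff, Equiv.apply_symm_apply, act_act]
    rcases 𝓜.comparable i (𝓜.equiv α) with h' | h' | h'
    · exact Or.inl ⟨h', rfl⟩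
    · exact Or.inr ⟨h', rfl⟩
    · exact absurd h' h

theorem edgeDegree_of_ne {i : B} {α β : CosetRep M J} (h : β ≠ α) : edgeDegree i α β = 0 :=
  if_neg h

open Classical in
theorem edgeDegree_self {i : B} {α : CosetRep M J} (h : 𝓜.act i (𝓜.equiv α) ≠ 𝓜.equiv α) :
    edgeDegree i α α = if 𝓜.equiv α < 𝓜.act i (𝓜.equiv α) then 1 else -1 := by
  obtain ⟨γ, hγ, -⟩ := (𝓜.extEdge_iff i α α).2 ⟨h, Or.inl rfl⟩
  have hγ' : γ.1 = α.1 * M.simple i := by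
    rcases hγ with h' | h'
    · exact h'.1
    · rw [h'.1, mul_simple_mul_simple]
  rw [edgeDegree, if_pos rfl]
  simp only [𝓜.bruhatLE_mul_simple_iff_up α hγ']

/-- A path is a first edge followed by a path. -/
def strollConsEquiv (i : B) (ω : List B) (α γ : CosetRep M J) :
    Stroll α (i :: ω) γ ≃ Σ β : {β : CosetRep M J // ExtEdge i α β}, Stroll β.1 ω γ where
  toFun S := match S with
    | .cons (β := β) _ h S => ⟨⟨β, h⟩, S⟩
  invFun p := .cons i p.1.2 p.2
  left_inv S := by cases S; rfl
  right_inv _ := rfl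

open Classical in
-- Split off the first edge. The two extended edges with label i that leave α match the two terms of
-- `hecke_single`, the degree of the edge being the exponent; there is no such edge exactly when i
-- fixes α, and then the operator gives 0.
theorem finsum_stroll [Finite X] (ω : List B) (α γ : CosetRep M J) :
    ∑ᶠ S : Stroll α ω γ, (LaurentPolynomial.T S.degree : ℤ[T;T⁻¹]) =
      𝓜.heckeWord ω (Pi.single (𝓜.equiv α) 1) (𝓜.equiv γ) := by
  have : Finite (CosetRep M J) := Finite.of_equiv X 𝓜.equiv.symm
  have : Fintype (CosetRep M J) := Fintype.ofFinite _
  induction ω generalizing α with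
  | nil =>
    by_cases h : α = γ
    · subst h
      rw [finsum_eq_single _ (Stroll.nil α) (fun S hS => by cases S; exact absurd rfl hS)]
      simp [Stroll.degree, heckeWord]
    · have : IsEmpty (Stroll α [] γ) := ⟨fun S => by cases S; exact h rfl⟩
      rw [finsum_of_isEmpty]
      simp [heckeWord, Ne.symm h]
  | cons i ω ih =>
    have : ∀ β, Fintype (Stroll β ω γ) := fun β => Fintype.ofFinite _
    have : Fintype (Stroll α (i :: ω) γ) := Fintype.ofFinite _
    have e : ∑ᶠ S : Stroll α (i :: ω) γ, (LaurentPolynomial.T S.degree : ℤ[T;T⁻¹]) =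
        ∑ β ∈ Finset.univ.filter (fun β => ExtEdge i α β),
          (LaurentPolynomial.T (edgeDegree i α β) : ℤ[T;T⁻¹]) *
            𝓜.heckeWord ω (Pi.single (𝓜.equiv β) 1) (𝓜.equiv γ) := by
      rw [finsum_eq_sum_of_fintype, ← Finset.sum_subtype_eq_sum_filter,
        ← (strollConsEquiv i ω α γ).symm.sum_comp, Fintype.sum_sigma]
      refine Finset.sum_congr (by ext; simp) fun β _ => ?_
      rw [← ih, finsum_eq_sum_of_fintype, Finset.mul_sum]
      refine Finset.sum_congr rfl fun S _ => ?_
      rw [← LaurentPolynomial.T_add]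
      rfl
    rw [e, heckeWord_cons]
    by_cases h : 𝓜.act i (𝓜.equiv α) = 𝓜.equiv α
    · rw [𝓜.hecke_single_fix h, Finset.filter_false_of_mem, Finset.sum_empty]
      · have := 𝓜.heckeWord_smul ω 0 0
        rw [zero_smul, zero_smul] at this
        rw [this]
        rfl
      · intro β _ hβ
        exact ((𝓜.extEdge_iff i α β).1 hβ).1 h
    · have hne : 𝓜.equiv.symm (𝓜.act i (𝓜.equiv α)) ≠ α := by
        rwa [Ne, Equiv.symm_apply_eq]
      have hs : Finset.univ.filter (fun β => ExtEdge i α β) =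
          {𝓜.equiv.symm (𝓜.act i (𝓜.equiv α)), α} := by
        ext β
        simp [𝓜.extEdge_iff, h, or_comm]
      rw [hs, Finset.sum_pair hne, edgeDegree_of_ne hne, 𝓜.edgeDegree_self h, 𝓜.hecke_single h,
        heckeWord_add, heckeWord_smul]
      simp

open Classical in
/-- The image of the generator of the anti-spherical module under a word. -/
noncomputable def column (ω : List B) : X → ℤ[T;T⁻¹] :=
  𝓜.heckeWord ω (Pi.single 𝓜.base 1)

theorem column_append_singleton (ω : List B) (i : B) :
    𝓜.column (ω ++ [i]) = 𝓜.hecke i (𝓜.column ω) := 𝓜.heckeWord_append_singleton i ω _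

theorem lightLeaves_eq [Finite X] (t : ∀ μ : CosetRep M J, ReducedPath μ) (lam μ : CosetRep M J) :
    lightLeaves t lam μ = 𝓜.column (t μ).word (𝓜.equiv lam) := by
  rw [lightLeaves, 𝓜.finsum_stroll, equiv_empty, column]

/-- Words that lead from the base element to `x` along edges of the Bruhat graph. -/
inductive IsUpWord : List B → X → Prop
  | nil : IsUpWord [] 𝓜.base
  | snoc {ω : List B} {x : X} (i : B) (h : IsUpWord ω x) (hi : x < 𝓜.act i x) :
      IsUpWord (ω ++ [i]) (𝓜.act i x)

variable {𝓜}

/-- An edge raises the rank by at most one, with equality only for an upward edge of the Bruhat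
graph. A path that gains its full length therefore uses no loops and no downward edges. The prefix η
makes the statement inductive in the starting point. -/
theorem isUpWord_of_stroll {α γ : CosetRep M J} {ω : List B} (S : Stroll α ω γ) :
    𝓜.rank (𝓜.equiv γ) ≤ 𝓜.rank (𝓜.equiv α) + ω.length ∧
    (𝓜.rank (𝓜.equiv γ) = 𝓜.rank (𝓜.equiv α) + ω.length →
      ∀ η, 𝓜.IsUpWord η (𝓜.equiv α) → 𝓜.IsUpWord (η ++ ω) (𝓜.equiv γ)) := by
  induction S with
  | nil => simp
  | @cons α β γ ω i h S ih =>
    obtain ⟨hne, hβ⟩ := (𝓜.extEdge_iff i α β).1 h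
    have hr : 𝓜.rank (𝓜.equiv β) ≤ 𝓜.rank (𝓜.equiv α) + 1 := by
      rcases hβ with rfl | rfl
      · omega
      · rw [Equiv.apply_symm_apply]
        exact 𝓜.rank_act_le _ _
    rw [List.length_cons]
    refine ⟨by omega, fun he η hη => ?_⟩
    have h1 := ih.2 (by omega) (η ++ [i])
    rw [List.append_assoc, List.singleton_append] at h1
    apply h1
    rcases hβ with rfl | rfl
    · omega
    · rw [Equiv.apply_symm_apply] at ih hr ⊢
      rcases 𝓜.comparable i (𝓜.equiv α) with h' | h' | h'
      · exact hη.snoc i h'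
      · have := 𝓜.rank_down h'
        omega
      · exact absurd h' hne

/-- A reduced word of μ is the weight of some path, so a shortest path has at most `len M μ.1`
edges; this is the rank of μ, which forces every edge to go up. -/
theorem isUpWord_reducedPath {μ : CosetRep M J} (t : ReducedPath μ) :
    𝓜.IsUpWord t.word (𝓜.equiv μ) := by
  obtain ⟨ω, hω, hμ⟩ := M.toCoxeterSystem.exists_isReduced μ.1
  have h1 := t.minimal ω (exists_stroll ω hω μ hμ.symm)
  have h2 := isUpWord_of_stroll (𝓜 := 𝓜) t.path
  have h3 : len M μ.1 = ω.length := by rw [hμ]; exact hω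
  rw [𝓜.len_eq] at h3
  rw [equiv_empty, rank_base] at h2
  simpa using h2.2 (by omega) [] .nil

/-- Unitriangularity of Δ. The support stays below the end point by `act_le_act`, and the new
leading coefficient is the old one, because the previous column vanishes at the new end point. -/
theorem IsUpWord.column_le {ω : List B} {x : X} (h : 𝓜.IsUpWord ω x) :
    𝓜.column ω x = 1 ∧ ∀ y, 𝓜.column ω y ≠ 0 → y ≤ x := by
  induction h with
  | nil =>
    refine ⟨by simp [column, heckeWord], fun y hy => ?_⟩
    by_contra hne
    refine hy ?_
    simp [column, heckeWord, show y ≠ 𝓜.base by rintro rfl; exact hne le_rfl]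
  | @snoc ω x i h hi ih =>
    rw [column_append_singleton]
    constructor
    · rw [hecke_down _ (by rwa [act_act]), act_act, ih.1]
      have : 𝓜.column ω (𝓜.act i x) = 0 := by
        by_contra h'
        exact (ih.2 _ h').not_gt hi
      rw [this, mul_zero, add_zero]
    · intro y hy
      have h0 : ¬ y ≤ x → 𝓜.column ω y = 0 := fun h' => by
        by_contra h''
        exact h' (ih.2 _ h'')
      have h1 : ¬ 𝓜.act i y ≤ x → 𝓜.column ω (𝓜.act i y) = 0 := fun h' => by
        by_contra h''
        exact h' (ih.2 _ h'')
      by_contra hne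
      have h2 := h0 fun h => hne (h.trans hi.le)
      rcases 𝓜.comparable i y with h' | h' | h'
      · refine hy ?_
        rw [𝓜.hecke_up h', h2, h1 fun h => hne (h'.le.trans (h.trans hi.le))]
        simp
      · by_cases h3 : 𝓜.act i y ≤ x
        · have := 𝓜.act_le_act i _ _ h3 (𝓜.up_of_down h') hi
          rw [act_act] at this
          exact hne this
        · refine hy ?_
          rw [𝓜.hecke_down h', h2, h1 h3]
          simp
      · exact hy (𝓜.hecke_fix h' _)

variable (𝓜)

theorem exists_isUpWord (x : X) : ∃ ω, 𝓜.IsUpWord ω x := by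
  induction hn : 𝓜.rank x using Nat.strong_induction_on generalizing x with
  | _ n ih =>
    by_cases hx : x = 𝓜.base
    · exact ⟨[], hx ▸ .nil⟩
    · obtain ⟨i, hi⟩ := 𝓜.exists_down hx
      have hr := 𝓜.rank_down hi
      obtain ⟨ω, hω⟩ := ih (𝓜.rank (𝓜.act i x)) (by omega) _ rfl
      have := hω.snoc i (𝓜.up_of_down hi)
      rw [act_act] at this
      exact ⟨_, this⟩

end CosetModel

/-! ### The recursion as a matrix factorization -/

theorem IsPositive.zero : IsPositive 0 := ⟨0, by simp⟩

/-- A factorization `Δ = N b` of a square matrix into a unitriangular matrix with entries in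
`q ℤ[q]` above the diagonal and a unitriangular matrix with entries in `ℤ[q + q⁻¹]`. -/
structure IsKLFactorization {X : Type} [PartialOrder X] [Fintype X]
    (Δ N b : X → X → ℤ[T;T⁻¹]) : Prop where
  diag_N : ∀ x, N x x = 1
  diag_b : ∀ x, b x x = 1
  positive : ∀ x y, x ≠ y → IsPositive (N x y)
  selfDual_b : ∀ x y, b x y ∈ selfDual
  N_eq_zero : ∀ x y, ¬ x ≤ y → N x y = 0
  b_eq_zero : ∀ x y, ¬ x ≤ y → b x y = 0
  eq_sum : ∀ x y, Δ x y = ∑ z, N x z * b z y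

/-- The recursion is the equation Δ = N b with the two extreme terms of the sum moved to the left.
It ranges over all pairs of distinct elements, so the triangularity of N and b has to be derived. -/
theorem CosetModel.isKLFactorization {B : Type} {M : CoxeterMatrix B} {J : Set B} {X : Type}
    [PartialOrder X] [Fintype X] (𝓜 : CosetModel M J X) {t : ∀ μ : CosetRep M J, ReducedPath μ}
    {N b : Matrix (CosetRep M J) (CosetRep M J) ℤ[T;T⁻¹]} (h : IsKLPair t N b) :
    IsKLFactorization (fun x y => 𝓜.column (t (𝓜.equiv.symm y)).word x)
      (fun x y => N (𝓜.equiv.symm x) (𝓜.equiv.symm y))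
      (fun x y => b (𝓜.equiv.symm x) (𝓜.equiv.symm y)) := by
  classical
  have hup : ∀ y, 𝓜.IsUpWord (t (𝓜.equiv.symm y)).word y := fun y => by
    simpa using isUpWord_reducedPath (𝓜 := 𝓜) (t (𝓜.equiv.symm y))
  have hrec : ∀ x y, x ≠ y → b (𝓜.equiv.symm x) (𝓜.equiv.symm y) +
      N (𝓜.equiv.symm x) (𝓜.equiv.symm y) = 𝓜.column (t (𝓜.equiv.symm y)).word x -
        ∑ z ∈ Finset.univ.filter (fun z => x < z ∧ z < y),
          N (𝓜.equiv.symm x) (𝓜.equiv.symm z) * b (𝓜.equiv.symm z) (𝓜.equiv.symm y) := by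
    intro x y hxy
    rw [h.recursion _ _ (𝓜.equiv.symm.injective.ne hxy), 𝓜.lightLeaves_eq,
      Equiv.apply_symm_apply]
    congr 1
    rw [← finsum_mem_coe_finset, ← finsum_mem_image (g := 𝓜.equiv.symm)
      (f := fun ν => N (𝓜.equiv.symm x) ν * b ν (𝓜.equiv.symm y))
      𝓜.equiv.symm.injective.injOn]
    refine finsum_mem_congr ?_ fun _ _ => rfl
    ext ν
    simp [𝓜.lt_iff]
  -- Here the sum is empty and Δ vanishes, so b = -N lies in ℤ[q + q⁻¹] ∩ qℤ[q] = 0.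
  have hzero : ∀ x y, ¬ x ≤ y → N (𝓜.equiv.symm x) (𝓜.equiv.symm y) = 0 ∧
      b (𝓜.equiv.symm x) (𝓜.equiv.symm y) = 0 := by
    intro x y hxy
    have hne : x ≠ y := fun e => hxy e.le
    have hne' := 𝓜.equiv.symm.injective.ne hne
    have h1 := hrec x y hne
    have h2 : 𝓜.column (t (𝓜.equiv.symm y)).word x = 0 := by
      by_contra h'
      exact hxy ((hup y).column_le.2 _ h')
    rw [h2, Finset.filter_false_of_mem (fun z _ hz => hxy (hz.1.trans hz.2).le),
      Finset.sum_empty, sub_zero] at h1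
    have h3 : b (𝓜.equiv.symm x) (𝓜.equiv.symm y) = 0 - N (𝓜.equiv.symm x) (𝓜.equiv.symm y) := by
      linear_combination h1
    have h4 := eq_zero_of_selfDual_of_isPositive (h.selfDual_b _ _ hne')
      (h3 ▸ IsPositive.zero.sub (h.positive_N _ _ hne'))
    rw [h4, zero_add] at h1
    exact ⟨h1, h4⟩
  refine ⟨fun x => (h.diag _).1, fun x => (h.diag _).2,
    fun x y hxy => h.positive_N _ _ (𝓜.equiv.symm.injective.ne hxy), fun x y => ?_,
    fun x y hxy => (hzero x y hxy).1, fun x y hxy => (hzero x y hxy).2, fun x y => ?_⟩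
  · by_cases hxy : x = y
    · subst hxy
      rw [(h.diag _).2]
      exact one_mem _
    · exact h.selfDual_b _ _ (𝓜.equiv.symm.injective.ne hxy)
  · have hout : ∀ z, ¬ (x ≤ z ∧ z ≤ y) →
        N (𝓜.equiv.symm x) (𝓜.equiv.symm z) * b (𝓜.equiv.symm z) (𝓜.equiv.symm y) = 0 := by
      intro z hz
      by_cases hxz : x ≤ z
      · rw [(hzero z y fun h => hz ⟨hxz, h⟩).2, mul_zero]
      · rw [(hzero x z hxz).1, zero_mul]
    by_cases hxy : x = y
    · subst hxy
      rw [Finset.sum_eq_single x (fun z _ hz => hout z fun h => hz (le_antisymm h.2 h.1))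
        (by simp), (h.diag _).1, (h.diag _).2, (hup x).column_le.1, one_mul]
    · have h1 := hrec x y hxy
      -- Outside the open interval only z = x and z = y survive; they give the terms b and N on the
      -- left of the recursion.
      have h2 : ∑ z ∈ {x, y}, N (𝓜.equiv.symm x) (𝓜.equiv.symm z) *
          b (𝓜.equiv.symm z) (𝓜.equiv.symm y) =
          ∑ z ∈ Finset.univ.filter (fun z => ¬ (x < z ∧ z < y)),
            N (𝓜.equiv.symm x) (𝓜.equiv.symm z) * b (𝓜.equiv.symm z) (𝓜.equiv.symm y) := by
        refine Finset.sum_subset ?_ fun z hz hz' => ?_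
        · intro z hz
          simp only [Finset.mem_insert, Finset.mem_singleton] at hz
          rcases hz with rfl | rfl <;> simp
        · simp only [Finset.mem_insert, Finset.mem_singleton, not_or, Finset.mem_filter,
            Finset.mem_univ, true_and] at hz hz'
          exact hout z fun h => hz ⟨lt_of_le_of_ne h.1 (Ne.symm hz'.1), lt_of_le_of_ne h.2 hz'.2⟩
      rw [← Finset.sum_filter_add_sum_filter_not Finset.univ (fun z => x < z ∧ z < y), ← h2,
        Finset.sum_pair hxy, (h.diag _).1, (h.diag _).2]
      linear_combination -h1

end ParabolicKL

/-! ### Temperley-Lieb relations and the lattice of columns -/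

namespace ParabolicKL

open scoped LaurentPolynomial

theorem T_one_mul_T_neg_one :
    (LaurentPolynomial.T 1 * LaurentPolynomial.T (-1) : ℤ[T;T⁻¹]) = 1 := by
  rw [← LaurentPolynomial.T_add]
  simp

namespace CosetModel

variable {B : Type} {M : CoxeterMatrix B} {J : Set B} {X : Type} [PartialOrder X]
  (𝓜 : CosetModel M J X)

theorem hecke_comm {i j : B} (h : M i j = 2) (v : X → ℤ[T;T⁻¹]) :
    𝓜.hecke i (𝓜.hecke j v) = 𝓜.hecke j (𝓜.hecke i v) := by
  have h' : M j i = 2 := M.symmetric j i ▸ h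
  funext x
  have e := 𝓜.act_comm h x
  rcases 𝓜.comparable i x with hi | hi | hi
  · rw [𝓜.hecke_up hi]
    rcases 𝓜.comparable j x with hj | hj | hj
    · rw [𝓜.hecke_up hj, 𝓜.hecke_up hj, 𝓜.hecke_up hi, 𝓜.hecke_up ((𝓜.up_act_iff h' x).2 hj),
        𝓜.hecke_up ((𝓜.up_act_iff h x).2 hi), e]
      ring
    · rw [𝓜.hecke_down hj, 𝓜.hecke_down hj, 𝓜.hecke_up hi,
        𝓜.hecke_down ((𝓜.down_act_iff h' x).2 hj), 𝓜.hecke_up ((𝓜.up_act_iff h x).2 hi), e]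
      ring
    · rw [𝓜.hecke_fix hj, 𝓜.hecke_fix hj, 𝓜.hecke_fix ((𝓜.fix_act_iff h' x).2 hj)]
      ring
  · rw [𝓜.hecke_down hi]
    rcases 𝓜.comparable j x with hj | hj | hj
    · rw [𝓜.hecke_up hj, 𝓜.hecke_up hj, 𝓜.hecke_down hi, 𝓜.hecke_up ((𝓜.up_act_iff h' x).2 hj),
        𝓜.hecke_down ((𝓜.down_act_iff h x).2 hi), e]
      ring
    · rw [𝓜.hecke_down hj, 𝓜.hecke_down hj, 𝓜.hecke_down hi,
        𝓜.hecke_down ((𝓜.down_act_iff h' x).2 hj), 𝓜.hecke_down ((𝓜.down_act_iff h x).2 hi), e]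
      ring
    · rw [𝓜.hecke_fix hj, 𝓜.hecke_fix hj, 𝓜.hecke_fix ((𝓜.fix_act_iff h' x).2 hj)]
      ring
  · rw [𝓜.hecke_fix hi]
    rcases 𝓜.comparable j x with hj | hj | hj
    · rw [𝓜.hecke_up hj, 𝓜.hecke_fix hi, 𝓜.hecke_fix ((𝓜.fix_act_iff h x).2 hi)]
      ring
    · rw [𝓜.hecke_down hj, 𝓜.hecke_fix hi, 𝓜.hecke_fix ((𝓜.fix_act_iff h x).2 hi)]
      ring
    · rw [𝓜.hecke_fix hj]

theorem hecke_hecke (i : B) (v : X → ℤ[T;T⁻¹]) : 𝓜.hecke i (𝓜.hecke i v) =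
    (LaurentPolynomial.T 1 + LaurentPolynomial.T (-1) : ℤ[T;T⁻¹]) • 𝓜.hecke i v := by
  funext x
  rw [Pi.smul_apply, smul_eq_mul]
  have e := T_one_mul_T_neg_one
  rcases 𝓜.comparable i x with hi | hi | hi
  · rw [𝓜.hecke_up hi, 𝓜.hecke_up hi, 𝓜.hecke_down (by rwa [act_act]), act_act]
    linear_combination -v x * e
  · rw [𝓜.hecke_down hi, 𝓜.hecke_down hi, 𝓜.hecke_up (𝓜.up_of_down hi), act_act]
    linear_combination -v x * e
  · rw [𝓜.hecke_fix hi, 𝓜.hecke_fix hi, mul_zero]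

/-- C_i C_j C_i - C_i is the Kazhdan-Lusztig element of the longest element of the dihedral
subgroup. It acts by zero because no orbit of that subgroup is a full hexagon. -/
theorem hecke_braid {i j : B} (h : M i j = 3) (v : X → ℤ[T;T⁻¹]) :
    𝓜.hecke i (𝓜.hecke j (𝓜.hecke i v)) = 𝓜.hecke i v := by
  funext x
  have e := T_one_mul_T_neg_one
  rcases 𝓜.comparable i x with hi | hi | hi
  · rw [𝓜.hecke_up hi]
    rcases 𝓜.braid₃ i j x h hi with ⟨h1, h2, h3⟩ | ⟨h1, h2, h3⟩
    · rw [𝓜.hecke_fix h1, 𝓜.hecke_up h2, 𝓜.hecke_fix h3, 𝓜.hecke_down (by rwa [act_act]),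
        act_act, 𝓜.hecke_up hi]
      linear_combination v (𝓜.act i x) * e
    · rw [𝓜.hecke_fix h2, 𝓜.hecke_down h1, 𝓜.hecke_fix h3, 𝓜.hecke_up hi]
      linear_combination (v (𝓜.act i x) + LaurentPolynomial.T 1 * v x) * e
  · rw [𝓜.hecke_down hi]
    have hb := 𝓜.braid₃ i j _ h (𝓜.up_of_down hi)
    rw [act_act] at hb
    rcases hb with ⟨h1, h2, h3⟩ | ⟨h1, h2, h3⟩
    · rw [𝓜.hecke_fix h1, 𝓜.hecke_up h2, 𝓜.hecke_fix h3, 𝓜.hecke_down hi]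
      linear_combination (v (𝓜.act i x) + LaurentPolynomial.T (-1) * v x) * e
    · rw [𝓜.hecke_fix h2, 𝓜.hecke_down h1, 𝓜.hecke_fix h3, 𝓜.hecke_up (𝓜.up_of_down hi),
        act_act, 𝓜.hecke_down hi]
      linear_combination v (𝓜.act i x) * e
  · rw [𝓜.hecke_fix hi, 𝓜.hecke_fix hi]

theorem IsUpWord.cases_down {𝓜 : CosetModel M J X} {ω : List B} {x : X} (h : 𝓜.IsUpWord ω x) :
    (ω = [] ∧ x = 𝓜.base) ∨
      ∃ η i, ω = η ++ [i] ∧ 𝓜.act i x < x ∧ 𝓜.IsUpWord η (𝓜.act i x) := by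
  cases h with
  | nil => exact Or.inl ⟨rfl, rfl⟩
  | @snoc η y i h hi =>
    refine Or.inr ⟨η, i, rfl, ?_⟩
    rw [act_act]
    exact ⟨hi, h⟩

/-- Any two reduced words of an element are related by commutations. -/
theorem IsUpWord.column_eq {𝓜 : CosetModel M J X} {ω η : List B} {x : X}
    (hω : 𝓜.IsUpWord ω x) (hη : 𝓜.IsUpWord η x) : 𝓜.column ω = 𝓜.column η := by
  induction hn : 𝓜.rank x using Nat.strong_induction_on generalizing x ω η with
  | _ n ih =>
    subst hn
    rcases hω.cases_down with ⟨rfl, rfl⟩ | ⟨ω, i, rfl, hi, hω'⟩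
    · rcases hη.cases_down with ⟨rfl, -⟩ | ⟨η, j, rfl, hj, -⟩
      · rfl
      · exact absurd hj (𝓜.not_down_base j)
    · rcases hη.cases_down with ⟨-, rfl⟩ | ⟨η, j, rfl, hj, hη'⟩
      · exact absurd hi (𝓜.not_down_base i)
      rw [column_append_singleton, column_append_singleton]
      have hri := 𝓜.rank_down hi
      have hrj := 𝓜.rank_down hj
      by_cases hij : i = j
      · subst hij
        rw [ih _ (by omega) hω' hη' rfl]
      · have hm := 𝓜.order_eq_two_of_down hij hi hj
        have hm' : M j i = 2 := M.symmetric j i ▸ hm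
        obtain ⟨ζ, hζ⟩ := 𝓜.exists_isUpWord (𝓜.act i (𝓜.act j x))
        have h1 := hζ.snoc i (𝓜.up_of_down ((𝓜.down_act_iff hm x).2 hi))
        rw [𝓜.act_comm hm] at hζ
        have h2 := hζ.snoc j (𝓜.up_of_down ((𝓜.down_act_iff hm' x).2 hj))
        rw [act_act] at h1 h2
        rw [ih _ (by omega) hω' h2 rfl, ih _ (by omega) hη' h1 rfl, column_append_singleton,
          column_append_singleton, 𝓜.hecke_comm hm]

/-- The `ℤ[q + q⁻¹]`-span of the columns of the elements of rank less than `k`. -/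
noncomputable def columnSpan (k : ℕ) : Submodule selfDual (X → ℤ[T;T⁻¹]) :=
  Submodule.span selfDual {v | ∃ ω x, 𝓜.IsUpWord ω x ∧ 𝓜.rank x < k ∧ 𝓜.column ω = v}

variable {𝓜}

theorem columnSpan_mono {k l : ℕ} (h : k ≤ l) : 𝓜.columnSpan k ≤ 𝓜.columnSpan l := by
  refine Submodule.span_mono ?_
  rintro v ⟨ω, x, h1, h2, h3⟩
  exact ⟨ω, x, h1, by omega, h3⟩

theorem IsUpWord.mem_columnSpan {ω : List B} {x : X} {k : ℕ} (h : 𝓜.IsUpWord ω x)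
    (hk : 𝓜.rank x < k) : 𝓜.column ω ∈ 𝓜.columnSpan k :=
  Submodule.subset_span ⟨ω, x, h, hk, rfl⟩

variable (𝓜) in
theorem map_mem_of_forall_column {L : Submodule selfDual (X → ℤ[T;T⁻¹])} {k : ℕ}
    (f : (X → ℤ[T;T⁻¹]) →ₗ[ℤ[T;T⁻¹]] (X → ℤ[T;T⁻¹]))
    (h : ∀ ω x, 𝓜.IsUpWord ω x → 𝓜.rank x < k → f (𝓜.column ω) ∈ L) {v : X → ℤ[T;T⁻¹]}
    (hv : v ∈ 𝓜.columnSpan k) : f v ∈ L := by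
  unfold columnSpan at hv
  induction hv using Submodule.span_induction with
  | mem v hv =>
    obtain ⟨ω, x, h1, h2, rfl⟩ := hv
    exact h ω x h1 h2
  | zero => rw [map_zero]; exact zero_mem _
  | add v w _ _ hv hw => rw [map_add]; exact add_mem hv hw
  | smul a v _ hv =>
    have : f (a • v) = a • f v := f.map_smul (a : ℤ[T;T⁻¹]) v
    rw [this]
    exact L.smul_mem a hv

/-- Induction on the rank. If i raises x, the result is again the column of a reduced word; if i
lowers x, a reduced word of x can be chosen to end in i, and C_i² = (q + q⁻¹) C_i applies. If i
fixes x, the last letter j of the word differs from i and one either commutes C_i past C_j or uses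
the braid relation. The sharper rank bound for fixed x is what lets the commuting case close. -/
theorem hecke_column_mem (hM : ∀ i j, i ≠ j → M i j ≠ 4) {ω : List B} {x : X}
    (hω : 𝓜.IsUpWord ω x) (i : B) :
    𝓜.hecke i (𝓜.column ω) ∈ 𝓜.columnSpan (𝓜.rank x + 2) ∧
    (𝓜.act i x = x → 𝓜.hecke i (𝓜.column ω) ∈ 𝓜.columnSpan (𝓜.rank x)) := by
  classical
  induction hn : 𝓜.rank x using Nat.strong_induction_on generalizing x ω i with
  | _ n ih =>
  subst hn
  have key : 𝓜.act i x = x → 𝓜.hecke i (𝓜.column ω) ∈ 𝓜.columnSpan (𝓜.rank x) := by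
    intro hi
    rcases hω.cases_down with ⟨rfl, rfl⟩ | ⟨η, j, rfl, hj, hη⟩
    · have : 𝓜.column [] = Pi.single 𝓜.base 1 := rfl
      rw [this, 𝓜.hecke_single_fix hi]
      exact zero_mem _
    · have hij : i ≠ j := by rintro rfl; exact hj.ne hi
      have hr := 𝓜.rank_down hj
      rw [column_append_singleton]
      rcases 𝓜.order i j hij with h | h | h
      -- As i also fixes the image of x under j, the inner vector only involves ranks below `rank x
      -- - 1`, and C_j raises this bound by one.
      · rw [𝓜.hecke_comm h]
        refine 𝓜.map_mem_of_forall_column _ (fun ζ y hζ hy => ?_)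
          ((ih _ (by omega) hη i rfl).2 ((𝓜.fix_act_iff h x).2 hi))
        exact columnSpan_mono (by omega) (ih _ (by omega) hζ j rfl).1
      · obtain ⟨h1, -⟩ := 𝓜.fix_down₃ h hi hj
        -- The word of the image of x under j is replaced by one that ends in i, so that the last
        -- three operators are C_i, C_j, C_i and collapse to C_i.
        obtain ⟨ζ, hζ⟩ := 𝓜.exists_isUpWord (𝓜.act i (𝓜.act j x))
        have h2 := hζ.snoc i (𝓜.up_of_down h1)
        rw [act_act] at h2
        rw [hη.column_eq h2, column_append_singleton, 𝓜.hecke_braid h,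
          ← column_append_singleton]
        exact h2.mem_columnSpan (by omega)
      · exact absurd h (hM i j hij)
  refine ⟨?_, key⟩
  rcases 𝓜.comparable i x with hi | hi | hi
  · have := hω.snoc i hi
    rw [← column_append_singleton]
    exact this.mem_columnSpan (by rw [𝓜.rank_act _ _ hi]; omega)
  · obtain ⟨ζ, hζ⟩ := 𝓜.exists_isUpWord (𝓜.act i x)
    have h2 := hζ.snoc i (𝓜.up_of_down hi)
    rw [act_act] at h2
    rw [hω.column_eq h2, column_append_singleton, 𝓜.hecke_hecke, ← column_append_singleton]
    exact (𝓜.columnSpan _).smul_mem ⟨_, Algebra.subset_adjoin rfl⟩ (h2.mem_columnSpan (by omega))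
  · exact columnSpan_mono (by omega) (key hi)

end CosetModel

/-! ### Uniqueness of the Kazhdan-Lusztig basis of a lattice -/

section Factorization

variable {X : Type} [PartialOrder X] [Fintype X]

/-- As b is unitriangular over ℤ[q + q⁻¹], the equation Δ = N b can be solved for the columns of N
by induction along the order. -/
theorem IsKLFactorization.mem_of_forall {Δ N b : X → X → ℤ[T;T⁻¹]} (h : IsKLFactorization Δ N b)
    {L : Submodule selfDual (X → ℤ[T;T⁻¹])} (hL : ∀ y, (fun x => Δ x y) ∈ L) (y : X) :
    (fun x => N x y) ∈ L := by
  classical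
  induction y using WellFoundedLT.induction with
  | _ y ih =>
    have e : (fun x => N x y) = (fun x => Δ x y) -
        ∑ z ∈ Finset.univ.filter (fun z => z < y),
          (⟨b z y, h.selfDual_b z y⟩ : selfDual) • (fun x => N x z) := by
      funext x
      have h1 := h.eq_sum x y
      rw [← Finset.add_sum_erase _ _ (Finset.mem_univ y), h.diag_b, mul_one] at h1
      have h2 : ∑ z ∈ Finset.univ.erase y, N x z * b z y =
          ∑ z ∈ Finset.univ.filter (fun z => z < y), N x z * b z y := by
        symm
        refine Finset.sum_subset (fun z hz => ?_) fun z hz hz' => ?_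
        · simp only [Finset.mem_filter, Finset.mem_univ, true_and] at hz
          simp [hz.ne]
        · simp only [Finset.mem_erase, Finset.mem_filter, Finset.mem_univ, and_true, true_and]
            at hz hz'
          rw [h.b_eq_zero z y fun hle => hz' (lt_of_le_of_ne hle hz), mul_zero]
      rw [h2] at h1
      rw [Pi.sub_apply, Finset.sum_apply, h1]
      rw [eq_sub_iff_add_eq]
      congr 1
      refine Finset.sum_congr rfl fun z _ => ?_
      rw [mul_comm]
      rfl
    rw [e]
    refine sub_mem (hL y) (sum_mem fun z hz => L.smul_mem _ (ih z ?_))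
    simpa using hz

/-- Once all coefficients above x vanish, the coordinate at x of the combination is a x itself,
which then lies in ℤ[q + q⁻¹] ∩ qℤ[q] = 0. -/
theorem IsKLFactorization.eq_zero {Δ N b : X → X → ℤ[T;T⁻¹]} (h : IsKLFactorization Δ N b)
    {a : X → ℤ[T;T⁻¹]} (ha : ∀ x, a x ∈ selfDual) (hp : ∀ x, IsPositive (∑ z, a z * N x z)) :
    ∀ x, a x = 0 := by
  classical
  intro x
  induction x using WellFoundedGT.induction with
  | _ x ih =>
    have e : ∑ z, a z * N x z = a x := by
      rw [Finset.sum_eq_single x, h.diag_N, mul_one]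
      · intro z _ hz
        by_cases hxz : x ≤ z
        · rw [ih z (lt_of_le_of_ne hxz hz.symm), zero_mul]
        · rw [h.N_eq_zero x z hxz, mul_zero]
      · simp
    exact eq_zero_of_selfDual_of_isPositive (ha x) (e ▸ hp x)

/-- The Kazhdan-Lusztig basis depends only on the `ℤ[q + q⁻¹]`-lattice that it spans. -/
theorem IsKLFactorization.eq_of_mem {Δ N b Δ' N' b' : X → X → ℤ[T;T⁻¹]}
    (h : IsKLFactorization Δ N b) (h' : IsKLFactorization Δ' N' b')
    (hmem : ∀ y, (fun x => N' x y) ∈ Submodule.span selfDual (Set.range fun z x => N x z)) :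
    N' = N := by
  classical
  funext x y
  obtain ⟨a, ha⟩ := (Submodule.mem_span_range_iff_exists_fun selfDual).1 (hmem y)
  have ha' : ∀ x, N' x y = ∑ z, (a z : ℤ[T;T⁻¹]) * N x z := by
    intro x
    have := congrFun ha x
    rw [Finset.sum_apply] at this
    exact this.symm
  have hsub : ∀ x, ∑ z, ((a z : ℤ[T;T⁻¹]) - if z = y then 1 else 0) * N x z =
      N' x y - N x y := by
    intro x
    simp only [sub_mul, Finset.sum_sub_distrib, ha', ite_mul, one_mul, zero_mul,
      Finset.sum_ite_eq', Finset.mem_univ, if_true]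
  have hz := h.eq_zero (a := fun z => (a z : ℤ[T;T⁻¹]) - if z = y then 1 else 0)
    (fun z => sub_mem (a z).2 (by split_ifs; exacts [one_mem _, zero_mem _])) (fun x => by
      rw [hsub]
      by_cases hxy : x = y
      · rw [hxy, h.diag_N, h'.diag_N, sub_self]
        exact IsPositive.zero
      · exact (h'.positive x y hxy).sub (h.positive x y hxy))
  have := hsub x
  simp only [hz, zero_mul, Finset.sum_const_zero] at this
  exact (sub_eq_zero.1 this.symm)

end Factorization

/-! ### Folding of labels -/

/-- `𝓒` is obtained from `𝓓` by identifying labels of edges along `π`. -/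
structure IsFolding {B B' : Type} {M : CoxeterMatrix B} {J : Set B} {M' : CoxeterMatrix B'}
    {J' : Set B'} {X : Type} [PartialOrder X] (𝓒 : CosetModel M J X) (𝓓 : CosetModel M' J' X)
    (π : B' → B) : Prop where
  act_eq : ∀ k x, 𝓓.act k x ≠ x → 𝓒.act (π k) x = 𝓓.act k x
  exists_act : ∀ i x, 𝓒.act i x ≠ x → ∃ k, π k = i ∧ 𝓓.act k x ≠ x
  eq_of_act : ∀ k l x, π k = π l → 𝓓.act k x ≠ x → 𝓓.act l x ≠ x → k = l

namespace IsFolding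

variable {B B' : Type} {M : CoxeterMatrix B} {J : Set B} {M' : CoxeterMatrix B'}
    {J' : Set B'} {X : Type} [PartialOrder X] {𝓒 : CosetModel M J X} {𝓓 : CosetModel M' J' X}
    {π : B' → B}

open Classical in
-- At a point moved by i exactly one k over i acts, and it acts like i; the other summands vanish
-- there. At a point fixed by i every k over i acts trivially.
theorem hecke_eq [Fintype B'] (h : IsFolding 𝓒 𝓓 π) (i : B) (v : X → ℤ[T;T⁻¹]) :
    𝓒.hecke i v = ∑ k ∈ Finset.univ.filter (fun k => π k = i), 𝓓.hecke k v := by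
  funext x
  rw [Finset.sum_apply]
  by_cases hx : 𝓒.act i x = x
  · rw [𝓒.hecke_fix hx, Finset.sum_eq_zero]
    intro k hk
    apply 𝓓.hecke_fix
    by_contra hne
    have h1 := h.act_eq k x hne
    rw [(Finset.mem_filter.1 hk).2, hx] at h1
    exact hne h1.symm
  · obtain ⟨k, rfl, hk⟩ := h.exists_act i x hx
    rw [Finset.sum_eq_single k]
    · have e := h.act_eq k x hk
      rcases 𝓓.comparable k x with h' | h' | h'
      · rw [𝓓.hecke_up h', 𝓒.hecke_up (by rwa [e]), e]
      · rw [𝓓.hecke_down h', 𝓒.hecke_down (by rwa [e]), e]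
      · exact absurd h' hk
    · intro l hl hlk
      apply 𝓓.hecke_fix
      by_contra hne
      exact hlk (h.eq_of_act l k x (Finset.mem_filter.1 hl).2 hne hk)
    · simp

/-- Folding does not change the Kazhdan-Lusztig matrix. -/
theorem klMatrix_eq [Finite X] [Finite B'] (h : IsFolding 𝓒 𝓓 π)
    (hM : ∀ i j, i ≠ j → M' i j ≠ 4) (t : ∀ μ : CosetRep M J, ReducedPath μ)
    (t' : ∀ μ : CosetRep M' J', ReducedPath μ) (x y : X) :
    klMatrix t (𝓒.equiv.symm x) (𝓒.equiv.symm y) =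
      klMatrix t' (𝓓.equiv.symm x) (𝓓.equiv.symm y) := by
  classical
  have := Fintype.ofFinite X
  have := Fintype.ofFinite B'
  obtain ⟨b, hb⟩ := (exists_isKLPair t).choose_spec
  obtain ⟨b', hb'⟩ := (exists_isKLPair t').choose_spec
  have hC := 𝓒.isKLFactorization hb
  have hD := 𝓓.isKLFactorization hb'
  refine congrFun (congrFun (hD.eq_of_mem hC fun y => ?_) x) y
  -- K exceeds all ranks of the finite set X, so `columnSpan K` contains the columns of all reduced
  -- words.
  have hk : ∃ K, ∀ x, 𝓓.rank x < K :=
    ⟨Finset.univ.sup 𝓓.rank + 1, fun x => Nat.lt_succ_of_le (Finset.le_sup (Finset.mem_univ x))⟩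
  obtain ⟨K, hK⟩ := hk
  have hup : ∀ y, 𝓓.IsUpWord (t' (𝓓.equiv.symm y)).word y := fun y => by
    simpa using CosetModel.isUpWord_reducedPath (𝓜 := 𝓓) (t' (𝓓.equiv.symm y))
  -- The column of any reduced word is a column of Δ, as it depends only on the end point; Δ = N b
  -- then expands it in the columns of N.
  have hle : 𝓓.columnSpan K ≤ Submodule.span selfDual
      (Set.range fun z x => klMatrix t' (𝓓.equiv.symm x) (𝓓.equiv.symm z)) := by
    refine Submodule.span_le.2 ?_
    rintro _ ⟨ω, y, hω, -, rfl⟩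
    rw [hω.column_eq (hup y)]
    refine (Submodule.mem_span_range_iff_exists_fun selfDual).2
      ⟨fun z => ⟨_, hD.selfDual_b z y⟩, ?_⟩
    funext x
    rw [Finset.sum_apply, hD.eq_sum x y]
    exact Finset.sum_congr rfl fun z _ => mul_comm _ _
  refine hle ?_
  have hstab : ∀ i, ∀ v ∈ 𝓓.columnSpan K, 𝓓.hecke i v ∈ 𝓓.columnSpan K := by
    intro i v hv
    refine 𝓓.map_mem_of_forall_column _ (fun ω x hω _ => ?_) hv
    refine Submodule.span_mono ?_ (CosetModel.hecke_column_mem hM hω i).1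
    rintro _ ⟨η, y, h1, -, h2⟩
    exact ⟨η, y, h1, hK y, h2⟩
  have hbase : 𝓒.base = 𝓓.base := le_antisymm (𝓒.base_le _) (𝓓.base_le _)
  -- Both modules start from the same vector, since both base points are the least element of X;
  -- each further operator of the folded type is a sum of operators that preserve the lattice.
  have hcol : ∀ ω, 𝓒.column ω ∈ 𝓓.columnSpan K := by
    intro ω
    induction ω using List.reverseRecOn with
    | nil =>
      have : 𝓒.column [] = 𝓓.column [] := by
        simp [CosetModel.column, CosetModel.heckeWord, hbase]
      rw [this]
      exact CosetModel.IsUpWord.nil.mem_columnSpan (hK _)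
    | append_singleton ω i ih =>
      rw [𝓒.column_append_singleton, h.hecke_eq]
      exact sum_mem fun k _ => hstab k _ ih
  exact hC.mem_of_forall (fun y => hcol _) y

end IsFolding

end ParabolicKL

/-! ### Lattice paths and their reflections -/

namespace ParabolicKL

/-- Lattice paths with `n` steps, each of height `0` or `1`. The value at `k` of the path of a coset
diagram is the number of labels `∧` among the entries `0, …, k - 1`. -/
@[ext] structure HeightPath (n : ℕ) where
  val : ℕ → ℕ
  zero : val 0 = 0
  step : ∀ {k : ℕ}, k < n → val (k + 1) = val k ∨ val (k + 1) = val k + 1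
  -- The default value 0 beyond n makes a path determined by its values at 0, …, n.
  out : ∀ {k : ℕ}, n < k → val k = 0

namespace HeightPath

variable {n : ℕ}

instance : PartialOrder (HeightPath n) := PartialOrder.lift val fun _ _ => HeightPath.ext

instance : CoeFun (HeightPath n) (fun _ => ℕ → ℕ) := ⟨val⟩

theorem ext_val {x y : HeightPath n} (h : ∀ k, x k = y k) : x = y := HeightPath.ext (funext h)

theorem le_self (x : HeightPath n) (k : ℕ) : x k ≤ k := by
  induction k with
  | zero => rw [x.zero]
  | succ k ih =>
    by_cases hk : k < n
    · have := x.step hk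
      omega
    · rw [x.out (by omega)]
      omega

instance : Finite (HeightPath n) := by
  let f : HeightPath n → Fin (n + 1) → Fin (n + 1) := fun x k =>
    ⟨x k, by have := x.le_self k; omega⟩
  refine Finite.of_injective f fun x y hxy => ?_
  refine ext_val fun k => ?_
  by_cases hk : k < n + 1
  · have := congrArg Fin.val (congrFun hxy ⟨k, hk⟩)
    exact this
  · rw [x.out (by omega), y.out (by omega)]

/-- The height at `j + 1` after reflection of the path there. -/
def newHeight (n : ℕ) (h : ℕ → ℕ) (j : ℕ) : ℕ :=
  -- On a path both natural subtractions are exact, because the heights at 0, …, n do not decrease.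
  if j + 1 < n then h j + h (j + 2) - h (j + 1) else 2 * h j + 1 - h (j + 1)

/-- Swap the steps `j` and `j + 1`, or flip the last step if `j + 1 = n`. -/
def toggle (j : ℕ) (hj : j < n) (x : HeightPath n) : HeightPath n :=
  { val := fun k => if k = j + 1 then newHeight n x j else x k
    zero := by simp [x.zero]
    step := by
      intro k hk
      have h1 := x.step hj
      have h2 := x.step hk
      have h3 : j + 1 < n → x (j + 2) = x (j + 1) ∨ x (j + 2) = x (j + 1) + 1 := fun h => x.step h
      simp only [newHeight]
      by_cases e1 : k = j
      · subst e1
        split_ifs <;> omega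
      · by_cases e2 : k = j + 1
        · subst e2
          have h4 : x (j + 2) = x (j + 1 + 1) := rfl
          split_ifs <;> omega
        · rw [if_neg (by omega), if_neg (by omega)]
          exact h2
    out := by
      intro k hk
      rw [if_neg (by omega), x.out hk] }

theorem toggle_of_ne {j : ℕ} (hj : j < n) (x : HeightPath n) {k : ℕ} (hk : k ≠ j + 1) :
    toggle j hj x k = x k := if_neg hk

theorem toggle_self {j : ℕ} (hj : j < n) (x : HeightPath n) :
    toggle j hj x (j + 1) = newHeight n x j := if_pos rfl

theorem toggle_toggle {j : ℕ} (hj : j < n) (x : HeightPath n) :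
    toggle j hj (toggle j hj x) = x := by
  refine ext_val fun k => ?_
  by_cases hk : k = j + 1
  · subst hk
    have h1 := x.step hj
    have h3 : j + 1 < n → x (j + 2) = x (j + 1) ∨ x (j + 2) = x (j + 1) + 1 := fun h => x.step h
    rw [toggle_self, newHeight, toggle_of_ne hj x (by omega), toggle_of_ne hj x (by omega),
      toggle_self, newHeight]
    split_ifs <;> omega
  · rw [toggle_of_ne hj _ hk, toggle_of_ne hj _ hk]

/-- The path is reflected upwards by `toggle j`. -/
def IsUp (x : HeightPath n) (j : ℕ) : Prop :=
  x (j + 1) = x j ∧ (j + 1 < n → x (j + 2) = x (j + 1) + 1)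

/-- The path is reflected downwards by `toggle j`. -/
def IsDown (x : HeightPath n) (j : ℕ) : Prop :=
  x (j + 1) = x j + 1 ∧ (j + 1 < n → x (j + 2) = x (j + 1))

theorem toggle_cases {j : ℕ} (hj : j < n) (x : HeightPath n) :
    (x.IsUp j ∧ ¬ x.IsDown j ∧ newHeight n x j = x (j + 1) + 1) ∨
    (¬ x.IsUp j ∧ x.IsDown j ∧ newHeight n x j + 1 = x (j + 1)) ∨
    (¬ x.IsUp j ∧ ¬ x.IsDown j ∧ newHeight n x j = x (j + 1)) := by
  have h1 := x.step hj
  have h3 : j + 1 < n → x (j + 2) = x (j + 1) ∨ x (j + 2) = x (j + 1) + 1 := fun h => x.step h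
  simp only [IsUp, IsDown, newHeight]
  split_ifs <;> omega

theorem lt_toggle_of_lt {j : ℕ} (hj : j < n) {x : HeightPath n} (h : x (j + 1) < newHeight n x j) :
    x < toggle j hj x := by
  refine lt_of_le_of_ne (fun k => ?_) fun e => ?_
  · by_cases hk : k = j + 1
    · subst hk
      rw [toggle_self]
      exact h.le
    · rw [toggle_of_ne hj _ hk]
  · have := congrArg (fun y : HeightPath n => y (j + 1)) e
    simp only [toggle_self] at this
    omega

theorem toggle_lt_of_lt {j : ℕ} (hj : j < n) {x : HeightPath n} (h : newHeight n x j < x (j + 1)) :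
    toggle j hj x < x := by
  refine lt_of_le_of_ne (fun k => ?_) fun e => ?_
  · by_cases hk : k = j + 1
    · subst hk
      rw [toggle_self]
      exact h.le
    · rw [toggle_of_ne hj _ hk]
  · have := congrArg (fun y : HeightPath n => y (j + 1)) e
    simp only [toggle_self] at this
    omega

theorem toggle_eq_of_eq {j : ℕ} (hj : j < n) {x : HeightPath n} (h : newHeight n x j = x (j + 1)) :
    toggle j hj x = x := by
  refine ext_val fun k => ?_
  by_cases hk : k = j + 1
  · subst hk
    rw [toggle_self, h]
  · rw [toggle_of_ne hj _ hk]

theorem lt_toggle_iff {j : ℕ} (hj : j < n) (x : HeightPath n) : x < toggle j hj x ↔ x.IsUp j := by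
  rcases x.toggle_cases hj with ⟨h1, h2, h3⟩ | ⟨h1, h2, h3⟩ | ⟨h1, h2, h3⟩
  · simp [h1, lt_toggle_of_lt hj (x := x) (by omega)]
  · simp [h1, (toggle_lt_of_lt hj (x := x) (by omega)).not_gt]
  · simp [h1, toggle_eq_of_eq hj h3]

theorem toggle_lt_iff {j : ℕ} (hj : j < n) (x : HeightPath n) : toggle j hj x < x ↔ x.IsDown j := by
  rcases x.toggle_cases hj with ⟨h1, h2, h3⟩ | ⟨h1, h2, h3⟩ | ⟨h1, h2, h3⟩
  · simp [h2, (lt_toggle_of_lt hj (x := x) (by omega)).not_gt]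
  · simp [h2, toggle_lt_of_lt hj (x := x) (by omega)]
  · simp [h2, toggle_eq_of_eq hj h3]

theorem toggle_eq_iff {j : ℕ} (hj : j < n) (x : HeightPath n) :
    toggle j hj x = x ↔ ¬ x.IsUp j ∧ ¬ x.IsDown j := by
  rcases x.toggle_cases hj with ⟨h1, h2, h3⟩ | ⟨h1, h2, h3⟩ | ⟨h1, h2, h3⟩
  · simp [h1, (lt_toggle_of_lt hj (x := x) (by omega)).ne']
  · simp [h2, (toggle_lt_of_lt hj (x := x) (by omega)).ne]
  · simp [h1, h2, toggle_eq_of_eq hj h3]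

theorem toggle_val_of_isUp {j : ℕ} (hj : j < n) {x : HeightPath n} (h : x.IsUp j) :
    toggle j hj x (j + 1) = x (j + 1) + 1 := by
  rcases x.toggle_cases hj with ⟨_, _, h3⟩ | ⟨h1, _, _⟩ | ⟨h1, _, _⟩
  · rw [toggle_self, h3]
  · exact absurd h h1
  · exact absurd h h1

theorem toggle_val_of_isDown {j : ℕ} (hj : j < n) {x : HeightPath n} (h : x.IsDown j) :
    toggle j hj x (j + 1) + 1 = x (j + 1) := by
  rcases x.toggle_cases hj with ⟨_, h1, _⟩ | ⟨_, _, h3⟩ | ⟨_, h1, _⟩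
  · exact absurd h h1
  · rw [toggle_self, h3]
  · exact absurd h h1

/-- The path without steps upwards. -/
def base (n : ℕ) : HeightPath n := ⟨fun _ => 0, rfl, by simp, by simp⟩

theorem base_le (x : HeightPath n) : base n ≤ x := fun _ => Nat.zero_le _

/-- The area under a path. -/
def area (x : HeightPath n) : ℕ := ∑ k ∈ Finset.range (n + 1), x k

theorem area_base : area (base n) = 0 := Finset.sum_eq_zero fun _ _ => rfl

theorem area_toggle {j : ℕ} (hj : j < n) {x : HeightPath n} (h : x.IsUp j) :
    area (toggle j hj x) = area x + 1 := by
  have hm : j + 1 ∈ Finset.range (n + 1) := by simpa using hj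
  rw [area, area, ← Finset.add_sum_erase _ _ hm, ← Finset.add_sum_erase _ (fun k => x k) hm,
    toggle_val_of_isUp hj h, Finset.sum_congr rfl fun k hk =>
      toggle_of_ne hj x (Finset.ne_of_mem_erase hk)]
  omega

theorem toggle_le_toggle {j : ℕ} (hj : j < n) {x y : HeightPath n} (h : x ≤ y) (hx : x.IsUp j)
    (hy : y.IsUp j) : toggle j hj x ≤ toggle j hj y := by
  intro k
  by_cases hk : k = j + 1
  · subst hk
    rw [toggle_val_of_isUp hj hx, toggle_val_of_isUp hj hy]
    exact Nat.succ_le_succ (h (j + 1))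
  · rw [toggle_of_ne hj _ hk, toggle_of_ne hj _ hk]
    exact h k

/-- Follow y as long as it keeps rising. The gap to x persists, as x rises by at most one per step,
and the run ends in a peak of y; the end of the path counts as a peak if the last step rises. -/
theorem exists_isDown_of_step {x y : HeightPath n} {k : ℕ} (hk : k < n)
    (hlt : x (k + 1) < y (k + 1)) (hs : y (k + 1) = y k + 1) :
    ∃ j, j < n ∧ y.IsDown j ∧ x (j + 1) < y (j + 1) := by
  induction hd : n - k generalizing k with
  | zero => omega
  | succ d ih =>
    by_cases hk' : k + 1 < n
    · rcases y.step hk' with h1 | h1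
      · exact ⟨k, hk, ⟨hs, fun _ => h1⟩, hlt⟩
      · refine ih hk' ?_ h1 (by omega)
        have := x.step hk'
        omega
    · exact ⟨k, hk, ⟨hs, fun h => absurd h hk'⟩, hlt⟩

/-- At the first place where y exceeds x the path y has just made a step up, so it has a peak
further on that still lies strictly above x; lowering y there keeps it above x. -/
theorem exists_isDown {x y : HeightPath n} (h : x < y) :
    ∃ j, ∃ hj : j < n, y.IsDown j ∧ x ≤ toggle j hj y := by
  classical
  have hex : ∃ k, x k < y k := by
    by_contra! hne
    exact h.ne (le_antisymm h.le hne)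
  have hmin := Nat.find_spec hex
  have hlow : ∀ m, m < Nat.find hex → y m ≤ x m := fun m hm => not_lt.1 (Nat.find_min hex hm)
  generalize Nat.find hex = k at hmin hlow
  obtain ⟨j, hj, hd, hlt⟩ : ∃ j, j < n ∧ y.IsDown j ∧ x (j + 1) < y (j + 1) := by
    match k with
    | 0 => rw [y.zero] at hmin; omega
    | k + 1 =>
      have hk : k < n := by
        by_contra hk
        rw [y.out (by omega)] at hmin
        omega
      refine exists_isDown_of_step hk hmin ?_
      have h1 := x.step hk
      have h2 := y.step hk
      have h3 := hlow k (by omega)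
      omega
  refine ⟨j, hj, hd, fun k => ?_⟩
  by_cases hk : k = j + 1
  · subst hk
    have := toggle_val_of_isDown hj hd
    change x (j + 1) ≤ toggle j hj y (j + 1)
    omega
  · rw [toggle_of_ne hj _ hk]
    exact h.le k

theorem toggle_apply {j : ℕ} (hj : j < n) (x : HeightPath n) (k : ℕ) :
    toggle j hj x k = if k = j + 1 then newHeight n x j else x k := rfl

theorem isUp_toggle_iff {i j : ℕ} (hj : j < n) (h : i + 1 < j ∨ j + 1 < i)
    (x : HeightPath n) : (toggle j hj x).IsUp i ↔ x.IsUp i := by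
  simp only [IsUp, toggle_apply]
  rw [if_neg (by omega), if_neg (by omega), if_neg (by omega)]

/-- Three consecutive labels that begin with ∨∧ are ∨∧∧ or ∨∧∨; either way they are not all equal,
so the two swaps permute an orbit of three elements, with x at the bottom or in the middle.
`braid_pred` is the mirror image. -/
theorem braid_succ {j : ℕ} (hj : j + 2 < n) (x : HeightPath n) (hx : x.IsUp j) :
    (¬ x.IsUp (j + 1) ∧ ¬ x.IsDown (j + 1) ∧ (toggle j (by omega) x).IsUp (j + 1) ∧
      ¬ (toggle (j + 1) (by omega) (toggle j (by omega) x)).IsUp j ∧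
       ¬ (toggle (j + 1) (by omega) (toggle j (by omega) x)).IsDown j) ∨
    (x.IsDown (j + 1) ∧ ¬ (toggle j (by omega) x).IsUp (j + 1) ∧
      ¬ (toggle j (by omega) x).IsDown (j + 1) ∧
      ¬ (toggle (j + 1) (by omega) x).IsUp j ∧ ¬ (toggle (j + 1) (by omega) x).IsDown j) := by
  have h3 := x.step hj
  have h4 := x.step (show j + 1 < n by omega)
  simp only [IsUp, IsDown, toggle_apply, newHeight, Nat.add_assoc, Nat.reduceAdd,
    Nat.add_left_cancel_iff, Nat.reduceEqDiff, show j + 1 < n by omega, hj, if_true, if_false,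
    forall_true_left, show ¬ j = j + 1 by omega, show ¬ j = j + 2 by omega] at *
  omega

theorem braid_pred {j : ℕ} (hj : j + 2 < n) (x : HeightPath n) (hx : x.IsUp (j + 1)) :
    (¬ x.IsUp j ∧ ¬ x.IsDown j ∧ (toggle (j + 1) (by omega) x).IsUp j ∧
      ¬ (toggle j (by omega) (toggle (j + 1) (by omega) x)).IsUp (j + 1) ∧
       ¬ (toggle j (by omega) (toggle (j + 1) (by omega) x)).IsDown (j + 1)) ∨
    (x.IsDown j ∧ ¬ (toggle (j + 1) (by omega) x).IsUp j ∧
      ¬ (toggle (j + 1) (by omega) x).IsDown j ∧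
      ¬ (toggle j (by omega) x).IsUp (j + 1) ∧ ¬ (toggle j (by omega) x).IsDown (j + 1)) := by
  have h3 := x.step (show j < n by omega)
  have h4 := x.step (show j + 1 < n by omega)
  simp only [IsUp, IsDown, toggle_apply, newHeight, Nat.add_assoc, Nat.reduceAdd,
    Nat.add_left_cancel_iff, Nat.reduceEqDiff, show j + 1 < n by omega, hj, if_true, if_false,
    forall_true_left, show ¬ j = j + 2 by omega] at *
  omega

/-- The labels at the last two steps run through the chain ∨∨ < ∨∧ < ∧∨ < ∧∧ by flip, swap, flip.
Here x is at ∨∧; in `last_braid` it is at ∨∨ or ∧∨. -/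
theorem braid_last {j : ℕ} (hj : j + 2 = n) (x : HeightPath n) (hx : x.IsUp j) :
    x.IsDown (j + 1) ∧ (toggle j (by omega) x).IsUp (j + 1) ∧
      ¬ (toggle (j + 1) (by omega) x).IsUp j ∧ ¬ (toggle (j + 1) (by omega) x).IsDown j ∧
      ¬ (toggle (j + 1) (by omega) (toggle j (by omega) x)).IsUp j ∧
      ¬ (toggle (j + 1) (by omega) (toggle j (by omega) x)).IsDown j := by
  simp only [IsUp, IsDown, toggle_apply, newHeight, Nat.add_assoc, Nat.reduceAdd,
    Nat.add_left_cancel_iff, Nat.reduceEqDiff, show j + 1 < n by omega, show ¬ j + 2 < n by omega,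
    if_true, if_false, forall_true_left, false_imp_iff, and_true, show ¬ j = j + 1 by omega,
    show ¬ j = j + 2 by omega] at *
  omega

theorem last_braid {j : ℕ} (hj : j + 2 = n) (x : HeightPath n) (hx : x.IsUp (j + 1)) :
    (¬ x.IsUp j ∧ ¬ x.IsDown j ∧ (toggle (j + 1) (by omega) x).IsUp j) ∨
    (x.IsDown j ∧ ¬ (toggle (j + 1) (by omega) x).IsUp j ∧
      ¬ (toggle (j + 1) (by omega) x).IsDown j ∧ (toggle j (by omega) x).IsDown (j + 1) ∧
      ¬ (toggle (j + 1) (by omega) (toggle j (by omega) x)).IsUp j ∧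
      ¬ (toggle (j + 1) (by omega) (toggle j (by omega) x)).IsDown j) := by
  have h3 := x.step (show j < n by omega)
  simp only [IsUp, IsDown, toggle_apply, newHeight, Nat.add_assoc, Nat.reduceAdd,
    Nat.add_left_cancel_iff, Nat.reduceEqDiff, show j + 1 < n by omega, show ¬ j + 2 < n by omega,
    if_true, if_false, forall_true_left, false_imp_iff, and_true, show ¬ j = j + 1 by omega,
    show ¬ j = j + 2 by omega] at *
  omega

/-! ### Diagrams of paths and their parity specialisation -/

/-- The coset diagram of type `C_n` that belongs to a path. -/
def toDiagram (x : HeightPath n) : Diagram n := fun p =>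
  if p.1 = n then .circ else if x (p.1 + 1) = x p.1 + 1 then .up else .down

theorem toDiagram_injective : Function.Injective (toDiagram (n := n)) := by
  intro x y h
  refine ext_val fun k => ?_
  induction k with
  | zero => rw [x.zero, y.zero]
  | succ k ih =>
    by_cases hk : k < n
    · have h1 := congrFun h ⟨k, by omega⟩
      have h2 := x.step hk
      have h3 := y.step hk
      simp only [toDiagram, if_neg hk.ne] at h1
      split_ifs at h1 <;> omega
    · rw [x.out (by omega), y.out (by omega)]

theorem toDiagram_base : toDiagram (base n) = emptyC n := by
  funext p
  simp [toDiagram, emptyC, base, Fin.ext_iff]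

theorem toDiagram_toggle (k : Fin n) (x : HeightPath n) :
    toDiagram (toggle k.1 k.2 x) = actC n k (toDiagram x) := by
  obtain ⟨k, hk⟩ := k
  funext ⟨p, hp⟩
  rw [actC_val]
  have h1 := x.step hk
  simp only [toDiagram, toggle_apply, newHeight]
  by_cases hk' : k + 1 < n
  · have h2 : x (k + 2) = x (k + 1) ∨ x (k + 2) = x (k + 1) + 1 := x.step hk'
    simp only [hk', if_true]
    by_cases e1 : p = k
    · subst e1
      simp only [if_true, hk.ne, hk'.ne, if_false, show ¬ p = p + 1 by omega,
        Nat.add_assoc, Nat.reduceAdd]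
      split_ifs <;> first | rfl | omega
    by_cases e2 : p = k + 1
    · subst e2
      simp only [if_true, hk.ne, hk'.ne, if_false, show ¬ k + 1 + 1 = k + 1 by omega,
        show ¬ k + 1 = k by omega, Nat.add_assoc, Nat.reduceAdd]
      split_ifs <;> first | rfl | omega
    · simp only [e1, e2, if_false, show ¬ p + 1 = k + 1 by omega]
  · simp only [hk', if_false]
    by_cases e1 : p = k
    · subst e1
      simp only [if_true, hk.ne, if_false, show ¬ p = p + 1 by omega]
      rcases h1 with h1 | h1
      · rw [if_pos (by omega), if_neg (by omega)]
        rfl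
      · rw [if_neg (by omega), if_pos (by omega)]
        rfl
    · by_cases e2 : p = k + 1
      · simp only [show p = n by omega, if_true, show ¬ n = k by omega, if_false]
      · simp only [e1, e2, if_false, show ¬ p + 1 = k + 1 by omega]

theorem card_up (x : HeightPath n) :
    (Finset.univ.filter fun p => toDiagram x p = .up).card = x n := by
  have key : ∀ m, m ≤ n →
      ∑ k ∈ Finset.range m, (if x (k + 1) = x k + 1 then 1 else 0) = x m := by
    intro m hm
    induction m with
    | zero => simp [x.zero]
    | succ m ih =>
      rw [Finset.sum_range_succ, ih (by omega)]
      have := x.step (show m < n by omega)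
      split_ifs <;> omega
  rw [Finset.card_filter, Fin.sum_univ_castSucc, ← key n le_rfl, Finset.sum_range]
  simp only [toDiagram, Fin.val_castSucc, Fin.val_last, if_true, reduceCtorEq, if_false, add_zero]
  refine Finset.sum_congr rfl fun k _ => ?_
  rw [if_neg k.2.ne]
  split_ifs <;> simp_all

theorem paritySpec_toDiagram (x : HeightPath n) (p : Fin (n + 1)) : paritySpec (toDiagram x) p =
    if p.1 = n then (if x n % 2 = 0 then .down else .up)
    else if x (p.1 + 1) = x p.1 + 1 then .up else .down := by
  rw [paritySpec, card_up]
  simp only [toDiagram, Nat.even_iff]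
  split_ifs <;> simp_all

theorem paritySpec_toDiagram_injective :
    Function.Injective fun x : HeightPath n => paritySpec (toDiagram x) := by
  intro x y h
  apply toDiagram_injective
  funext p
  have := congrFun h p
  simp only [paritySpec_toDiagram] at this
  simp only [toDiagram]
  split_ifs at this ⊢ <;> simp_all

theorem paritySpec_toDiagram_base : paritySpec (toDiagram (base n)) = emptyD n := by
  funext p
  rw [paritySpec_toDiagram]
  simp [emptyD, base]

/-! ### The action of type D on paths -/

/-- The reflection of the path that corresponds to the generator `k` in type `D_{n+1}`. -/
def Enabled (k : ℕ) (x : HeightPath n) : Prop := k + 1 < n ∨ (x (n - 1) + (k + 1 - n)) % 2 = 1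

instance (k : ℕ) (x : HeightPath n) : Decidable (Enabled k x) := inferInstanceAs (Decidable (_ ∨ _))

/-- The action of the generators in type `D_{n+1}`. -/
def twist (hn : 0 < n) (k : ℕ) (x : HeightPath n) : HeightPath n :=
  if Enabled k x then toggle (min k (n - 1)) (by omega) x else x

theorem twist_of_lt (hn : 0 < n) {k : ℕ} (hk : k + 1 < n) (x : HeightPath n) :
    twist hn k x = toggle k (by omega) x := by
  rw [twist, if_pos (show Enabled k x from Or.inl hk)]
  congr 1
  omega

theorem twist_of_ge (hn : 0 < n) {k : ℕ} (hk : n ≤ k + 1) (x : HeightPath n) :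
    twist hn k x = if (x (n - 1) + (k + 1 - n)) % 2 = 1 then toggle (n - 1) (by omega) x else x := by
  have : min k (n - 1) = n - 1 := by omega
  simp only [twist, Enabled, this, show ¬ k + 1 < n by omega, false_or]

/-- This is where the parity in `Enabled` comes from. The total number of ∧ is even, so the two
leftmost labels differ exactly if `x (n - 1)` is odd. A swap moves them only if they differ, a swap
with flip only if they agree, and in both cases the label at n - 1 is flipped, which is a reflection
of the last step of the path. -/
theorem paritySpec_toDiagram_twist (hn : 0 < n) (k : Fin (n + 1)) (x : HeightPath n) :
    paritySpec (toDiagram (twist hn k x)) = actD n k (paritySpec (toDiagram x)) := by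
  obtain ⟨k, hk⟩ := k
  funext ⟨p, hp⟩
  rw [actD_val]
  by_cases hk' : k + 1 < n
  · have h1 := x.step (show k < n by omega)
    have h2 : x (k + 2) = x (k + 1) ∨ x (k + 2) = x (k + 1) + 1 := x.step hk'
    rw [twist_of_lt hn hk']
    simp only [paritySpec_toDiagram, toggle_apply, newHeight, hk', if_true,
      show k < n by omega, dite_true, show ¬ k + 1 = n by omega, show ¬ k = n by omega, if_false,
      show ¬ n = k + 1 by omega]
    by_cases e1 : p = k
    · subst e1
      simp only [if_true, show ¬ p = n by omega, if_false, show ¬ p = p + 1 by omega,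
        Nat.add_assoc, Nat.reduceAdd]
      split_ifs <;> first | rfl | omega
    by_cases e2 : p = k + 1
    · subst e2
      simp only [if_true, show ¬ k + 1 = n by omega, if_false, show ¬ k + 1 + 1 = k + 1 by omega,
        show ¬ k + 1 = k by omega, Nat.add_assoc, Nat.reduceAdd]
      split_ifs <;> first | rfl | omega
    · simp only [e1, e2, if_false, show ¬ p + 1 = k + 1 by omega]
  · obtain ⟨m, rfl⟩ : ∃ m, n = m + 1 := ⟨n - 1, by omega⟩
    have h1 := x.step (show m < m + 1 by omega)
    have hv : ∀ q, twist hn k x q = if q = m + 1 ∧ (x m + (k - m)) % 2 = 1 then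
        2 * x m + 1 - x (m + 1) else x q := by
      intro q
      rw [twist_of_ge hn (by omega)]
      simp only [Nat.add_sub_cancel, Nat.add_sub_add_right]
      by_cases hc : (x m + (k - m)) % 2 = 1
      · simp [hc, toggle_apply, newHeight]
      · simp [hc]
    simp only [paritySpec_toDiagram, hv, Nat.add_sub_cancel, Fin.val_last, if_true,
      show ¬ m = m + 1 by omega, if_false, Nat.add_right_cancel_iff, true_and]
    obtain rfl | rfl : k = m ∨ k = m + 1 := by omega
    · simp only [Nat.lt_succ_self, dite_true, Nat.sub_self, Nat.add_zero]
      by_cases e1 : p = k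
      · subst e1
        simp only [if_true, show ¬ p = p + 1 by omega, if_false, true_and, false_and]
        split_ifs <;> first | rfl | omega
      by_cases e2 : p = k + 1
      · subst e2
        simp only [if_true, show ¬ k + 1 = k by omega, if_false]
        split_ifs <;> first | rfl | omega
      · simp only [e1, e2, if_false, false_and]
    · simp only [lt_irrefl, dite_false, Nat.add_sub_cancel_left]
      by_cases e1 : p = m
      · subst e1
        simp only [if_true, show ¬ p = p + 1 by omega, if_false, true_and, false_and]
        split_ifs <;> first | rfl | omega
      by_cases e2 : p = m + 1
      · subst e2
        simp only [if_true, show ¬ m + 1 = m by omega, if_false]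
        split_ifs <;> first | rfl | omega
      · simp only [e1, e2, if_false, false_and]

theorem lt_twist_iff (hn : 0 < n) (k : ℕ) (x : HeightPath n) :
    x < twist hn k x ↔ Enabled k x ∧ x.IsUp (min k (n - 1)) := by
  unfold twist
  split_ifs with h
  · simp [h, lt_toggle_iff]
  · simp [h]

theorem twist_lt_iff (hn : 0 < n) (k : ℕ) (x : HeightPath n) :
    twist hn k x < x ↔ Enabled k x ∧ x.IsDown (min k (n - 1)) := by
  unfold twist
  split_ifs with h
  · simp [h, toggle_lt_iff]
  · simp [h]

theorem twist_eq_iff (hn : 0 < n) (k : ℕ) (x : HeightPath n) :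
    twist hn k x = x ↔ (Enabled k x → ¬ x.IsUp (min k (n - 1)) ∧ ¬ x.IsDown (min k (n - 1))) := by
  unfold twist
  split_ifs with h
  · simp [h, toggle_eq_iff]
  · simp [h]

/-- For the two end nodes the condition only reads the height at n - 1, and among the reflections
only `toggle (n - 2)` changes that height. -/
theorem enabled_toggle_iff {j : ℕ} (hj : j < n) {k : ℕ} (h : k + 1 < n ∨ j + 2 ≠ n)
    (x : HeightPath n) : Enabled k (toggle j hj x) ↔ Enabled k x := by
  unfold Enabled
  rcases h with h | h
  · simp [h]
  · rw [toggle_of_ne hj x (by omega)]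

theorem twist_twist (hn : 0 < n) (k : ℕ) (x : HeightPath n) : twist hn k (twist hn k x) = x := by
  by_cases h : Enabled k x
  · have e : twist hn k x = toggle (min k (n - 1)) (by omega) x := if_pos h
    have h' : Enabled k (twist hn k x) := by
      rwa [e, enabled_toggle_iff]
      omega
    rw [twist, if_pos h', e, toggle_toggle]
  · have e : twist hn k x = x := if_neg h
    rw [e, e]

end HeightPath

end ParabolicKL

/-! ### The models of types C and D, and their folding -/

namespace ParabolicKL

/-- Coxeter relations can be checked after an equivariant embedding. -/
theorem isLiftable_of_injective {B X Y : Type} {M : CoxeterMatrix B} {f : B → Equiv.Perm X}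
    {g : B → Equiv.Perm Y} (hg : M.IsLiftable g) {ι : X → Y} (hι : Function.Injective ι)
    (h : ∀ i x, ι (f i x) = g i (ι x)) : M.IsLiftable f := by
  intro i j
  have key : ∀ (m : ℕ) x, ι (((f i * f j) ^ m) x) = ((g i * g j) ^ m) (ι x) := by
    intro m
    induction m with
    | zero => simp
    | succ m ih =>
      intro x
      rw [pow_succ, pow_succ, Equiv.Perm.mul_apply, Equiv.Perm.mul_apply, ih,
        Equiv.Perm.mul_apply, Equiv.Perm.mul_apply, h, h]
  ext x
  apply hι
  rw [key, hg i j]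
  rfl

/-- The coset of `w` is determined by the image of the base point under `w⁻¹`. -/
theorem CosetModel.lift_apply_eq {B : Type} {M : CoxeterMatrix B} {J : Set B} {X Y : Type}
    [PartialOrder X] (𝓜 : CosetModel M J X) {g : B → Equiv.Perm Y} (hg : M.IsLiftable g)
    {ι : X → Y} (h : ∀ i x, ι (𝓜.act i x) = g i (ι x)) (w : M.Group) :
    M.toCoxeterSystem.lift ⟨g, hg⟩ w⁻¹ (ι 𝓜.base) = ι (𝓜.diag w) := by
  have key : ∀ w : M.Group, ∀ x, M.toCoxeterSystem.lift ⟨g, hg⟩ w (ι x) =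
      ι (M.toCoxeterSystem.lift ⟨𝓜.act, 𝓜.liftable⟩ w x) := by
    intro w
    induction w using M.toCoxeterSystem.simple_induction_left with
    | one => simp
    | mul_simple_left w i ih =>
      intro x
      rw [map_mul, map_mul, Equiv.Perm.mul_apply, Equiv.Perm.mul_apply, ih,
        M.toCoxeterSystem.lift_apply_simple, M.toCoxeterSystem.lift_apply_simple, h]
  rw [key]
  rfl

theorem typeB_apply (n : ℕ) (hn : 2 ≤ n) (i j : Fin n) : CoxeterMatrix.B n i j =
    if i.1 = j.1 then 1
    else if i.1 + 1 = n ∧ j.1 + 2 = n ∨ j.1 + 1 = n ∧ i.1 + 2 = n then 4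
    else if j.1 + 1 = i.1 ∨ i.1 + 1 = j.1 then 3 else 2 := by
  change (if i = j then 1 else if i.1 = n - 1 ∧ j.1 = n - 2 ∨ j.1 = n - 1 ∧ i.1 = n - 2 then 4
    else if j.1 + 1 = i.1 ∨ i.1 + 1 = j.1 then 3 else 2) = _
  simp only [Fin.ext_iff]
  congr 2
  simp only [eq_iff_iff]
  omega

theorem typeD_apply (n : ℕ) (i j : Fin (n + 1)) : typeD (n + 1) i j =
    if i.1 = j.1 then 1
    else if (i.1 + 1 = j.1 ∧ j.1 ≠ n) ∨ (j.1 + 1 = i.1 ∧ i.1 ≠ n) ∨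
      (i.1 + 2 = j.1 ∧ j.1 = n) ∨ (j.1 + 2 = i.1 ∧ i.1 = n) then 3
    else 2 := by
  simp [typeD, Fin.ext_iff]

open HeightPath

/-- The generators of type `C_n` as permutations of the paths. -/
def permC {n : ℕ} (i : Fin n) : Equiv.Perm (HeightPath n) :=
  (show Function.Involutive (toggle i.1 i.2) from toggle_toggle i.2).toPerm

/-- The generators of type `D_{n+1}` as permutations of the paths. -/
def permD {n : ℕ} (hn : 0 < n) (i : Fin (n + 1)) : Equiv.Perm (HeightPath n) :=
  (show Function.Involutive (twist hn i.1) from twist_twist hn i.1).toPerm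

/-- The model of type `(C_n, A_{n-1})`. -/
def modelC (n : ℕ) (hn : 2 ≤ n) :
    CosetModel (CoxeterMatrix.B n) {k : Fin n | (k : ℕ) + 1 ≠ n} (HeightPath n) where
  act := permC
  base := base n
  rank := area
  liftable := isLiftable_of_injective (isLiftable_actC n) toDiagram_injective toDiagram_toggle
  base_le := base_le
  rank_base := area_base
  act_base i := by
    change toggle i.1 i.2 (base n) = base n ↔ i.1 + 1 ≠ n
    have := i.2
    simp [toggle_eq_iff, IsUp, IsDown, base]
    omega
  comparable i x := by
    change x < toggle i.1 i.2 x ∨ toggle i.1 i.2 x < x ∨ toggle i.1 i.2 x = x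
    rw [lt_toggle_iff, toggle_lt_iff, toggle_eq_iff]
    tauto
  rank_act i x h := area_toggle i.2 ((lt_toggle_iff i.2 x).1 h)
  act_le_act i x y h hx hy :=
    toggle_le_toggle i.2 h ((lt_toggle_iff i.2 x).1 hx) ((lt_toggle_iff i.2 y).1 hy)
  exists_descent x y h := by
    obtain ⟨j, hj, h1, h2⟩ := exists_isDown h
    exact ⟨⟨j, hj⟩, (toggle_lt_iff hj y).2 h1, h2⟩
  order i j hij := by
    rw [typeB_apply n hn, if_neg (Fin.val_ne_of_ne hij)]
    split_ifs <;> simp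
  comm i j x h _ := by
    change toggle j.1 j.2 x < toggle i.1 i.2 (toggle j.1 j.2 x) ↔ x < toggle i.1 i.2 x
    rw [lt_toggle_iff, lt_toggle_iff]
    apply isUp_toggle_iff
    rw [typeB_apply n hn] at h
    split_ifs at h <;> omega
  braid₃ i j x h hx := by
    obtain ⟨i, hi⟩ := i
    obtain ⟨j, hj⟩ := j
    have hx' := (lt_toggle_iff hi x).1 hx
    change (toggle j hj x = x ∧ toggle i hi x < toggle j hj (toggle i hi x) ∧
      toggle i hi (toggle j hj (toggle i hi x)) = toggle j hj (toggle i hi x)) ∨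
      (toggle j hj x < x ∧ toggle j hj (toggle i hi x) = toggle i hi x ∧
        toggle i hi (toggle j hj x) = toggle j hj x)
    simp only [lt_toggle_iff, toggle_lt_iff, toggle_eq_iff]
    rw [typeB_apply n hn] at h
    dsimp only at h
    obtain ⟨rfl, hlt⟩ | ⟨rfl, hlt⟩ : (j = i + 1 ∧ i + 2 < n) ∨ (i = j + 1 ∧ j + 2 < n) := by
      split_ifs at h <;> omega
    · have := braid_succ hlt x hx'
      tauto
    · have := braid_pred hlt x hx'
      tauto
  braid₄ i j x h hx := by
    obtain ⟨i, hi⟩ := i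
    obtain ⟨j, hj⟩ := j
    have hx' := (lt_toggle_iff hi x).1 hx
    change toggle i hi x < toggle j hj (toggle i hi x) ∨ (toggle j hj (toggle i hi x) =
      toggle i hi x ∧ toggle j hj x < x ∧ toggle i hi (toggle j hj x) < toggle j hj x ∧
      toggle j hj (toggle i hi (toggle j hj x)) = toggle i hi (toggle j hj x))
    simp only [lt_toggle_iff, toggle_lt_iff, toggle_eq_iff]
    rw [typeB_apply n hn] at h
    dsimp only at h
    obtain ⟨rfl, hlt⟩ | ⟨rfl, hlt⟩ : (j = i + 1 ∧ i + 2 = n) ∨ (i = j + 1 ∧ j + 2 = n) := by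
      split_ifs at h <;> omega
    · exact Or.inl (braid_last hlt x hx').2.1
    · have := last_braid hlt x hx'
      tauto

/-- For the last step the parity of `x (n - 1)` selects one of the two end nodes n - 1 and n. -/
theorem exists_enabled {n j : ℕ} (hj : j < n) (x : HeightPath n) :
    ∃ k, k < n + 1 ∧ min k (n - 1) = j ∧ Enabled k x := by
  by_cases hj' : j + 1 < n
  · exact ⟨j, by omega, by omega, Or.inl hj'⟩
  · by_cases hp : x (n - 1) % 2 = 1
    · exact ⟨n - 1, by omega, by omega, Or.inr (by omega)⟩
    · exact ⟨n, by omega, by omega, Or.inr (by omega)⟩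

theorem enabled_add_two_iff {m k : ℕ} (hk : m + 2 ≤ k + 1) (x : HeightPath (m + 2)) :
    Enabled k x ↔ (x (m + 1) + (k + 1 - (m + 2))) % 2 = 1 := by
  simp [Enabled, show ¬ k + 1 < m + 2 by omega]

theorem twist_eq_toggle {m k : ℕ} (hn : 0 < m + 2) (hk : m + 2 ≤ k + 1) {x : HeightPath (m + 2)}
    (h : Enabled k x) : twist hn k x = toggle (m + 1) (by omega) x := by
  rw [twist, if_pos h]
  congr 1
  omega

/-- Reflection at m changes the height at m + 1 by one and so exchanges the two end nodes that are
enabled. The chain of four elements of type C thereby loses one of its end edges for a given k, and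
an orbit of three elements is left. -/
theorem twist_braid_last {m k : ℕ} (hn : 0 < m + 2) (hk : m + 2 ≤ k + 1) {x : HeightPath (m + 2)}
    (hx : x.IsUp m) :
    (twist hn k x = x ∧ twist hn m x < twist hn k (twist hn m x) ∧
      twist hn m (twist hn k (twist hn m x)) = twist hn k (twist hn m x)) ∨
    (twist hn k x < x ∧ twist hn k (twist hn m x) = twist hn m x ∧
      twist hn m (twist hn k x) = twist hn k x) := by
  obtain ⟨h1, h2, h3, h4, h5, h6⟩ := braid_last rfl x hx
  have em : ∀ y : HeightPath (m + 2), twist hn m y = toggle m (by omega) y :=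
    twist_of_lt hn (by omega)
  have hv := toggle_val_of_isUp (show m < m + 2 by omega) hx
  have hmin : min k (m + 2 - 1) = m + 1 := by omega
  by_cases hE : Enabled k x
  · have hE' : ¬ Enabled k (toggle m (by omega) x) := by
      rw [enabled_add_two_iff hk] at *
      omega
    refine Or.inr ⟨(twist_lt_iff _ _ _).2 ⟨hE, by rwa [hmin]⟩, ?_, ?_⟩
    · rw [em, twist_eq_iff]
      exact fun h => absurd h hE'
    · rw [em, twist_eq_toggle hn hk hE, toggle_eq_iff]
      exact ⟨h3, h4⟩
  · have hE' : Enabled k (toggle m (by omega) x) := by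
      rw [enabled_add_two_iff hk] at *
      omega
    refine Or.inl ⟨(twist_eq_iff _ _ _).2 fun h => absurd h hE, ?_, ?_⟩
    · rw [em, lt_twist_iff, hmin]
      exact ⟨hE', h2⟩
    · rw [em, em, twist_eq_toggle hn hk hE', toggle_eq_iff]
      exact ⟨h5, h6⟩

/-- The remaining positions of x in that orbit: k is enabled at x, hence disabled after a reflection
at m. -/
theorem twist_last_braid {m k : ℕ} (hn : 0 < m + 2) (hk : m + 2 ≤ k + 1) {x : HeightPath (m + 2)}
    (hE : Enabled k x) (hx : x.IsUp (m + 1)) :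
    (twist hn m x = x ∧ twist hn k x < twist hn m (twist hn k x) ∧
      twist hn k (twist hn m (twist hn k x)) = twist hn m (twist hn k x)) ∨
    (twist hn m x < x ∧ twist hn m (twist hn k x) = twist hn k x ∧
      twist hn k (twist hn m x) = twist hn m x) := by
  have em : ∀ y : HeightPath (m + 2), twist hn m y = toggle m (by omega) y :=
    twist_of_lt hn (by omega)
  simp only [em, twist_eq_toggle hn hk hE, lt_toggle_iff, toggle_lt_iff, toggle_eq_iff,
    twist_eq_iff]
  have hv : (toggle (m + 1) (by omega) x) (m + 1) = x (m + 1) := toggle_of_ne _ _ (by omega)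
  rcases last_braid rfl x hx with ⟨h1, h2, h3⟩ | ⟨h1, h2, h3, h4, h5, h6⟩
  · have := toggle_val_of_isUp (show m < m + 2 by omega) h3
    refine Or.inl ⟨⟨h1, h2⟩, h3, fun h => ?_⟩
    rw [enabled_add_two_iff hk] at *
    omega
  · have := toggle_val_of_isDown (show m < m + 2 by omega) h1
    refine Or.inr ⟨h1, ⟨h2, h3⟩, fun h => ?_⟩
    rw [enabled_add_two_iff hk] at *
    omega

/-- The model of type `(D_{n+1}, A_n)`. -/
def modelD (n : ℕ) (hn : 0 < n) :
    CosetModel (typeD (n + 1)) {k : Fin (n + 1) | k ≠ Fin.last n} (HeightPath n) where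
  act := permD hn
  base := base n
  rank := area
  liftable := isLiftable_of_injective (isLiftable_actD n) paritySpec_toDiagram_injective
    (paritySpec_toDiagram_twist hn)
  base_le := base_le
  rank_base := area_base
  act_base i := by
    change twist hn i.1 (base n) = base n ↔ i ≠ Fin.last n
    have := i.2
    simp [twist_eq_iff, IsUp, IsDown, Enabled, base, Fin.ext_iff]
    omega
  comparable i x := by
    change x < twist hn i.1 x ∨ twist hn i.1 x < x ∨ twist hn i.1 x = x
    rw [lt_twist_iff, twist_lt_iff, twist_eq_iff]
    tauto
  rank_act i x h := by
    have h' := (lt_twist_iff hn i.1 x).1 h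
    change area (twist hn i.1 x) = _
    rw [twist, if_pos h'.1, area_toggle _ h'.2]
  act_le_act i x y h hx hy := by
    have hx' := (lt_twist_iff hn i.1 x).1 hx
    have hy' := (lt_twist_iff hn i.1 y).1 hy
    change twist hn i.1 x ≤ twist hn i.1 y
    rw [twist, twist, if_pos hx'.1, if_pos hy'.1]
    exact toggle_le_toggle _ h hx'.2 hy'.2
  exists_descent x y h := by
    obtain ⟨j, hj, h1, h2⟩ := exists_isDown h
    obtain ⟨k, hk, rfl, he⟩ := exists_enabled hj y
    refine ⟨⟨k, hk⟩, (twist_lt_iff hn k y).2 ⟨he, h1⟩, ?_⟩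
    change x ≤ twist hn k y
    rwa [twist, if_pos he]
  order i j hij := by
    rw [typeD_apply, if_neg (Fin.val_ne_of_ne hij)]
    split_ifs <;> simp
  comm i j x h hx := by
    obtain ⟨i, hi⟩ := i
    obtain ⟨j, hj⟩ := j
    have hx' := (lt_twist_iff hn j x).1 hx
    change twist hn j x < twist hn i (twist hn j x) ↔ x < twist hn i x
    rw [lt_twist_iff, lt_twist_iff]
    have e : twist hn j x = toggle (min j (n - 1)) (by omega) x := if_pos hx'.1
    rw [typeD_apply] at h
    dsimp only at h
    -- Commuting nodes either reflect the path at distant places or are the two end nodes, which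
    -- reflect the same step but are never enabled together.
    have hcase : (i + 1 < n ∨ j + 2 < n) ∧ (min i (n - 1) + 1 < min j (n - 1) ∨
        min j (n - 1) + 1 < min i (n - 1)) ∨ (n ≤ i + 1 ∧ n ≤ j + 1 ∧ i ≠ j) := by
      split_ifs at h <;> omega
    rcases hcase with ⟨h1, h2⟩ | ⟨h1, h2, h3⟩
    · rw [e, isUp_toggle_iff _ h2, enabled_toggle_iff _ (by omega)]
    · have hd : Enabled j x := hx'.1
      have h4 : ¬ Enabled i x := by
        unfold Enabled at *
        omega
      rw [e, enabled_toggle_iff _ (by omega)]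
      simp [h4]
  braid₃ i j x h hx := by
    obtain ⟨i, hi⟩ := i
    obtain ⟨j, hj⟩ := j
    have hx' := (lt_twist_iff hn i x).1 hx
    change (twist hn j x = x ∧ twist hn i x < twist hn j (twist hn i x) ∧
      twist hn i (twist hn j (twist hn i x)) = twist hn j (twist hn i x)) ∨
      (twist hn j x < x ∧ twist hn j (twist hn i x) = twist hn i x ∧
        twist hn i (twist hn j x) = twist hn j x)
    rw [typeD_apply] at h
    dsimp only at h
    have hcase : (j = i + 1 ∧ i + 2 < n) ∨ (i = j + 1 ∧ j + 2 < n) ∨ (i + 2 = n ∧ n ≤ j + 1) ∨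
        (j + 2 = n ∧ n ≤ i + 1) := by
      split_ifs at h <;> omega
    clear h
    rcases hcase with ⟨rfl, hlt⟩ | ⟨rfl, hlt⟩ | ⟨rfl, hle⟩ | ⟨rfl, hle⟩
    · simp only [twist_of_lt hn (show i + 1 < n by omega),
        twist_of_lt hn (show i + 1 + 1 < n by omega), lt_toggle_iff, toggle_lt_iff, toggle_eq_iff]
      have := braid_succ hlt x (by rw [Nat.min_eq_left (by omega)] at hx'; exact hx'.2)
      tauto
    · simp only [twist_of_lt hn (show j + 1 < n by omega),
        twist_of_lt hn (show j + 1 + 1 < n by omega), lt_toggle_iff, toggle_lt_iff, toggle_eq_iff]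
      have := braid_pred hlt x (by rw [Nat.min_eq_left (by omega)] at hx'; exact hx'.2)
      tauto
    · exact twist_braid_last hn hle (by rw [Nat.min_eq_left (by omega)] at hx'; exact hx'.2)
    · exact twist_last_braid hn hle hx'.1
        (by rw [Nat.min_eq_right (by omega)] at hx'; exact hx'.2)
  braid₄ i j x h hx := by
    rw [typeD_apply] at h
    split_ifs at h <;> omega

/-- The end nodes n - 1 and n of the graph of D_{n+1} lie over the node n - 1 of C_n, and exactly
one of them is enabled at any given path. -/
theorem isFolding_CD (n : ℕ) (hn : 2 ≤ n) :
    IsFolding (modelC n hn) (modelD n (by omega))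
      (fun k : Fin (n + 1) => ⟨min k.1 (n - 1), by omega⟩) where
  act_eq k x h := by
    have hn' : 0 < n := by omega
    change toggle (min k.1 (n - 1)) (by omega) x = twist hn' k.1 x
    change twist hn' k.1 x ≠ x at h
    by_cases hE : Enabled k.1 x
    · rw [twist, if_pos hE]
    · exact absurd (if_neg hE) h
  exists_act i x h := by
    obtain ⟨i, hi⟩ := i
    obtain ⟨k, hk, rfl, hE⟩ := exists_enabled hi x
    refine ⟨⟨k, hk⟩, rfl, fun h' => h ?_⟩
    change twist (show 0 < n by omega) k x = x at h'
    rwa [twist, if_pos hE] at h'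
  eq_of_act k l x h hk hl := by
    have hk' : Enabled k.1 x := by
      by_contra hE
      exact hk (if_neg hE)
    have hl' : Enabled l.1 x := by
      by_contra hE
      exact hl (if_neg hE)
    have h' := congrArg Fin.val h
    dsimp only at h'
    unfold Enabled at hk' hl'
    omega

theorem diagramC_eq (n : ℕ) (hn : 2 ≤ n) (w : (CoxeterMatrix.B n).Group) :
    diagramC n w = toDiagram ((modelC n hn).diag w) := by
  rw [diagramC, ← toDiagram_base]
  exact (modelC n hn).lift_apply_eq (isLiftable_actC n) toDiagram_toggle w

theorem diagramD_eq (n : ℕ) (hn : 0 < n) (w : (typeD (n + 1)).Group) :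
    diagramD n w = paritySpec (toDiagram ((modelD n hn).diag w)) := by
  rw [diagramD, ← paritySpec_toDiagram_base]
  exact (modelD n hn).lift_apply_eq (isLiftable_actD n) (ι := fun x => paritySpec (toDiagram x))
    (paritySpec_toDiagram_twist hn) w

theorem klMatrix_CD (n : ℕ) (hn : 2 ≤ n) :
    ∃ φ : CosetC n ≃ CosetD n,
      (∀ (lam : CosetC n) (ν : CosetD n),
        diagramD n ν.1 = paritySpec (diagramC n lam.1) ↔ ν = φ lam) ∧
      ∀ (t : ∀ μ : CosetC n, ReducedPath μ) (t' : ∀ μ : CosetD n, ReducedPath μ)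
        (lam μ : CosetC n), klMatrix t lam μ = klMatrix t' (φ lam) (φ μ) := by
  have hn' : 0 < n := by omega
  refine ⟨(modelC n hn).equiv.trans (modelD n hn').equiv.symm, fun lam ν => ?_,
    fun t t' lam μ => ?_⟩
  · rw [diagramC_eq n hn, diagramD_eq n hn', paritySpec_toDiagram_injective.eq_iff,
      Equiv.trans_apply, Equiv.eq_symm_apply]
    rfl
  · have := (isFolding_CD n hn).klMatrix_eq (fun i j _ => by
      rw [typeD_apply]
      split_ifs <;> omega) t t' ((modelC n hn).equiv lam) ((modelC n hn).equiv μ)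
    rwa [Equiv.symm_apply_apply, Equiv.symm_apply_apply] at this

end ParabolicKL

/-! ### Quotients that are chains -/

namespace ParabolicKL

/-- The neighbour of `x` in the chain `0, …, N - 1` along an edge with label `i`; the edge between
`k` and `k + 1` has the label `lab k`. -/
def chainStep {N : ℕ} (lab : ℕ → ℕ) (i : ℕ) (x : Fin N) : Fin N :=
  if h : x.1 + 1 < N ∧ lab x.1 = i then ⟨x.1 + 1, h.1⟩
  else if 0 < x.1 ∧ lab (x.1 - 1) = i then ⟨x.1 - 1, by omega⟩ else x

theorem chainStep_val {N : ℕ} (lab : ℕ → ℕ) (i : ℕ) (x : Fin N) : (chainStep lab i x).1 =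
    if x.1 + 1 < N ∧ lab x.1 = i then x.1 + 1
    else if 0 < x.1 ∧ lab (x.1 - 1) = i then x.1 - 1 else x.1 := by
  unfold chainStep
  split_ifs <;> rfl

/-- Adjacent edges of the chain have different labels. -/
def IsChainLabelling (N : ℕ) (lab : ℕ → ℕ) : Prop := ∀ k, k + 2 < N → lab k ≠ lab (k + 1)

namespace IsChainLabelling

variable {N : ℕ} {lab : ℕ → ℕ}

theorem ne_pred (h : IsChainLabelling N lab) {k : ℕ} (hk : 0 < k) (hk' : k + 1 < N) :
    lab (k - 1) ≠ lab k := by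
  have := h (k - 1) (by omega)
  rwa [Nat.sub_add_cancel hk] at this

theorem step_cases (h : IsChainLabelling N lab) (i : ℕ) (x : Fin N) :
    ((x.1 + 1 < N ∧ lab x.1 = i) ∧ ¬ (0 < x.1 ∧ lab (x.1 - 1) = i) ∧
      (chainStep lab i x).1 = x.1 + 1) ∨
    (¬ (x.1 + 1 < N ∧ lab x.1 = i) ∧ (0 < x.1 ∧ lab (x.1 - 1) = i) ∧
      (chainStep lab i x).1 + 1 = x.1) ∨
    (¬ (x.1 + 1 < N ∧ lab x.1 = i) ∧ ¬ (0 < x.1 ∧ lab (x.1 - 1) = i) ∧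
      (chainStep lab i x).1 = x.1) := by
  rw [chainStep_val]
  by_cases h1 : x.1 + 1 < N ∧ lab x.1 = i
  · refine Or.inl ⟨h1, fun h2 => h.ne_pred h2.1 h1.1 (h2.2.trans h1.2.symm), if_pos h1⟩
  · by_cases h2 : 0 < x.1 ∧ lab (x.1 - 1) = i
    · rw [if_neg h1, if_pos h2]
      exact Or.inr (Or.inl ⟨h1, h2, by omega⟩)
    · rw [if_neg h1, if_neg h2]
      exact Or.inr (Or.inr ⟨h1, h2, rfl⟩)

theorem lt_step_iff (h : IsChainLabelling N lab) (i : ℕ) (x : Fin N) :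
    x < chainStep lab i x ↔ x.1 + 1 < N ∧ lab x.1 = i := by
  rw [Fin.lt_def]
  have := h.step_cases i x
  by_cases h1 : x.1 + 1 < N ∧ lab x.1 = i
  · simp only [h1, and_self, iff_true]
    omega
  · simp only [h1, iff_false]
    omega

theorem step_lt_iff (h : IsChainLabelling N lab) (i : ℕ) (x : Fin N) :
    chainStep lab i x < x ↔ 0 < x.1 ∧ lab (x.1 - 1) = i := by
  rw [Fin.lt_def]
  have := h.step_cases i x
  by_cases h1 : 0 < x.1 ∧ lab (x.1 - 1) = i
  · simp only [h1, and_self, iff_true]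
    omega
  · simp only [h1, iff_false]
    omega

theorem step_eq_iff (h : IsChainLabelling N lab) (i : ℕ) (x : Fin N) :
    chainStep lab i x = x ↔
      ¬ (x.1 + 1 < N ∧ lab x.1 = i) ∧ ¬ (0 < x.1 ∧ lab (x.1 - 1) = i) := by
  rw [Fin.ext_iff]
  have := h.step_cases i x
  by_cases h1 : 0 < x.1 ∧ lab (x.1 - 1) = i <;> by_cases h2 : x.1 + 1 < N ∧ lab x.1 = i <;>
    simp only [h1, h2, not_true, not_false_eq_true, and_true, and_false, iff_true, iff_false] <;>
    omega

theorem step_up (h : IsChainLabelling N lab) {i : ℕ} {x : Fin N} (hx : x < chainStep lab i x) :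
    (chainStep lab i x).1 = x.1 + 1 := by
  have := (h.lt_step_iff i x).1 hx
  rw [chainStep_val, if_pos this]

theorem step_down (h : IsChainLabelling N lab) {i : ℕ} {x : Fin N} (hx : chainStep lab i x < x) :
    (chainStep lab i x).1 = x.1 - 1 := by
  have h1 := h.step_cases i x
  rw [Fin.lt_def] at hx
  omega

theorem step_step (h : IsChainLabelling N lab) (i : ℕ) (x : Fin N) :
    chainStep lab i (chainStep lab i x) = x := by
  rcases h.step_cases i x with ⟨h1, h2, h3⟩ | ⟨h1, h2, h3⟩ | ⟨h1, h2, h3⟩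
  · have h4 : chainStep lab i (chainStep lab i x) < chainStep lab i x := by
      rw [h.step_lt_iff, h3, Nat.add_sub_cancel]
      exact ⟨by omega, h1.2⟩
    rw [Fin.ext_iff, h.step_down h4, h3, Nat.add_sub_cancel]
  · have h4 : chainStep lab i x < chainStep lab i (chainStep lab i x) := by
      rw [h.lt_step_iff, h3, show (chainStep lab i x).1 = x.1 - 1 by omega]
      exact ⟨x.2, h2.2⟩
    rw [Fin.ext_iff, h.step_up h4, h3]
  · have h4 : chainStep lab i x = x := Fin.ext h3
    rw [h4, h4]

/-- The generators as permutations of the chain. -/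
def perm (h : IsChainLabelling N lab) (i : ℕ) : Equiv.Perm (Fin N) :=
  (show Function.Involutive (chainStep lab i) from h.step_step i).toPerm

theorem perm_apply (h : IsChainLabelling N lab) (i : ℕ) (x : Fin N) :
    h.perm i x = chainStep lab i x := rfl

/-- The model of a quotient `^P W` that is a chain. -/
def model (h : IsChainLabelling N lab) {m : ℕ} (M : CoxeterMatrix (Fin m)) (J : Set (Fin m))
    (hN : 0 < N) (hlab : ∀ k, k + 1 < N → lab k < m)
    (liftable : M.IsLiftable fun i => h.perm i.1)
    (hJ : ∀ i, i ∈ J ↔ ¬ (1 < N ∧ lab 0 = i.1))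
    (order : ∀ i j, i ≠ j → M i j = 2 ∨ M i j = 3 ∨ M i j = 4)
    (comm : ∀ i j, M i j = 2 → ∀ k, k + 2 < N → lab k = i.1 → lab (k + 1) ≠ j.1)
    -- An edge with label i has a neighbour with label j on one side only, and beyond that neighbour
    -- there is no further i: the two edges form an orbit of three points.
    (braid₃ : ∀ i j, M i j = 3 → ∀ k, k + 1 < N → lab k = i.1 →
      ((k + 2 < N ∧ lab (k + 1) = j.1) ∧ (0 < k → lab (k - 1) ≠ j.1) ∧
        (k + 3 < N → lab (k + 2) ≠ i.1)) ∨
      ((0 < k ∧ lab (k - 1) = j.1) ∧ (k + 2 < N → lab (k + 1) ≠ j.1) ∧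
        (1 < k → lab (k - 2) ≠ i.1)))
    (braid₄ : ∀ i j, M i j = 4 → ∀ k, k + 1 < N → lab k = i.1 →
      (k + 2 < N ∧ lab (k + 1) = j.1) ∨
      ((k + 2 < N → lab (k + 1) ≠ j.1) ∧ 1 < k ∧ lab (k - 1) = j.1 ∧ lab (k - 2) = i.1 ∧
        (2 < k → lab (k - 3) ≠ j.1))) :
    CosetModel M J (Fin N) where
  act i := h.perm i.1
  base := ⟨0, hN⟩
  rank x := x.1
  liftable := liftable
  base_le x := Nat.zero_le _
  rank_base := rfl
  act_base i := by
    rw [hJ]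
    change chainStep lab i.1 ⟨0, hN⟩ = _ ↔ _
    rw [h.step_eq_iff]
    simp
  comparable i x := by
    simp only [h.perm_apply, h.lt_step_iff, h.step_lt_iff, h.step_eq_iff]
    tauto
  rank_act i x hx := h.step_up hx
  act_le_act i x y hxy hx hy := by
    rw [Fin.le_def] at *
    rw [h.perm_apply, h.perm_apply, h.step_up hx, h.step_up hy]
    omega
  exists_descent x y hxy := by
    rw [Fin.lt_def] at hxy
    have hd : chainStep lab (lab (y.1 - 1)) y < y := by
      rw [h.step_lt_iff]
      exact ⟨by omega, rfl⟩
    refine ⟨⟨lab (y.1 - 1), hlab _ (by omega)⟩, hd, ?_⟩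
    rw [h.perm_apply, Fin.le_def, h.step_down hd]
    omega
  order := order
  comm i j x hij hx := by
    have hx' := (h.lt_step_iff j.1 x).1 hx
    simp only [h.perm_apply]
    rw [h.lt_step_iff, h.lt_step_iff, h.step_up hx]
    have h1 := comm j i (M.symmetric j i ▸ hij) x.1
    refine ⟨fun h2 => absurd h2.2 (h1 h2.1 hx'.2), fun h2 => ?_⟩
    have : i = j := Fin.ext (h2.2.symm.trans hx'.2)
    rw [this, M.diagonal] at hij
    omega
  braid₃ i j x hij hx := by
    have hx' := (h.lt_step_iff i.1 x).1 hx
    have hne : i.1 ≠ j.1 := fun e => by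
      rw [Fin.ext e, M.diagonal] at hij
      omega
    simp only [h.perm_apply] at *
    have hu := h.step_up hx
    rcases braid₃ i j hij x.1 hx'.1 hx'.2 with ⟨h1, h2, h3⟩ | ⟨h1, h2, h3⟩
    · have h4 : chainStep lab i.1 x < chainStep lab j.1 (chainStep lab i.1 x) := by
        rw [h.lt_step_iff, hu]
        exact h1
      refine Or.inl ⟨?_, h4, ?_⟩
      · rw [h.step_eq_iff]
        exact ⟨fun h' => hne (hx'.2.symm.trans h'.2), fun h' => h2 h'.1 h'.2⟩
      · rw [h.step_eq_iff, h.step_up h4, hu]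
        exact ⟨fun h' => h3 h'.1 h'.2, fun h' => hne (h'.2.symm.trans h1.2)⟩
    · have h4 : chainStep lab j.1 x < x := by
        rw [h.step_lt_iff]
        exact h1
      refine Or.inr ⟨h4, ?_, ?_⟩
      · rw [h.step_eq_iff, hu]
        exact ⟨fun h' => h2 h'.1 h'.2, fun h' => hne (hx'.2.symm.trans h'.2)⟩
      · rw [h.step_eq_iff, h.step_down h4]
        exact ⟨fun h' => hne (h'.2.symm.trans h1.2), fun h' => h3 (by omega) h'.2⟩
  braid₄ i j x hij hx := by
    have hx' := (h.lt_step_iff i.1 x).1 hx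
    have hne : i.1 ≠ j.1 := fun e => by
      rw [Fin.ext e, M.diagonal] at hij
      omega
    simp only [h.perm_apply] at *
    have hu := h.step_up hx
    rcases braid₄ i j hij x.1 hx'.1 hx'.2 with h1 | ⟨h1, h2, h3, h4, h5⟩
    · left
      rw [h.lt_step_iff, hu]
      exact h1
    · have h6 : chainStep lab j.1 x < x := by
        rw [h.step_lt_iff]
        exact ⟨by omega, h3⟩
      have h7 : chainStep lab i.1 (chainStep lab j.1 x) < chainStep lab j.1 x := by
        rw [h.step_lt_iff, h.step_down h6]
        exact ⟨by omega, h4⟩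
      refine Or.inr ⟨?_, h6, h7, ?_⟩
      · rw [h.step_eq_iff, hu]
        exact ⟨fun h' => h1 h'.1 h'.2, fun h' => hne (hx'.2.symm.trans h'.2)⟩
      · rw [h.step_eq_iff, h.step_down h7, h.step_down h6]
        exact ⟨fun h' => hne (h4.symm.trans h'.2), fun h' => h5 (by omega) h'.2⟩

end IsChainLabelling

theorem CosetModel.bruhatEdge_iff {B : Type} {M : CoxeterMatrix B} {J : Set B} {X : Type}
    [PartialOrder X] (𝓜 : CosetModel M J X) (α β : CosetRep M J) : BruhatEdge M J α β ↔
      ∃ i, 𝓜.equiv α < 𝓜.act i (𝓜.equiv α) ∧ 𝓜.equiv β = 𝓜.act i (𝓜.equiv α) :=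
  exists_congr fun i => 𝓜.labelledEdge_iff i α β

/-- Preserving successors gives g k = g 0 + k, and g (N - 1) < N then forces g 0 = 0. -/
theorem perm_fin_eq_refl {N : ℕ} (g : Equiv.Perm (Fin N))
    (h : ∀ x y : Fin N, y.1 = x.1 + 1 ↔ (g y).1 = (g x).1 + 1) : g = Equiv.refl _ := by
  rcases Nat.eq_zero_or_pos N with rfl | hN
  · exact Subsingleton.elim _ _
  have key : ∀ k (hk : k < N), (g ⟨k, hk⟩).1 = (g ⟨0, hN⟩).1 + k := by
    intro k
    induction k with
    | zero => intro _; rfl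
    | succ k ih =>
      intro hk
      rw [(h ⟨k, by omega⟩ ⟨k + 1, hk⟩).1 rfl, ih]
      rfl
  have h0 := key (N - 1) (by omega)
  have h1 := (g ⟨N - 1, by omega⟩).2
  ext x
  have := key x.1 x.2
  simp only [Fin.eta, Equiv.refl_apply] at *
  omega

end ParabolicKL

/-! ### The models of types B and A, and their folding -/

namespace ParabolicKL

theorem typeA_apply (m : ℕ) (i j : Fin m) : CoxeterMatrix.A m i j =
    if i.1 = j.1 then 1 else if j.1 + 1 = i.1 ∨ i.1 + 1 = j.1 then 3 else 2 := by
  change (if i = j then 1 else if j.1 + 1 = i.1 ∨ i.1 + 1 = j.1 then 3 else 2) = _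
  simp only [Fin.ext_iff]

/-- The labels of the Bruhat graph of type `(B_n, B_{n-1})`. -/
def labelB (n k : ℕ) : ℕ := min k (2 * n - 2 - k)

/-- The labels of the Bruhat graph of type `(A_{2n-1}, A_{2n-2})`, if the parabolic omits the
node `e`. -/
def labelA (n e k : ℕ) : ℕ := if e = 0 then k else 2 * n - 2 - k

theorem isChainLabelling_labelB (n : ℕ) : IsChainLabelling (2 * n) (labelB n) := by
  intro k hk
  unfold labelB
  omega

theorem isChainLabelling_labelA (n e : ℕ) : IsChainLabelling (2 * n) (labelA n e) := by
  intro k hk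
  unfold labelA
  split_ifs <;> omega

/-- The diagram of type `C_n` with exactly one label `∧` or `∨` that belongs to a point of the
chain. -/
def chainDiagramB (n : ℕ) (x : Fin (2 * n)) : Diagram n := fun p =>
  if p.1 = n then .circ else if p.1 = x.1 then .up
  else if p.1 + x.1 + 1 = 2 * n then .down else .circ

theorem chainDiagramB_injective (n : ℕ) : Function.Injective (chainDiagramB n) := by
  intro x y h
  have h1 := congrFun h ⟨min x.1 (2 * n - 1 - x.1), by omega⟩
  simp only [chainDiagramB] at h1
  ext
  split_ifs at h1 <;> omega

/-- Along the chain a single ∧ travels from entry 0 to entry n - 1, is flipped there and returns as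
∨. Hence the labels 0, …, n - 1, …, 0 of `labelB`. -/
theorem chainDiagramB_perm (n : ℕ) (i : Fin n) (x : Fin (2 * n)) :
    chainDiagramB n ((isChainLabelling_labelB n).perm i.1 x) =
      actC n i (chainDiagramB n x) := by
  obtain ⟨i, hi⟩ := i
  change chainDiagramB n (chainStep (labelB n) i x) = actC n ⟨i, hi⟩ (chainDiagramB n x)
  funext ⟨p, hp⟩
  rw [actC_val]
  have hc := (isChainLabelling_labelB n).step_cases i x
  simp only [chainDiagramB]
  generalize (chainStep (labelB n) i x).1 = y at hc ⊢
  obtain ⟨x, hx⟩ := x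
  unfold labelB at hc
  dsimp only at hc ⊢
  split_ifs <;> first | rfl | omega

/-- The diagram with exactly one label `∧` that belongs to a point of the chain. -/
def chainDiagramA (n e : ℕ) (x : Fin (2 * n)) : Diagram (2 * n) := fun p =>
  if p.1 = (if e = 0 then x.1 else 2 * n - 1 - x.1) then .up else .circ

theorem chainDiagramA_injective (n e : ℕ) : Function.Injective (chainDiagramA n e) := by
  intro x y h
  have h1 := congrFun h ⟨if e = 0 then x.1 else 2 * n - 1 - x.1, by split_ifs <;> omega⟩
  simp only [chainDiagramA] at h1
  ext
  split_ifs at h1 <;> omega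

theorem chainDiagramA_perm (n e i : ℕ) (hi : i + 1 < 2 * n) (x : Fin (2 * n)) :
    chainDiagramA n e ((isChainLabelling_labelA n e).perm i x) =
      actC (2 * n) ⟨i, by omega⟩ (chainDiagramA n e x) := by
  change chainDiagramA n e (chainStep (labelA n e) i x) = _
  funext ⟨p, hp⟩
  rw [actC_val]
  have hc := (isChainLabelling_labelA n e).step_cases i x
  simp only [chainDiagramA]
  generalize (chainStep (labelA n e) i x).1 = y at hc ⊢
  obtain ⟨x, hx⟩ := x
  unfold labelA at hc
  dsimp only at hc ⊢
  simp only [hi, if_true]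
  split_ifs at hc ⊢ <;> first | rfl | omega

/-- The nodes of type B_{2n} other than the last one span a graph of type A_{2n-1}, so the relations
follow from those of `actC (2 * n)`. -/
theorem isLiftable_A (n e : ℕ) :
    (CoxeterMatrix.A (2 * n - 1)).IsLiftable fun i => (isChainLabelling_labelA n e).perm i.1 := by
  have hg : (CoxeterMatrix.A (2 * n - 1)).IsLiftable fun i =>
      (actC_actC (2 * n) ⟨i.1, by omega⟩).toPerm := by
    intro i j
    have hn : 2 ≤ 2 * n := by have := i.2; omega
    have h := isLiftable_actC (2 * n) ⟨i.1, by omega⟩ ⟨j.1, by omega⟩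
    rw [typeB_apply (2 * n) hn] at h
    rw [typeA_apply]
    dsimp only at h
    rwa [if_neg (show ¬ (i.1 + 1 = 2 * n ∧ j.1 + 2 = 2 * n ∨ j.1 + 1 = 2 * n ∧ i.1 + 2 = 2 * n) by
      omega)] at h
  exact isLiftable_of_injective hg (chainDiagramA_injective n e)
    fun i x => chainDiagramA_perm n e i.1 (by omega) x

/-- The model of type `(B_n, B_{n-1})`. -/
def modelB (n : ℕ) (hn : 2 ≤ n) :
    CosetModel (CoxeterMatrix.B n) (nodesB n) (Fin (2 * n)) :=
  (isChainLabelling_labelB n).model _ _ (by omega)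
    (by unfold labelB; omega)
    (isLiftable_of_injective (isLiftable_actC n) (chainDiagramB_injective n)
      (chainDiagramB_perm n))
    (by
      intro i
      simp only [nodesB, labelB, Set.mem_ofPred_eq]
      omega)
    (by
      intro i j hij
      rw [typeB_apply n hn, if_neg (Fin.val_ne_of_ne hij)]
      split_ifs <;> simp)
    (by
      intro i j h k
      rw [typeB_apply n hn] at h
      unfold labelB
      split_ifs at h <;> omega)
    (by
      intro i j h k
      rw [typeB_apply n hn] at h
      unfold labelB
      split_ifs at h <;> omega)
    (by
      intro i j h k
      rw [typeB_apply n hn] at h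
      unfold labelB
      split_ifs at h <;> omega)

/-- The model of type `(A_{2n-1}, A_{2n-2})`. -/
def modelA (n : ℕ) (hn : 2 ≤ n) (e : Fin (2 * n - 1)) (he : e.1 = 0 ∨ e.1 = 2 * n - 2) :
    CosetModel (CoxeterMatrix.A (2 * n - 1)) {k | k ≠ e} (Fin (2 * n)) :=
  (isChainLabelling_labelA n e.1).model _ _ (by omega)
    (by unfold labelA; split_ifs <;> omega)
    (isLiftable_A n e.1)
    (by
      intro i
      simp only [labelA, Set.mem_ofPred_eq, Fin.ext_iff, ne_eq]
      split_ifs <;> omega)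
    (by
      intro i j hij
      rw [typeA_apply, if_neg (Fin.val_ne_of_ne hij)]
      split_ifs <;> simp)
    (by
      intro i j h k
      rw [typeA_apply] at h
      unfold labelA
      split_ifs at h ⊢ <;> omega)
    (by
      intro i j h k
      rw [typeA_apply] at h
      unfold labelA
      split_ifs at h ⊢ <;> omega)
    (by
      intro i j h k
      rw [typeA_apply] at h
      split_ifs at h <;> omega)

theorem modelB_act (n : ℕ) (hn : 2 ≤ n) (i : Fin n) (x : Fin (2 * n)) :
    (modelB n hn).act i x = chainStep (labelB n) i.1 x := rfl

theorem modelA_act (n : ℕ) (hn : 2 ≤ n) (e : Fin (2 * n - 1)) (he : e.1 = 0 ∨ e.1 = 2 * n - 2)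
    (i : Fin (2 * n - 1)) (x : Fin (2 * n)) :
    (modelA n hn e he).act i x = chainStep (labelA n e.1) i.1 x := rfl

theorem chainStep_ne_iff {N : ℕ} {lab : ℕ → ℕ} (h : IsChainLabelling N lab) (i : ℕ) (x : Fin N) :
    chainStep lab i x ≠ x ↔
      (x.1 + 1 < N ∧ lab x.1 = i) ∨ (0 < x.1 ∧ lab (x.1 - 1) = i) := by
  rw [ne_eq, h.step_eq_iff]
  tauto

/-- The folding reflects the graph of A_{2n-1} in its middle node n - 1. The map is injective on the
labels of the at most two edges at a point, because neighbouring edges of the chain also have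
different labels in type B. Both choices of the end node e give the same folded labels. -/
theorem isFolding_BA (n : ℕ) (hn : 2 ≤ n) (e : Fin (2 * n - 1))
    (he : e.1 = 0 ∨ e.1 = 2 * n - 2) :
    IsFolding (modelB n hn) (modelA n hn e he)
      (fun k : Fin (2 * n - 1) => ⟨min k.1 (2 * n - 2 - k.1), by omega⟩) where
  act_eq k x h := by
    rw [modelA_act, chainStep_ne_iff (isChainLabelling_labelA n e.1)] at h
    rw [modelB_act, modelA_act]
    have h1 := (isChainLabelling_labelA n e.1).step_cases k.1 x
    have h2 := (isChainLabelling_labelB n).step_cases (min k.1 (2 * n - 2 - k.1)) x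
    ext
    unfold labelA at h
    generalize (chainStep (labelA n e.1) _ x).1 = y at h1 ⊢
    dsimp only
    generalize (chainStep (labelB n) _ x).1 = z at h2 ⊢
    unfold labelA at h1
    unfold labelB at h2
    split_ifs at h h1 <;> omega
  exists_act i x h := by
    rw [modelB_act, chainStep_ne_iff (isChainLabelling_labelB n)] at h
    simp only [modelA_act, chainStep_ne_iff (isChainLabelling_labelA n e.1), Fin.ext_iff]
    unfold labelB at h
    unfold labelA
    rcases h with h | h
    · refine ⟨⟨if e.1 = 0 then x.1 else 2 * n - 2 - x.1, by split_ifs <;> omega⟩, ?_, Or.inl ?_⟩ <;>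
        dsimp only <;> split_ifs <;> omega
    · refine ⟨⟨if e.1 = 0 then x.1 - 1 else 2 * n - 2 - (x.1 - 1), by split_ifs <;> omega⟩, ?_,
        Or.inr ?_⟩ <;> dsimp only <;> split_ifs <;> omega
  eq_of_act k l x h hk hl := by
    rw [modelA_act, chainStep_ne_iff (isChainLabelling_labelA n e.1)] at hk hl
    have h' := congrArg Fin.val h
    dsimp only at h'
    unfold labelA at hk hl
    ext
    split_ifs at hk hl <;> omega

theorem bruhatEdge_chain_iff {B : Type} {M : CoxeterMatrix B} {J : Set B} {N : ℕ}
    (𝓜 : CosetModel M J (Fin N)) {lab : ℕ → ℕ} (h : IsChainLabelling N lab) (f : B → ℕ)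
    (hact : ∀ i x, 𝓜.act i x = chainStep lab (f i) x)
    (hf : ∀ k, k + 1 < N → ∃ i, f i = lab k) (α β : CosetRep M J) :
    BruhatEdge M J α β ↔ (𝓜.equiv β).1 = (𝓜.equiv α).1 + 1 := by
  simp only [𝓜.bruhatEdge_iff, hact]
  constructor
  · rintro ⟨i, h1, h2⟩
    rw [h2, h.step_up h1]
  · intro h1
    have h2 := (𝓜.equiv β).2
    obtain ⟨i, hi⟩ := hf (𝓜.equiv α).1 (by omega)
    have h3 : 𝓜.equiv α < chainStep lab (f i) (𝓜.equiv α) := by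
      rw [h.lt_step_iff]
      exact ⟨by omega, hi.symm⟩
    exact ⟨i, h3, Fin.ext (h1.trans (h.step_up h3).symm)⟩

theorem klMatrix_BA (n : ℕ) (hn : 2 ≤ n) (e : Fin (2 * n - 1))
    (he : e.1 = 0 ∨ e.1 = 2 * n - 2) :
    ∃ ψ : CosetB n ≃ CosetA (2 * n - 1) e,
      (∀ χ : CosetB n ≃ CosetA (2 * n - 1) e,
        (∀ lam μ : CosetB n, BruhatEdge _ _ lam μ ↔ BruhatEdge _ _ (χ lam) (χ μ)) ↔ χ = ψ) ∧
      ∀ (t : ∀ μ : CosetB n, ReducedPath μ)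
        (t' : ∀ μ : CosetA (2 * n - 1) e, ReducedPath μ) (lam μ : CosetB n),
        klMatrix t lam μ = klMatrix t' (ψ lam) (ψ μ) := by
  have hB := bruhatEdge_chain_iff (modelB n hn) (isChainLabelling_labelB n) Fin.val
    (modelB_act n hn) fun k hk => ⟨⟨labelB n k, by unfold labelB; omega⟩, rfl⟩
  have hA := bruhatEdge_chain_iff (modelA n hn e he) (isChainLabelling_labelA n e.1) Fin.val
    (modelA_act n hn e he)
    fun k hk => ⟨⟨labelA n e.1 k, by unfold labelA; split_ifs <;> omega⟩, rfl⟩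
  refine ⟨(modelB n hn).equiv.trans (modelA n hn e he).equiv.symm, fun χ => ⟨fun h => ?_, ?_⟩,
    fun t t' lam μ => ?_⟩
  · have hg := perm_fin_eq_refl
      ((modelB n hn).equiv.symm.trans (χ.trans (modelA n hn e he).equiv)) fun x y => by
        have := h ((modelB n hn).equiv.symm x) ((modelB n hn).equiv.symm y)
        rw [hB, hA, Equiv.apply_symm_apply, Equiv.apply_symm_apply] at this
        exact this
    ext lam : 1
    have := congrArg (fun g => g ((modelB n hn).equiv lam)) hg
    simp only [Equiv.trans_apply, Equiv.symm_apply_apply, Equiv.refl_apply] at this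
    rw [Equiv.trans_apply, Equiv.eq_symm_apply, this]
  · rintro rfl lam μ
    rw [hB, hA, Equiv.trans_apply, Equiv.trans_apply, Equiv.apply_symm_apply,
      Equiv.apply_symm_apply]
  · have := (isFolding_BA n hn e he).klMatrix_eq (fun i j _ => by
      rw [typeA_apply]
      split_ifs <;> omega) t t' ((modelB n hn).equiv lam) ((modelB n hn).equiv μ)
    rwa [Equiv.symm_apply_apply, Equiv.symm_apply_apply] at this

end ParabolicKL

theorem mainTheorem8 (n : ℕ) (hn : 2 ≤ n) :
    (∃ φ : ParabolicKL.CosetC n ≃ ParabolicKL.CosetD n,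
      (∀ (lam : ParabolicKL.CosetC n) (ν : ParabolicKL.CosetD n),
        ParabolicKL.diagramD n ν.1 = ParabolicKL.paritySpec (ParabolicKL.diagramC n lam.1) ↔
          ν = φ lam) ∧
      ∀ (t : ∀ μ : ParabolicKL.CosetC n, ParabolicKL.ReducedPath μ)
        (t' : ∀ μ : ParabolicKL.CosetD n, ParabolicKL.ReducedPath μ)
        (lam μ : ParabolicKL.CosetC n),
        ParabolicKL.klMatrix t lam μ = ParabolicKL.klMatrix t' (φ lam) (φ μ)) ∧
    (∀ e : Fin (2 * n - 1), (e : ℕ) = 0 ∨ (e : ℕ) = 2 * n - 2 →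
      ∃ ψ : ParabolicKL.CosetB n ≃ ParabolicKL.CosetA (2 * n - 1) e,
        (∀ χ : ParabolicKL.CosetB n ≃ ParabolicKL.CosetA (2 * n - 1) e,
          (∀ lam μ : ParabolicKL.CosetB n,
            ParabolicKL.BruhatEdge _ _ lam μ ↔ ParabolicKL.BruhatEdge _ _ (χ lam) (χ μ)) ↔
              χ = ψ) ∧
        ∀ (t : ∀ μ : ParabolicKL.CosetB n, ParabolicKL.ReducedPath μ)
          (t' : ∀ μ : ParabolicKL.CosetA (2 * n - 1) e, ParabolicKL.ReducedPath μ)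
          (lam μ : ParabolicKL.CosetB n),
          ParabolicKL.klMatrix t lam μ = ParabolicKL.klMatrix t' (ψ lam) (ψ μ)) :=
  ⟨ParabolicKL.klMatrix_CD n hn, fun e he => ParabolicKL.klMatrix_BA n hn e he⟩
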